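/- Let $n\ge 0$ and let $\lambda_0<\lambda_1<\dots<\lambda_n$ be real numbers. \emph{Matrices and groups.} Let $M_{\mathrm{St}_n,\lambda}$ (resp. $M^{\mathbb R}_{\mathrm{St}_n,\lambda}$) be the space of Hermitian (resp. real symmetric) arrow matrices $A=(a_{ij})_{0\le i,j\le n}$ (that is, $a_{ij}=0$ for distinct $i,j\ge 1$) with eigenvalues $\lambda_0,\dots,\lambda_n$; write $a_i=a_{ii}$, $b_i=a_{0i}$. The torus $T^n$ acts by conjugation with the matrices $\mathrm{diag}(1,t_1,\dots,t_n)$, $|t_i|=1$, and $\Sigma_n$ acts by simultaneous permutations of the rows and columns $1,\dots,n$; together they give an action of $\mathcal N_n=T^n\rtimes\Sigma_n$ on $M_{\mathrm{St}_n,\lambda}$, and, with $t_i=\pm1$, an action of the Weyl group $\mathcal N_n^{\mathbb R}=\mathbb Z_2^n\rtimes\Sigma_n$ on $M^{\mathbb R}_{\mathrm{St}_n,\lambda}$. Let $Q_n=M_{\mathrm{St}_n,\lambda}/T^n$, with the induced action of $\Sigma_n=\mathcal N_n/T^n$. The smooth structure of $Q_n$ is the one given by the invariants $[A]\mapsto(a_0,\dots,a_n,|b_1|^2,\dots,|b_n|^2)\in\mathbb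 R^{2n+1}$. Let $\tilde\mu\colon Q_n\to\mathbb R^n$, $[A]\mapsto(a_1,\dots,a_n)$. Put $I_j=[\lambda_{j-1},\lambda_j]$, $I^n_\sigma=I_{\sigma(1)}\times\dots\times I_{\sigma(n)}$ for $\sigma\in\Sigma_n$, and $\mathcal R_n=\bigcup_{\sigma}I^n_\sigma$. \emph{Polytope.} In $I^n=[-1,1]^n$ let $F_{\sigma_i}=\{x_i=1,\ x_{i+1}=-1\}$, $1\le i\le n-1$, and let $\mathcal B^n$ be the simple polytope obtained from $I^n$ by cutting all the codimension-two faces $F_{\sigma_i}$, realized as $$\mathcal B^n=\{x\in[-1,1]^n:\ x_i-x_{i+1}\le 2-\varepsilon,\ 1\le i\le n-1\},\qquad 0<\varepsilon<1 .$$ The blow-up of $I^n$ along the $F_{\sigma_i}$ is the set of $(x,t)\in I^n\times[0,1]^{n-1}$ with $t_i(1+x_{i+1})=(1-t_i)(1-x_i)$ for all $i$. A map $\beta\colon\mathcal B^n\to I^n$ is said to blow down the cut faces if it is the composition of a diffeomorphism of $\mathcal B^n$ onto this blow-up with the projection $(x,t)\mapsto x$, the preimage of each $F_{\sigma_i}$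 is the facet $\{x_i-x_{i+1}=2-\varepsilon\}$ of $\mathcal B^n$ created by the $i$-th cut, and each facet $\{x_k=\pm1\}$ of $\mathcal B^n$ is mapped onto the facet $\{x_k=\pm1\}$ of $I^n$. (Maps between subsets of Euclidean spaces are smooth if they extend locally to smooth maps of the ambient spaces; a diffeomorphism is a homeomorphism smooth in both directions.) \emph{Fundamental domain.} A map $\varphi\colon\mathcal B^n\to X$ makes $\mathcal B^n$ a fundamental domain of an action of a group $G$ on $X$ if $\varphi$ is a closed topological embedding, every $G$-orbit meets $\varphi(\mathcal B^n)$, and whenever $g\varphi(p)=\varphi(q)$ with $p$ in the interior of $\mathcal B^n$, or with $\varphi(p)$ in the topological interior of $\varphi(\mathcal B^n)$ in $X$, one has $g=1$. \textbf{Proposition.} The image of $\tilde\mu$ is $\mathcal R_n$, and for every $\varepsilon\in(0,1)$ and every $\sigma\in\Sigma_n$ there are a diffeomorphism $\Phi\colon\mathcal B^n\to\tilde\mu^{-1}(I^n_\sigma)\subset Q_n$ and maps $\Psi\colon\mathcal B^n\to M_{\mathrm{St}_n,\lambda}$, $\Psi^{\mathbb R}\colon\mathcal B^n\to M^{\mathbb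 R}_{\mathrm{St}_n,\lambda}$ such that 1. $\tilde\mu\circ\Phi\colon\mathcal B^n\to I^n_\sigma$ blows down the cut faces, where $I^n_\sigma$ is identified with $[-1,1]^n$ by letting $x_j$ be the coordinate $a_{\sigma^{-1}(j)}\in I_j$, rescaled increasingly and affinely from $I_j$ to $[-1,1]$; 2. $\Psi$ is a lift of $\Phi$, i.e. $[\Psi(x)]=\Phi(x)$ for all $x$, and $\Psi(x)=\Psi^{\mathbb R}(x)$ as complex matrices for all $x$; 3. by means of $\Phi$, $\Psi$ and $\Psi^{\mathbb R}$ respectively, $\mathcal B^n$ is a fundamental domain of the $\Sigma_n$-action on $Q_n$, of the $\mathcal N_n$-action on $M_{\mathrm{St}_n,\lambda}$, and of the $\mathcal N_n^{\mathbb R}$-action on $M^{\mathbb R}_{\mathrm{St}_n,\lambda}$. -/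

import Mathlib

open scoped ContDiff Topology

noncomputable section

namespace ArrowMatrix

/-! ### Isospectral arrow matrices and the groups acting on them

Everything is written for `𝕜 = ℂ` (Hermitian matrices, torus `Tⁿ`) and `𝕜 = ℝ` (real symmetric
matrices, group `ℤ₂ⁿ`) simultaneously. -/

/-- The Hermitian (symmetric if `𝕜 = ℝ`) `(n+1) × (n+1)` matrices with zeroes outside the main
diagonal, row `0` and column `0`, whose eigenvalues are `lam 0, …, lam n`. -/
def isospectral (𝕜 : Type) [RCLike 𝕜] {n : ℕ} (lam : Fin (n + 1) → ℝ) :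
    Set (Matrix (Fin (n + 1)) (Fin (n + 1)) 𝕜) :=
  {A | A.IsHermitian ∧ (∀ i j : Fin n, i ≠ j → A i.succ j.succ = 0) ∧
    A.charpoly = ∏ i, (Polynomial.X - Polynomial.C (lam i : 𝕜))}

/-- The space of isospectral arrow matrices: `M_{St_n, λ}` for `𝕜 = ℂ`, `M_{St_n, λ}^ℝ` for
`𝕜 = ℝ`. -/
abbrev M (𝕜 : Type) [RCLike 𝕜] {n : ℕ} (lam : Fin (n + 1) → ℝ) : Type := ↥(isospectral 𝕜 lam)

/-- The group of tuples `(t₁, …, tₙ)` of elements of `𝕜` of absolute value one: the torus `Tⁿ` for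
`𝕜 = ℂ`, and `{±1}ⁿ = ℤ₂ⁿ` for `𝕜 = ℝ`. -/
abbrev Torus (𝕜 : Type) [RCLike 𝕜] (n : ℕ) : Type := Fin n → unitary 𝕜

/-- The semidirect product of the torus with the symmetric group `Σₙ`, which permutes
coordinates: `𝒩ₙ = Tⁿ ⋊ Σₙ` for `𝕜 = ℂ`, and the Weyl group `ℤ₂ⁿ ⋊ Σₙ` of type `B` for `𝕜 = ℝ`. -/
abbrev N (𝕜 : Type) [RCLike 𝕜] (n : ℕ) : Type :=
  SemidirectProduct (Torus 𝕜 n) (Equiv.Perm (Fin n)) mulAutArrow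

variable {𝕜 : Type} [RCLike 𝕜] {n : ℕ} {lam : Fin (n + 1) → ℝ}

/-- The diagonal `(1, t₁, …, tₙ)` of a torus element. -/
def phase (t : Torus 𝕜 n) : Fin (n + 1) → 𝕜 := Fin.cons 1 (fun i => (t i : 𝕜))

/-- The permutation of `{0, …, n}` which fixes `0` and permutes the leaves `1, …, n` of the star by
`s`. -/
def leafPerm (s : Equiv.Perm (Fin n)) : Equiv.Perm (Fin (n + 1)) where
  toFun := Fin.cons 0 (fun i => (s i).succ)
  invFun := Fin.cons 0 (fun i => (s.symm i).succ)
  left_inv i := by refine Fin.cases ?_ (fun i => ?_) i <;> simp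
  right_inv i := by refine Fin.cases ?_ (fun i => ?_) i <;> simp

theorem phase_zero (t : Torus 𝕜 n) : phase t 0 = 1 := rfl

theorem phase_succ (t : Torus 𝕜 n) (i : Fin n) : phase t i.succ = (t i : 𝕜) := rfl

theorem leafPerm_symm_zero (s : Equiv.Perm (Fin n)) : (leafPerm s).symm 0 = 0 := rfl

theorem leafPerm_symm_succ (s : Equiv.Perm (Fin n)) (i : Fin n) :
    (leafPerm s).symm i.succ = (s⁻¹ i).succ := rfl

theorem mulAutArrow_apply (s : Equiv.Perm (Fin n)) (t : Torus 𝕜 n) (i : Fin n) :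
    (mulAutArrow s t : Torus 𝕜 n) i = t (s⁻¹ i) := rfl

/-- `(t, s)` acts on matrices by `A ↦ D_t P_s A P_s⁻¹ D_t⁻¹`. -/
def conj (g : N 𝕜 n) (A : Matrix (Fin (n + 1)) (Fin (n + 1)) 𝕜) :
    Matrix (Fin (n + 1)) (Fin (n + 1)) 𝕜 :=
  Matrix.diagonal (phase g.left) * A.submatrix (leafPerm g.right).symm (leafPerm g.right).symm *
    Matrix.diagonal (star (phase g.left))

theorem conj_apply (g : N 𝕜 n) (A : Matrix (Fin (n + 1)) (Fin (n + 1)) 𝕜) (i j : Fin (n + 1)) :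
    conj g A i j = phase g.left i *
      A ((leafPerm g.right).symm i) ((leafPerm g.right).symm j) * star (phase g.left j) := by
  simp [conj, Matrix.diagonal_mul, Matrix.mul_diagonal]

theorem phase_mul_star (t : Torus 𝕜 n) : phase t * star (phase t) = 1 := by
  funext i
  refine Fin.cases ?_ (fun i => ?_) i
  · simp [phase]
  · simpa [phase] using Unitary.coe_mul_star_self (t i)

theorem conj_mem (g : N 𝕜 n) {A : Matrix (Fin (n + 1)) (Fin (n + 1)) 𝕜}
    (hA : A ∈ isospectral 𝕜 lam) : conj g A ∈ isospectral 𝕜 lam := by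
  obtain ⟨h1, h2, h3⟩ := hA
  refine ⟨?_, ?_, ?_⟩
  · ext i j
    have := congrFun (congrFun h1 ((leafPerm g.right).symm i)) ((leafPerm g.right).symm j)
    rw [Matrix.conjTranspose_apply] at this
    rw [Matrix.conjTranspose_apply, conj_apply, conj_apply, ← this]
    simp only [star_mul, star_star]
    ring
  · intro i j hij
    have : A ((leafPerm g.right).symm i.succ) ((leafPerm g.right).symm j.succ) = 0 :=
      h2 (g.right.symm i) (g.right.symm j) (by simpa using hij)
    rw [conj_apply, this]
    simp
  · have hD' : Matrix.diagonal (star (phase g.left)) * Matrix.diagonal (phase g.left) = 1 := by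
      rw [Matrix.diagonal_mul_diagonal, ← Matrix.diagonal_one]
      exact congrArg _ ((mul_comm _ _).trans (phase_mul_star g.left))
    have hB : (A.submatrix (leafPerm g.right).symm (leafPerm g.right).symm).charpoly =
        ∏ i, (Polynomial.X - Polynomial.C (lam i : 𝕜)) := by
      rw [← h3, ← Matrix.charpoly_reindex (leafPerm g.right) A, Matrix.reindex_apply]
    rw [← hB]
    rw [conj, Matrix.charpoly_mul_comm, ← Matrix.mul_assoc, hD', Matrix.one_mul]

/-- The action of `𝒩ₙ` on the isospectral arrow matrices. -/
instance instMulActionN : MulAction (N 𝕜 n) (M 𝕜 lam) where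
  smul g A := ⟨conj g A.1, conj_mem g A.2⟩
  one_smul A := by
    apply Subtype.ext
    ext i j
    change conj 1 A.1 i j = A.1 i j
    rw [conj_apply]
    refine Fin.cases ?_ (fun i => ?_) i <;> refine Fin.cases ?_ (fun j => ?_) j <;>
      simp [phase_zero, phase_succ, leafPerm_symm_zero, leafPerm_symm_succ]
  mul_smul g h A := by
    apply Subtype.ext
    ext i j
    change conj (g * h) A.1 i j = conj g (conj h A.1) i j
    simp only [conj_apply]
    refine Fin.cases ?_ (fun i => ?_) i <;> refine Fin.cases ?_ (fun j => ?_) j <;>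
      simp only [phase_zero, phase_succ, leafPerm_symm_zero, leafPerm_symm_succ,
        SemidirectProduct.mul_left, SemidirectProduct.mul_right, Pi.mul_apply, Submonoid.coe_mul,
        mul_inv_rev, Equiv.Perm.mul_apply, star_mul, star_one, one_mul, mul_one,
        mulAutArrow_apply, mul_assoc]

/-- The torus acts as the normal subgroup `Tⁿ` of `𝒩ₙ`. -/
instance instMulActionTorus : MulAction (Torus 𝕜 n) (M 𝕜 lam) :=
  MulAction.compHom (M 𝕜 lam) (SemidirectProduct.inl : Torus 𝕜 n →* N 𝕜 n)

/-- The orbit space `Qₙ = M_{St_n, λ} / Tⁿ` (with the quotient topology). -/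
abbrev Q (𝕜 : Type) [RCLike 𝕜] {n : ℕ} (lam : Fin (n + 1) → ℝ) : Type :=
  Quotient (MulAction.orbitRel (Torus 𝕜 n) (M 𝕜 lam))

/-- The orbit of a matrix. -/
def orb (A : M 𝕜 lam) : Q 𝕜 lam := Quotient.mk _ A

theorem inr_smul_inl_smul (s : Equiv.Perm (Fin n)) (t : Torus 𝕜 n) (A : M 𝕜 lam) :
    (SemidirectProduct.inr s : N 𝕜 n) • (t • A) =
      (mulAutArrow s t : Torus 𝕜 n) • ((SemidirectProduct.inr s : N 𝕜 n) • A) := by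
  change (SemidirectProduct.inr s : N 𝕜 n) • ((SemidirectProduct.inl t : N 𝕜 n) • A) =
    (SemidirectProduct.inl (mulAutArrow s t) : N 𝕜 n) • ((SemidirectProduct.inr s : N 𝕜 n) • A)
  rw [smul_smul, smul_smul, SemidirectProduct.inl_aut]
  simp [mul_assoc]

/-- The remaining action of `Σₙ = 𝒩ₙ / Tⁿ` on the orbit space `Qₙ`: the class of a matrix `A` is
sent to the class of `P_s A P_s⁻¹`. -/
instance instMulActionPerm : MulAction (Equiv.Perm (Fin n)) (Q 𝕜 lam) where
  smul s := Quotient.map (fun A => (SemidirectProduct.inr s : N 𝕜 n) • A) (by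
    rintro A B ⟨t, rfl⟩
    exact ⟨mulAutArrow s t, (inr_smul_inl_smul s t B).symm⟩)
  one_smul q := by
    induction q using Quotient.inductionOn with
    | h A => exact congrArg (Quotient.mk _) (by simp)
  mul_smul s r q := by
    induction q using Quotient.inductionOn with
    | h A => exact congrArg (Quotient.mk _) (by simp [mul_smul])

/-! ### Invariants, the moment map and the cubes -/

theorem torus_smul_apply (t : Torus 𝕜 n) (A : M 𝕜 lam) (i j : Fin (n + 1)) :
    (t • A).1 i j = phase t i * A.1 i j * star (phase t j) := by
  change conj (SemidirectProduct.inl t) A.1 i j = _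
  rw [conj_apply]
  refine Fin.cases ?_ (fun i => ?_) i <;> refine Fin.cases ?_ (fun j => ?_) j <;>
    simp [phase_zero, phase_succ, leafPerm_symm_zero, leafPerm_symm_succ]

theorem norm_phase (t : Torus 𝕜 n) (i : Fin (n + 1)) : ‖phase t i‖ = 1 := by
  have h := congrFun (phase_mul_star t) i
  have h2 := congrArg norm h
  simp only [Pi.mul_apply, Pi.star_apply, norm_mul, norm_star, Pi.one_apply, norm_one] at h2
  nlinarith [norm_nonneg (phase t i)]

theorem torus_smul_diag (t : Torus 𝕜 n) (A : M 𝕜 lam) (i : Fin (n + 1)) :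
    (t • A).1 i i = A.1 i i := by
  have h := congrFun (phase_mul_star t) i
  simp only [Pi.mul_apply, Pi.star_apply, Pi.one_apply] at h
  rw [torus_smul_apply, mul_right_comm, h, one_mul]

/-- The torus invariants `(a₀, …, aₙ)` and `(|b₁|², …, |bₙ|²)` of an arrow matrix with diagonal `a`
and row zero `(a₀, b₁, …, bₙ)`, as a map on the orbit space.  It identifies `Qₙ` with a subset of
`ℝⁿ⁺¹ × ℝⁿ`, and defines the smooth structure of `Qₙ` : the orbit space of a locally standard
action is a manifold with corners modelled on `ℂᵏ / Tᵏ = [0, ∞)ᵏ`, where the identification is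
`z ↦ (|z₁|², …, |z_k|²)`. -/
def invariants : Q 𝕜 lam → (Fin (n + 1) → ℝ) × (Fin n → ℝ) :=
  Quotient.lift (fun A => (fun i => RCLike.re (A.1 i i), fun i => ‖A.1 0 i.succ‖ ^ 2)) (by
    rintro A B ⟨t, rfl⟩
    have h : ∀ i, (t • B).1 i i = B.1 i i := torus_smul_diag t B
    have h' : ∀ i j, ‖(t • B).1 i j‖ = ‖B.1 i j‖ := fun i j => by
      rw [torus_smul_apply]; simp [norm_phase]
    simp only [h, h'])

/-- The map `μ̃` induced on the orbit space by the diagonal, `[A] ↦ (a₁, …, aₙ)`.  (The remaining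
diagonal entry is determined by these, `a₀ = ∑ λᵢ - ∑ aᵢ`.) -/
def moment (q : Q 𝕜 lam) : Fin n → ℝ := fun i => (invariants q).1 i.succ

/-- The cube `I_{s(1)} × ⋯ × I_{s(n)}`, where `I_j = [λ_{j-1}, λ_j]`. -/
def cubeAt (lam : Fin (n + 1) → ℝ) (s : Equiv.Perm (Fin n)) : Set (Fin n → ℝ) :=
  {a | ∀ k, a k ∈ Set.Icc (lam (s k).castSucc) (lam (s k).succ)}

/-- The affine identification of the cube `I_{s(1)} × ⋯ × I_{s(n)}` with `[-1, 1]ⁿ`: the `j`-th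
coordinate of the image is the coordinate lying in `I_j = [λ_{j-1}, λ_j]`, rescaled to
`[-1, 1]`. -/
def standardize (lam : Fin (n + 1) → ℝ) (s : Equiv.Perm (Fin n)) (a : Fin n → ℝ) : Fin n → ℝ :=
  fun j => (2 * a (s.symm j) - lam j.castSucc - lam j.succ) / (lam j.succ - lam j.castSucc)

/-! ### The polytope -/

/-- The indices `i = 1, …, n - 1` of the neighbouring transpositions `(i, i+1)`. -/
abbrev Cut (n : ℕ) : Type := {i : Fin n // (i : ℕ) + 1 < n}

/-- The index `i`. -/
def Cut.lo (i : Cut n) : Fin n := i.1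

/-- The index `i + 1`. -/
def Cut.hi (i : Cut n) : Fin n := ⟨(i.1 : ℕ) + 1, i.2⟩

/-- The cube `[-1, 1]ⁿ`. -/
def cube (n : ℕ) : Set (Fin n → ℝ) := {x | ∀ k, x k ∈ Set.Icc (-1 : ℝ) 1}

/-- The facet `{x_k = δ}` of the cube, `δ = ±1`. -/
def cubeFacet (δ : ℤˣ) (k : Fin n) : Set (Fin n → ℝ) := {x ∈ cube n | x k = ((δ : ℤ) : ℝ)}

/-- The codimension-two face `{x_i = 1, x_{i+1} = -1}` of the cube. -/
def codimTwoFace (i : Cut n) : Set (Fin n → ℝ) := cubeFacet 1 i.lo ∩ cubeFacet (-1) i.hi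

/-- The polytope `ℬⁿ`: the cube with all faces `{x_i = 1, x_{i+1} = -1}` cut off at depth `ε`.
The functional `x_i - x_{i+1}` is `2` on the vertices of this face, and at most `0` on all the other
vertices of the cube.  For `0 < ε < 1` the cuts at `i` and `i + 1` do not meet, so
each cutting hyperplane also separates the vertices of its face from the other vertices after the
other faces have been cut, and the combinatorial type does not depend on `ε`. -/
def B (n : ℕ) (ε : ℝ) : Set (Fin n → ℝ) :=
  {x ∈ cube n | ∀ i : Cut n, x i.lo - x i.hi ≤ 2 - ε}

/-- The facet of `ℬⁿ` obtained by cutting the face with index `i`. -/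
def cutFacet (ε : ℝ) (i : Cut n) : Set (Fin n → ℝ) := {x ∈ B n ε | x i.lo - x i.hi = 2 - ε}

/-- The facet of `ℬⁿ` which is contained in the facet `{x_k = δ}` of the cube. -/
def oldFacet (ε : ℝ) (δ : ℤˣ) (k : Fin n) : Set (Fin n → ℝ) := B n ε ∩ cubeFacet δ k

/-! ### Smooth maps and blow-downs -/

/-- `f` is smooth with respect to the coordinates `ι` on `X`: locally it is the composition of `ι`
with a smooth map on the ambient space.  If `ι` is the inclusion of a subset of `E` this is the
usual smoothness of maps on subsets of Euclidean spaces. -/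
def SmoothVia {X E F : Type*} [TopologicalSpace X] [NormedAddCommGroup E] [NormedSpace ℝ E]
    [NormedAddCommGroup F] [NormedSpace ℝ F] (ι : X → E) (f : X → F) : Prop :=
  ∀ x, ∃ g : E → F, ContDiff ℝ ∞ g ∧ ∀ᶠ y in 𝓝 x, f y = g (ι y)

/-- A homeomorphism which is smooth in both directions, with respect to the smooth structures given
by the coordinates `ι` and `κ`. -/
structure IsDiffeo {X Y E F : Type*} [TopologicalSpace X] [TopologicalSpace Y]
    [NormedAddCommGroup E] [NormedSpace ℝ E] [NormedAddCommGroup F] [NormedSpace ℝ F]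
    (ι : X → E) (κ : Y → F) (Φ : X ≃ₜ Y) : Prop where
  smooth : SmoothVia ι (κ ∘ Φ)
  smooth_symm : SmoothVia κ (ι ∘ Φ.symm)

/-- The real oriented blow-up of the cube along all the faces `{x_i = 1, x_{i+1} = -1}`: points of
the cube together with, for each `i`, a ratio `[1 - x_i : 1 + x_{i+1}] = [t_i : 1 - t_i]` of the
distances to the two facets meeting in that face. -/
def blowUp (n : ℕ) : Set ((Fin n → ℝ) × (Cut n → ℝ)) :=
  {p | p.1 ∈ cube n ∧ ∀ i : Cut n, p.2 i ∈ Set.Icc (0 : ℝ) 1 ∧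
    p.2 i * (1 + p.1 i.hi) = (1 - p.2 i) * (1 - p.1 i.lo)}

/-- `β` is a blow-down `ℬⁿ → [-1, 1]ⁿ` of the cut faces: up to a diffeomorphism of `ℬⁿ` with the
blow-up of the cube it is the projection of the blow-up; the points over a face
`{x_i = 1, x_{i+1} = -1}` form the facet of `ℬⁿ` obtained by cutting this face, and each other facet
of `ℬⁿ` is mapped onto the facet of the cube from which it comes. -/
structure IsBlowDown (ε : ℝ) (β : B n ε → Fin n → ℝ) : Prop where
  blow_up : ∃ Θ : B n ε ≃ₜ blowUp n,
    IsDiffeo (Subtype.val : B n ε → Fin n → ℝ)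
      (Subtype.val : blowUp n → (Fin n → ℝ) × (Cut n → ℝ)) Θ ∧
    ∀ x, β x = (Θ x).1.1
  cut : ∀ (i : Cut n) (x : B n ε), x.1 ∈ cutFacet ε i ↔ β x ∈ codimTwoFace i
  old : ∀ (δ : ℤˣ) (k : Fin n), β '' {x | x.1 ∈ oldFacet ε δ k} = cubeFacet δ k

/-! ### Fundamental domains -/

/-- The polytope `P` (a subset of `V`), placed in `X` by the map `φ`, is a fundamental domain of the
action of `G` on `X`: `φ` is a closed topological embedding, every orbit meets the domain, and
points that are interior (in the polytope, or in `X`) are not identified with any point of the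
domain, and have trivial stabilizers; so points of the domain are identified only along the
boundary.  The group may have positive dimension, so the domain may have empty interior in `X`. -/
structure IsFundamentalDomain (G : Type*) {X V : Type*} [Group G] [TopologicalSpace X]
    [MulAction G X] [TopologicalSpace V] (P : Set V) (φ : P → X) : Prop where
  embedding : Topology.IsClosedEmbedding φ
  covers : ∀ x : X, ∃ (g : G) (p : P), g • φ p = x
  interior_polytope : ∀ (g : G) (p q : P), p.1 ∈ interior P → g • φ p = φ q → g = 1
  interior_space : ∀ (g : G) (p q : P), φ p ∈ interior (Set.range φ) → g • φ p = φ q → g = 1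

end ArrowMatrix

end

noncomputable section

namespace ArrowMatrix

/-! ### Maps that are smooth with respect to coordinates -/

section Smooth

variable {X Y Z E F G : Type*} [TopologicalSpace X] [TopologicalSpace Y] [TopologicalSpace Z]
  [NormedAddCommGroup E] [NormedSpace ℝ E] [NormedAddCommGroup F] [NormedSpace ℝ F]
  [NormedAddCommGroup G] [NormedSpace ℝ G]

/-! The map `Φ` is a composition of two diffeomorphisms, from the polytope to the blow-up of the
cube and from the blow-up to the part of the orbit space over one cube.

Polytope to blow-up. For the cut `i` let `gap` be the sum of the distances `1 - x_i` and `1 +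
x_{i+1}` to the two facets that meet in the face; the polytope is `gap ≥ ε`. The blow-down keeps the
ratio of the two distances and replaces `gap` by `ρ(gap)`, where `ρ` is a diffeomorphism of the line
with `ρ(ε) = 0` and `ρ = id` on `[1, ∞)`. The inverse uses `κ = ρ⁻¹` in the same way. If `gap < 1`,
then `x_i > 0 > x_{i+1}`, so consecutive cuts are never active together and every coordinate is
moved by at most one cut.

Blow-up to orbit space. An arrow matrix with leaf diagonal `a` and `w_k = |b_k|²` has characteristic
polynomial `(x - a₀) ∏ (x - a_k) - ∑ w_k ∏_{l ≠ k} (x - a_l)`. If the `a_k` are distinct, the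
spectrum is prescribed exactly when `a₀` has the value forced by the trace and `w_j ∏_{l ≠ j} (a_j -
a_l) = -∏ (a_j - λ_i)` for all `j`. Over a cube, each `a_j - a_l` is paired with an endpoint of the
interval of `a_l`, which writes `w_j` as a product of nonnegative fractions (`weight_mul_prod`).
Only neighbouring entries can collide, at the common endpoint of their intervals, and the resulting
`0/0` is a smooth function of the blow-up coordinate (`split`). Hence the weights are smooth on the
blow-up, and they satisfy the spectral equation everywhere by density (`secular_weight`).
Conversely, at a collision the spectrum fixes only the sum of the two weights, and their ratio is
the missing blow-up coordinate (`exists_weight_eq`, `smoothViaAt_recover`). Torus orbits are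
separated by the invariants, and the entries `b_k = √w_k` give a real lift.

The image of the moment map is bounded by Cauchy interlacing (`exists_mem_cubeAt`) and filled by the
section over the blow-up. For the fundamental domains: over the interior of the polytope the `a_k`
lie in disjoint open intervals, which excludes permutations, and no `b_k` vanishes, which excludes
torus elements. Density of this interior gives the statement about the topological interior of the
image. -/

theorem SmoothVia.continuous {ι : X → E} {f : X → F} (h : SmoothVia ι f) (hι : Continuous ι) :
    Continuous f := by
  rw [continuous_iff_continuousAt]
  intro x
  obtain ⟨g, hg, hfg⟩ := h x
  exact ((hg.continuous.comp hι).continuousAt (x := x)).congr (hfg.mono fun y hy => hy.symm)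

theorem SmoothVia.comp {ι : X → E} {κ : Y → F} {f : Y → G} {Φ : X → Y}
    (hf : SmoothVia κ f) (hΦ : SmoothVia ι (κ ∘ Φ)) (hc : Continuous Φ) :
    SmoothVia ι (f ∘ Φ) := by
  intro x
  obtain ⟨g, hg, hfg⟩ := hf (Φ x)
  obtain ⟨k, hk, hfk⟩ := hΦ x
  refine ⟨g ∘ k, hg.comp hk, ?_⟩
  filter_upwards [hc.continuousAt.eventually hfg, hfk] with y h1 h2
  have h2' : κ (Φ y) = k (ι y) := h2
  simp only [Function.comp_apply, h1, h2']

theorem IsDiffeo.trans {ι : X → E} {κ : Y → F} {ν : Z → G} {Φ : X ≃ₜ Y} {Θ : Y ≃ₜ Z}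
    (hΦ : IsDiffeo ι κ Φ) (hΘ : IsDiffeo κ ν Θ) : IsDiffeo ι ν (Φ.trans Θ) :=
  ⟨hΘ.smooth.comp hΦ.smooth Φ.continuous,
    hΦ.smooth_symm.comp hΘ.smooth_symm Θ.symm.continuous⟩

/-- Multiplication by a cutoff. A bump function `f` supported in `U` with `f x = 1` need not be
constant near `x`, but `Real.smoothTransition (2 * f)` is `1` wherever `f ≥ 1/2`. -/
theorem exists_contDiff_eventuallyEq [FiniteDimensional ℝ E] {U : Set E} (hU : IsOpen U)
    {g : E → F} (hg : ∀ z ∈ U, ContDiffAt ℝ ∞ g z) {x : E} (hx : x ∈ U) :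
    ∃ g' : E → F, ContDiff ℝ ∞ g' ∧ g' =ᶠ[𝓝 x] g := by
  obtain ⟨f, hfU, -, hf, -, hfx⟩ := exists_contDiff_tsupport_subset (n := ⊤) (hU.mem_nhds hx)
  refine ⟨fun z => Real.smoothTransition (2 * f z) • g z, ?_, ?_⟩
  · rw [contDiff_iff_contDiffAt]
    intro z
    by_cases hz : z ∈ tsupport f
    · exact ((Real.smoothTransition.contDiff (n := ⊤)).comp
        (contDiff_const.mul hf)).contDiffAt.smul (hg z (hfU hz))
    · have h0 : (fun z => Real.smoothTransition (2 * f z) • g z) =ᶠ[𝓝 z] fun _ => 0 := by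
        filter_upwards [notMem_tsupport_iff_eventuallyEq.mp hz] with y hy
        simp [hy]
      exact contDiffAt_const.congr_of_eventuallyEq h0
  · have h1 : ∀ᶠ z in 𝓝 x, 1 / 2 < f z :=
      hf.continuous.continuousAt.eventually_const_lt (by rw [hfx]; norm_num)
    filter_upwards [h1] with z hz
    rw [Real.smoothTransition.one_of_one_le (by linarith), one_smul]

theorem smoothVia_of_local [FiniteDimensional ℝ E] {ι : X → E} (hι : Continuous ι) {f : X → F}
    (h : ∀ x, ∃ (U : Set E) (g : E → F), IsOpen U ∧ ι x ∈ U ∧ (∀ z ∈ U, ContDiffAt ℝ ∞ g z) ∧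
      ∀ᶠ y in 𝓝 x, f y = g (ι y)) : SmoothVia ι f := by
  intro x
  obtain ⟨U, g, hU, hx, hg, hfg⟩ := h x
  obtain ⟨g', hg', hgg'⟩ := exists_contDiff_eventuallyEq hU hg hx
  refine ⟨g', hg', ?_⟩
  filter_upwards [hfg, hι.continuousAt.eventually hgg'] with y h1 h2
  rw [h1, h2]

end Smooth

/-! ### A radial profile -/

/-- A pair of mutually inverse increasing diffeomorphisms of the line, the first of which moves `ε`
to `0` and is the identity on `[1, ∞)`. -/
structure IsProfile (ε : ℝ) (ρ κ : ℝ → ℝ) : Prop where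
  smooth : ContDiff ℝ ∞ ρ
  smooth_inv : ContDiff ℝ ∞ κ
  mono : StrictMono ρ
  left_inv : ∀ x, κ (ρ x) = x
  right_inv : ∀ x, ρ (κ x) = x
  map_eps : ρ ε = 0
  le_self : ∀ x, ρ x ≤ x
  eq_self : ∀ x, 1 ≤ x → ρ x = x

/-- Take `ρ x = x - ε χ(x)`, where the smooth antitone `χ` is `1` at `ε` and `0` on `[1, ∞)`. Then
`ρ' ≥ 1`, so the inverse is smooth too. -/
theorem exists_isProfile {ε : ℝ} (h0 : 0 < ε) (h1 : ε < 1) : ∃ ρ κ, IsProfile ε ρ κ := by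
  let χ : ℝ → ℝ := fun x => Real.smoothTransition ((1 - x) / (1 - ε))
  have hχ : ContDiff ℝ ∞ χ :=
    (Real.smoothTransition.contDiff (n := ⊤)).comp ((contDiff_const.sub contDiff_id).div_const _)
  have hanti : Antitone χ := fun x y hxy => Real.smoothTransition.monotone (by
    have : 0 < 1 - ε := by linarith
    gcongr)
  let ρ : ℝ → ℝ := fun x => x - ε * χ x
  have hρ : ContDiff ℝ ∞ ρ := contDiff_id.sub (contDiff_const.mul hχ)
  have hmono : StrictMono ρ := fun x y hxy => by
    have := mul_le_mul_of_nonneg_left (hanti hxy.le) h0.le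
    simp only [ρ]; linarith
  have hle : ∀ x, ρ x ≤ x := fun x => by
    have := mul_nonneg h0.le (Real.smoothTransition.nonneg ((1 - x) / (1 - ε)))
    simp only [ρ, χ]; linarith
  have hge : ∀ x, x - ε ≤ ρ x := fun x => by
    have := mul_le_mul_of_nonneg_left (Real.smoothTransition.le_one ((1 - x) / (1 - ε))) h0.le
    simp only [ρ, χ]; linarith
  have hsurj : Function.Surjective ρ := hρ.continuous.surjective
    (Filter.tendsto_atTop_mono hge (Filter.tendsto_atTop_add_const_right _ _ Filter.tendsto_id))
    (Filter.tendsto_atBot_mono hle Filter.tendsto_id)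
  let e : ℝ ≃ₜ ℝ := (hmono.orderIsoOfSurjective ρ hsurj).toHomeomorph
  have hderiv : ∀ x, HasDerivAt ρ (deriv ρ x) x := fun x =>
    (hρ.differentiable (by simp)).differentiableAt.hasDerivAt
  have hne : ∀ x, deriv ρ x ≠ 0 := fun x => by
    have hd : deriv ρ x = 1 - ε * deriv χ x := by
      have := ((hasDerivAt_id x).sub
        (((hχ.differentiable (by simp)).differentiableAt (x := x)).hasDerivAt.const_mul ε))
      exact this.deriv
    have := mul_nonpos_of_nonneg_of_nonpos h0.le (hanti.deriv_nonpos (x := x))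
    rw [hd]; linarith
  refine ⟨ρ, e.symm, hρ, e.contDiff_symm_deriv hne hderiv hρ, hmono, e.symm_apply_apply,
    e.apply_symm_apply, ?_, hle, ?_⟩
  · have : (1 - ε) / (1 - ε) = 1 := div_self (by linarith)
    simp [ρ, χ, this]
  · intro x hx
    have : (1 - x) / (1 - ε) ≤ 0 := div_nonpos_of_nonpos_of_nonneg (by linarith) (by linarith)
    simp [ρ, χ, Real.smoothTransition.zero_of_nonpos this]

theorem IsProfile.inv_mono {ε : ℝ} {ρ κ : ℝ → ℝ} (h : IsProfile ε ρ κ) : StrictMono κ := by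
  intro x y hxy
  rwa [← h.mono.lt_iff_lt, h.right_inv, h.right_inv]

/-! ### The polytope and the blow-up of the cube -/

section Polytope

variable {n : ℕ}

theorem smoothVia_of_eventually {X E F : Type*} [TopologicalSpace X]
    [NormedAddCommGroup E] [NormedSpace ℝ E] [NormedAddCommGroup F] [NormedSpace ℝ F]
    [FiniteDimensional ℝ E] {ι : X → E} (hι : Continuous ι) {f : X → F}
    (h : ∀ x, ∃ g : E → F, (∀ᶠ z in 𝓝 (ι x), ContDiffAt ℝ ∞ g z) ∧
      ∀ᶠ y in 𝓝 x, f y = g (ι y)) : SmoothVia ι f := by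
  refine smoothVia_of_local hι fun x => ?_
  obtain ⟨g, hg, hfg⟩ := h x
  obtain ⟨U, hU, hUo, hxU⟩ := eventually_nhds_iff.mp hg
  exact ⟨U, g, hUo, hxU, hU, hfg⟩

theorem Cut.lo_injective : Function.Injective (Cut.lo (n := n)) := Subtype.val_injective

theorem Cut.hi_injective : Function.Injective (Cut.hi (n := n)) := fun i j h => by
  have := congrArg Fin.val h
  exact Subtype.ext (Fin.ext (by simpa [Cut.hi] using this))

/-- The value of `v` at the cut with lower index `k`, and zero if there is none. -/
def lowSum (v : Cut n → ℝ) (k : Fin n) : ℝ := ∑ i : Cut n, if i.lo = k then v i else 0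

/-- The value of `v` at the cut with upper index `k`, and zero if there is none. -/
def highSum (v : Cut n → ℝ) (k : Fin n) : ℝ := ∑ i : Cut n, if i.hi = k then v i else 0

theorem lowSum_lo (v : Cut n → ℝ) (i : Cut n) : lowSum v i.lo = v i := by
  simp [lowSum, Cut.lo_injective.eq_iff]

theorem highSum_hi (v : Cut n → ℝ) (i : Cut n) : highSum v i.hi = v i := by
  simp [highSum, Cut.hi_injective.eq_iff]

theorem lowSum_eq_zero {v : Cut n → ℝ} {k : Fin n} (h : ∀ i : Cut n, i.lo = k → v i = 0) :
    lowSum v k = 0 :=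
  Finset.sum_eq_zero fun i _ => by split_ifs with hi; exacts [h i hi, rfl]

theorem highSum_eq_zero {v : Cut n → ℝ} {k : Fin n} (h : ∀ i : Cut n, i.hi = k → v i = 0) :
    highSum v k = 0 :=
  Finset.sum_eq_zero fun i _ => by split_ifs with hi; exacts [h i hi, rfl]

theorem lowSum_nonneg {v : Cut n → ℝ} (h : ∀ i, 0 ≤ v i) (k : Fin n) : 0 ≤ lowSum v k :=
  Finset.sum_nonneg fun i _ => by split_ifs; exacts [h i, le_rfl]

theorem highSum_nonneg {v : Cut n → ℝ} (h : ∀ i, 0 ≤ v i) (k : Fin n) : 0 ≤ highSum v k :=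
  Finset.sum_nonneg fun i _ => by split_ifs; exacts [h i, le_rfl]

theorem contDiffAt_lowSum {E : Type*} [NormedAddCommGroup E] [NormedSpace ℝ E]
    {v : E → Cut n → ℝ} {z : E} (h : ∀ i, ContDiffAt ℝ ∞ (fun z => v z i) z) (k : Fin n) :
    ContDiffAt ℝ ∞ (fun z => lowSum (v z) k) z :=
  ContDiffAt.sum fun i _ => by split_ifs; exacts [h i, contDiffAt_const]

theorem contDiffAt_highSum {E : Type*} [NormedAddCommGroup E] [NormedSpace ℝ E]
    {v : E → Cut n → ℝ} {z : E} (h : ∀ i, ContDiffAt ℝ ∞ (fun z => v z i) z) (k : Fin n) :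
    ContDiffAt ℝ ∞ (fun z => highSum (v z) k) z :=
  ContDiffAt.sum fun i _ => by split_ifs; exacts [h i, contDiffAt_const]

/-- The sum of the distances from `x` to the two facets which meet in the face with index `i`. -/
def gap (x : Fin n → ℝ) (i : Cut n) : ℝ := 2 - x i.lo + x i.hi

theorem contDiff_gap (i : Cut n) : ContDiff ℝ ∞ (fun x : Fin n → ℝ => gap x i) :=
  (contDiff_const.sub (contDiff_apply ℝ ℝ i.lo)).add (contDiff_apply ℝ ℝ i.hi)

/-- A cut pair of coordinates near its face, i.e. with `gap < 1`, is disjoint from the neighbouring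
such pairs. -/
theorem lo_ne_hi_of_gap_lt {x : Fin n → ℝ} (hx : x ∈ cube n) {i j : Cut n} (hi : gap x i < 1)
    (hj : gap x j < 1) : i.lo ≠ j.hi := by
  intro h
  have h1 := (hx i.hi).1
  have h2 := (hx j.lo).2
  simp only [gap] at hi hj
  rw [← h] at hj
  linarith

theorem one_lt_gap_of_lo_neg {x : Fin n → ℝ} (hx : x ∈ cube n) {i : Cut n} (h : x i.lo < 0) :
    1 < gap x i := by
  have := (hx i.hi).1
  simp only [gap]; linarith

theorem one_lt_gap_of_hi_pos {x : Fin n → ℝ} (hx : x ∈ cube n) {i : Cut n} (h : 0 < x i.hi) :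
    1 < gap x i := by
  have := (hx i.lo).2
  simp only [gap]; linarith

theorem gap_nonneg {x : Fin n → ℝ} (hx : x ∈ cube n) (i : Cut n) : 0 ≤ gap x i := by
  have := (hx i.lo).2
  have := (hx i.hi).1
  simp only [gap]; linarith

theorem le_gap {ε : ℝ} {x : Fin n → ℝ} (hx : x ∈ B n ε) (i : Cut n) : ε ≤ gap x i := by
  have := hx.2 i
  simp only [gap]; linarith

/-- The ratio in which the distances to the two facets divide their sum. -/
def ratio (x : Fin n → ℝ) (i : Cut n) : ℝ := (1 - x i.lo) / gap x i

/-! ### Displacements with disjoint supports -/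

section Perturb

/-- The common shape of the blow-down and of its inverse: if `u i ≠ 0` only when
`gap x i < 1`, then moving `x` by `u i` in the direction `(r i, r i - 1)` moves each coordinate at
most once. -/
theorem perturb_cases {x : Fin n → ℝ} (hx : x ∈ cube n) {u : Cut n → ℝ}
    (hu : ∀ i, u i ≠ 0 → gap x i < 1) (k : Fin n) :
    ((∀ i : Cut n, i.lo = k → u i = 0) ∧ ∀ i : Cut n, i.hi = k → u i = 0) ∨
    (∃ i : Cut n, i.lo = k ∧ u i ≠ 0 ∧ ∀ j : Cut n, j.hi = k → u j = 0) ∨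
    (∃ i : Cut n, i.hi = k ∧ u i ≠ 0 ∧ ∀ j : Cut n, j.lo = k → u j = 0) := by
  by_cases h1 : ∀ i : Cut n, i.lo = k → u i = 0
  · by_cases h2 : ∀ i : Cut n, i.hi = k → u i = 0
    · exact Or.inl ⟨h1, h2⟩
    · push Not at h2
      obtain ⟨i, hi, hui⟩ := h2
      exact Or.inr (Or.inr ⟨i, hi, hui, h1⟩)
  · push Not at h1
    obtain ⟨i, hi, hui⟩ := h1
    refine Or.inr (Or.inl ⟨i, hi, hui, fun j hj => ?_⟩)
    by_contra h
    exact lo_ne_hi_of_gap_lt hx (hu i hui) (hu j h) (hi.trans hj.symm)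

/-- The coordinate `i.lo` could only be moved a second time by the preceding cut, which is inactive
while cut `i` is active. -/
theorem perturb_lo {x : Fin n → ℝ} (hx : x ∈ cube n) {u : Cut n → ℝ}
    (hu : ∀ i, u i ≠ 0 → gap x i < 1) {i : Cut n} (hi : u i ≠ 0) (r : Cut n → ℝ) :
    highSum (fun j => r j * u j) i.lo = 0 :=
  highSum_eq_zero fun j hj => by
    by_contra h
    exact lo_ne_hi_of_gap_lt hx (hu i hi) (hu j fun h' => h (by simp [h'])) hj.symm

theorem perturb_hi {x : Fin n → ℝ} (hx : x ∈ cube n) {u : Cut n → ℝ}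
    (hu : ∀ i, u i ≠ 0 → gap x i < 1) {i : Cut n} (hi : u i ≠ 0) (r : Cut n → ℝ) :
    lowSum (fun j => r j * u j) i.hi = 0 :=
  lowSum_eq_zero fun j hj => by
    by_contra h
    exact lo_ne_hi_of_gap_lt hx (hu j fun h' => h (by simp [h'])) (hu i hi) hj

end Perturb

/-! #### From the polytope to the blow-up -/

/-- The displacement of the distance to the face with index `i`. -/
def shift (ρ : ℝ → ℝ) (x : Fin n → ℝ) (i : Cut n) : ℝ := gap x i - ρ (gap x i)

/-- The blow-down map. -/
def down (ρ : ℝ → ℝ) (x : Fin n → ℝ) (k : Fin n) : ℝ :=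
  x k + lowSum (fun i => ratio x i * shift ρ x i) k -
    highSum (fun i => (1 - ratio x i) * shift ρ x i) k

/-- The distance to the lower facet, before the displacement towards the face with index `i`. -/
def lowDist (ρ : ℝ → ℝ) (x : Fin n → ℝ) (i : Cut n) : ℝ :=
  1 - x i.lo + highSum (fun i => (1 - ratio x i) * shift ρ x i) i.lo

/-- The distance to the upper facet, before the displacement towards the face with index `i`. -/
def highDist (ρ : ℝ → ℝ) (x : Fin n → ℝ) (i : Cut n) : ℝ :=
  1 + x i.hi + lowSum (fun i => ratio x i * shift ρ x i) i.hi

/-- The ratio of the distances to the facets, as a coordinate of the blow-up. -/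
def angle (ρ : ℝ → ℝ) (x : Fin n → ℝ) (i : Cut n) : ℝ :=
  lowDist ρ x i / (lowDist ρ x i + highDist ρ x i)

/-- The displacement which undoes `shift`. -/
def unshift (κ : ℝ → ℝ) (y : Fin n → ℝ) (i : Cut n) : ℝ := κ (gap y i) - gap y i

/-- The inverse of the blow-down map on the blow-up. -/
def up (κ : ℝ → ℝ) (y : Fin n → ℝ) (t : Cut n → ℝ) (k : Fin n) : ℝ :=
  y k - lowSum (fun i => t i * unshift κ y i) k + highSum (fun i => (1 - t i) * unshift κ y i) k

section Down

variable {ε : ℝ} {ρ κ : ℝ → ℝ} {x : Fin n → ℝ}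

theorem IsProfile.inv_eq_self (h : IsProfile ε ρ κ) {s : ℝ} (hs : 1 ≤ s) : κ s = s := by
  conv_lhs => rw [← h.eq_self s hs, h.left_inv]

theorem IsProfile.inv_zero (h : IsProfile ε ρ κ) : κ 0 = ε := by rw [← h.map_eps, h.left_inv]

variable (h : IsProfile ε ρ κ)
include h

theorem shift_nonneg (x : Fin n → ℝ) (i : Cut n) : 0 ≤ shift ρ x i :=
  sub_nonneg.mpr (h.le_self _)

theorem gap_lt_one_of_shift_ne_zero {i : Cut n} (hi : shift ρ x i ≠ 0) : gap x i < 1 := by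
  by_contra hc
  exact hi (by rw [shift, h.eq_self _ (not_lt.mp hc), sub_self])

end Down

section Down

variable {ε : ℝ} {ρ κ : ℝ → ℝ} {x : Fin n → ℝ} (h : IsProfile ε ρ κ) (h0 : 0 < ε)
  (hx : x ∈ B n ε)
include h0 hx

theorem gap_pos (i : Cut n) : 0 < gap x i := h0.trans_le (le_gap hx i)

theorem ratio_mul_gap (i : Cut n) : ratio x i * gap x i = 1 - x i.lo :=
  div_mul_cancel₀ _ (gap_pos h0 hx i).ne'

theorem one_sub_ratio_mul_gap (i : Cut n) : (1 - ratio x i) * gap x i = 1 + x i.hi := by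
  have := ratio_mul_gap h0 hx i
  rw [sub_mul, this, gap]; ring

theorem ratio_nonneg (i : Cut n) : 0 ≤ ratio x i :=
  div_nonneg (by linarith [(hx.1 i.lo).2]) (gap_pos h0 hx i).le

theorem ratio_le_one (i : Cut n) : ratio x i ≤ 1 := by
  have h1 := one_sub_ratio_mul_gap h0 hx i
  have h2 := (hx.1 i.hi).1
  have h3 := gap_pos h0 hx i
  by_contra hc
  nlinarith [mul_neg_of_neg_of_pos (show 1 - ratio x i < 0 by linarith) h3]

include h

omit h0 in
theorem map_gap_nonneg (i : Cut n) : 0 ≤ ρ (gap x i) := by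
  rw [← h.map_eps]; exact h.mono.monotone (le_gap hx i)

/-- At an active cut no neighbour interferes, so the distance `ratio * gap` is simply rescaled to
`ratio * ρ gap`. -/
theorem one_sub_down_lo {i : Cut n} (hi : shift ρ x i ≠ 0) :
    1 - down ρ x i.lo = ratio x i * ρ (gap x i) := by
  rw [down, lowSum_lo,
    perturb_lo hx.1 (fun i => gap_lt_one_of_shift_ne_zero h) hi (fun i => 1 - ratio x i), shift]
  linarith [ratio_mul_gap h0 hx i]

theorem one_add_down_hi {i : Cut n} (hi : shift ρ x i ≠ 0) :
    1 + down ρ x i.hi = (1 - ratio x i) * ρ (gap x i) := by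
  rw [down, highSum_hi, perturb_hi hx.1 (fun i => gap_lt_one_of_shift_ne_zero h) hi, shift]
  linarith [one_sub_ratio_mul_gap h0 hx i]

theorem gap_down_of_shift_ne_zero {i : Cut n} (hi : shift ρ x i ≠ 0) :
    gap (down ρ x) i = ρ (gap x i) := by
  have h1 := one_sub_down_lo h h0 hx hi
  have h2 := one_add_down_hi h h0 hx hi
  rw [gap]; linarith

omit h0 hx in
theorem map_gap_lt_one {i : Cut n} (hi : shift ρ x i ≠ 0) : ρ (gap x i) < 1 :=
  (h.le_self _).trans_lt (gap_lt_one_of_shift_ne_zero h hi)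

theorem down_lo_pos {i : Cut n} (hi : shift ρ x i ≠ 0) : 0 < down ρ x i.lo := by
  have h1 := one_sub_down_lo h h0 hx hi
  have h2 := mul_le_of_le_one_left (map_gap_nonneg h hx i) (ratio_le_one h0 hx i)
  linarith [map_gap_lt_one h hi]

theorem down_hi_neg {i : Cut n} (hi : shift ρ x i ≠ 0) : down ρ x i.hi < 0 := by
  have h1 := one_add_down_hi h h0 hx hi
  have h2 := mul_le_of_le_one_left (map_gap_nonneg h hx i)
    (sub_le_self 1 (ratio_nonneg h0 hx i))
  linarith [map_gap_lt_one h hi]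

omit h0 in
theorem down_cases (k : Fin n) :
    down ρ x k = x k ∨
    (∃ i : Cut n, i.lo = k ∧ shift ρ x i ≠ 0) ∨ (∃ i : Cut n, i.hi = k ∧ shift ρ x i ≠ 0) := by
  obtain ⟨h1, h2⟩ | ⟨i, hi, hi', -⟩ | ⟨i, hi, hi', -⟩ :=
    perturb_cases hx.1 (fun i => gap_lt_one_of_shift_ne_zero h (x := x) (i := i)) k
  · left
    rw [down, lowSum_eq_zero fun i hi => by rw [h1 i hi, mul_zero],
      highSum_eq_zero fun i hi => by rw [h2 i hi, mul_zero]]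
    ring
  · exact Or.inr (Or.inl ⟨i, hi, hi'⟩)
  · exact Or.inr (Or.inr ⟨i, hi, hi'⟩)

theorem down_mem_cube : down ρ x ∈ cube n := by
  intro k
  obtain hk | ⟨i, rfl, hi⟩ | ⟨i, rfl, hi⟩ := down_cases h hx k
  · rw [hk]; exact hx.1 k
  · have h1 := one_sub_down_lo h h0 hx hi
    have h2 := mul_nonneg (ratio_nonneg h0 hx i) (map_gap_nonneg h hx i)
    exact ⟨by linarith [down_lo_pos h h0 hx hi], by linarith⟩
  · have h1 := one_add_down_hi h h0 hx hi
    have h2 := mul_nonneg (sub_nonneg.mpr (ratio_le_one h0 hx i)) (map_gap_nonneg h hx i)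
    exact ⟨by linarith, by linarith [down_hi_neg h h0 hx hi]⟩

omit h h0 hx in
theorem lowDist_eq_down (i : Cut n) :
    lowDist ρ x i = 1 - down ρ x i.lo + ratio x i * shift ρ x i := by
  rw [lowDist, down, lowSum_lo]; ring

omit h h0 hx in
theorem highDist_eq_down (i : Cut n) :
    highDist ρ x i = 1 + down ρ x i.hi + (1 - ratio x i) * shift ρ x i := by
  rw [highDist, down, highSum_hi]; ring

theorem le_lowDist (i : Cut n) : 1 - x i.lo ≤ lowDist ρ x i :=
  le_add_of_nonneg_right (highSum_nonneg (fun j => mul_nonneg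
    (sub_nonneg.mpr (ratio_le_one h0 hx j)) (shift_nonneg h x j)) _)

theorem le_highDist (i : Cut n) : 1 + x i.hi ≤ highDist ρ x i :=
  le_add_of_nonneg_right (lowSum_nonneg (fun j => mul_nonneg
    (ratio_nonneg h0 hx j) (shift_nonneg h x j)) _)

theorem lowDist_nonneg (i : Cut n) : 0 ≤ lowDist ρ x i :=
  (by linarith [(hx.1 i.lo).2] : 0 ≤ 1 - x i.lo).trans (le_lowDist h h0 hx i)

theorem highDist_nonneg (i : Cut n) : 0 ≤ highDist ρ x i :=
  (by linarith [(hx.1 i.hi).1] : 0 ≤ 1 + x i.hi).trans (le_highDist h h0 hx i)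

/-- This keeps the denominator of `angle` away from zero even over the face, where the gap of the
image vanishes. The distances omit the cut's own displacement, and the neighbouring displacements
can only increase them. -/
theorem gap_le_dist (i : Cut n) : gap x i ≤ lowDist ρ x i + highDist ρ x i := by
  have h1 := le_lowDist h h0 hx i
  have h2 := le_highDist h h0 hx i
  rw [gap]; linarith

theorem dist_pos (i : Cut n) : 0 < lowDist ρ x i + highDist ρ x i :=
  (gap_pos h0 hx i).trans_le (gap_le_dist h h0 hx i)

theorem lowDist_of_shift_ne_zero {i : Cut n} (hi : shift ρ x i ≠ 0) :
    lowDist ρ x i = ratio x i * gap x i := by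
  rw [lowDist_eq_down, one_sub_down_lo h h0 hx hi, shift]; ring

theorem highDist_of_shift_ne_zero {i : Cut n} (hi : shift ρ x i ≠ 0) :
    highDist ρ x i = (1 - ratio x i) * gap x i := by
  rw [highDist_eq_down, one_add_down_hi h h0 hx hi, shift]; ring

theorem angle_of_shift_ne_zero {i : Cut n} (hi : shift ρ x i ≠ 0) : angle ρ x i = ratio x i := by
  have hg := (gap_pos h0 hx i).ne'
  rw [angle, lowDist_of_shift_ne_zero h h0 hx hi, highDist_of_shift_ne_zero h h0 hx hi, ← add_mul,
    add_sub_cancel, one_mul, mul_div_cancel_right₀ _ hg]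

theorem angle_mem (i : Cut n) : angle ρ x i ∈ Set.Icc (0 : ℝ) 1 := by
  have h1 := lowDist_nonneg h h0 hx i
  have h2 := highDist_nonneg h h0 hx i
  exact ⟨div_nonneg h1 (by linarith), div_le_one_of_le₀ (by linarith) (by linarith)⟩

/-- If cut `i` is inactive, `lowDist` and `highDist` are the true distances of the image to the two
facets and `angle` is their ratio. If it is active, both distances of the image are multiples of `ρ
(gap x i)` in the ratio `ratio x i`, which is then `angle`. -/
theorem down_mem_blowUp : (down ρ x, angle ρ x) ∈ blowUp n := by
  refine ⟨down_mem_cube h h0 hx, fun i => ⟨angle_mem h h0 hx i, ?_⟩⟩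
  change angle ρ x i * (1 + down ρ x i.hi) = (1 - angle ρ x i) * (1 - down ρ x i.lo)
  by_cases hi : shift ρ x i = 0
  · have h1 := lowDist_eq_down (ρ := ρ) (x := x) i
    have h2 := highDist_eq_down (ρ := ρ) (x := x) i
    have h3 := dist_pos h h0 hx i
    rw [hi, mul_zero, add_zero] at h1 h2
    rw [← h1, ← h2, angle]
    field_simp
    ring
  · rw [one_add_down_hi h h0 hx hi, one_sub_down_lo h h0 hx hi, angle_of_shift_ne_zero h h0 hx hi]
    ring

/-- The displacement can be read off from the image alone, which is what makes the blow-down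
invertible. -/
theorem unshift_down (i : Cut n) : unshift κ (down ρ x) i = shift ρ x i := by
  by_cases hi : shift ρ x i = 0
  · rw [hi, unshift, sub_eq_zero]
    -- Cut `i` is inactive. Either neither coordinate moves, or a neighbouring cut moves one of
    -- them; the sign which the latter leaves on the moved coordinate makes the new gap exceed `1`,
    -- where `κ` is the identity.
    obtain h1 | ⟨j, hj, hj'⟩ | ⟨j, hj, hj'⟩ := down_cases h hx i.lo
    · obtain h2 | ⟨j, hj, hj'⟩ | ⟨j, hj, hj'⟩ := down_cases h hx i.hi
      · have : gap (down ρ x) i = gap x i := by rw [gap, gap, h1, h2]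
        rw [this]
        conv_lhs => rw [sub_eq_zero.mp hi, h.left_inv]
      · refine h.inv_eq_self (one_lt_gap_of_hi_pos (down_mem_cube h h0 hx) ?_).le
        rw [← hj]; exact down_lo_pos h h0 hx hj'
      · rw [Cut.hi_injective hj] at hj'
        exact absurd hi hj'
    · rw [Cut.lo_injective hj] at hj'
      exact absurd hi hj'
    · refine h.inv_eq_self (one_lt_gap_of_lo_neg (down_mem_cube h h0 hx) ?_).le
      rw [← hj]; exact down_hi_neg h h0 hx hj'
  · rw [unshift, gap_down_of_shift_ne_zero h h0 hx hi, h.left_inv, shift]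

theorem up_down : up κ (down ρ x) (angle ρ x) = x := by
  have key : ∀ i, angle ρ x i * unshift κ (down ρ x) i = ratio x i * shift ρ x i := fun i => by
    rw [unshift_down h h0 hx]
    by_cases hi : shift ρ x i = 0
    · rw [hi, mul_zero, mul_zero]
    · rw [angle_of_shift_ne_zero h h0 hx hi]
  have key' : ∀ i, (1 - angle ρ x i) * unshift κ (down ρ x) i =
      (1 - ratio x i) * shift ρ x i := fun i => by
    rw [sub_mul, key, unshift_down h h0 hx]; ring
  funext k
  rw [up, funext key, funext key', down]
  ring

/-- The gap of the image vanishes only at an active cut with `ρ(gap) = 0`, that is `gap = ε`; at an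
inactive cut it is at least the old gap. -/
theorem mem_cutFacet_iff (i : Cut n) : x ∈ cutFacet ε i ↔ down ρ x ∈ codimTwoFace i := by
  have hgap : x ∈ cutFacet ε i ↔ gap x i = ε := by
    rw [gap]
    exact ⟨fun hc => by linarith [hc.2], fun hc => ⟨hx, by linarith⟩⟩
  have hface : down ρ x ∈ codimTwoFace i ↔ down ρ x i.lo = 1 ∧ down ρ x i.hi = -1 := by
    have := down_mem_cube h h0 hx
    simp [codimTwoFace, cubeFacet, this]
  rw [hgap, hface]
  constructor
  · intro hg
    have hi : shift ρ x i ≠ 0 := by rw [shift, hg, h.map_eps, sub_zero]; exact h0.ne'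
    have h1 := one_sub_down_lo h h0 hx hi
    have h2 := one_add_down_hi h h0 hx hi
    rw [hg, h.map_eps, mul_zero] at h1 h2
    exact ⟨by linarith, by linarith⟩
  · rintro ⟨h1, h2⟩
    by_cases hi : shift ρ x i = 0
    · have h3 := gap_le_dist h h0 hx i
      rw [lowDist_eq_down, highDist_eq_down, hi, h1, h2] at h3
      linarith [gap_pos h0 hx i]
    · have h3 := gap_down_of_shift_ne_zero h h0 hx hi
      rw [gap, h1, h2] at h3
      exact h.mono.injective (by rw [h.map_eps, ← h3]; norm_num)

theorem down_lt_one {k : Fin n} (hk : x k < 1) (hg : ∀ i, ε < gap x i) : down ρ x k < 1 := by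
  obtain hk' | ⟨i, rfl, hi⟩ | ⟨i, rfl, hi⟩ := down_cases h hx k
  · rwa [hk']
  · have h1 := one_sub_down_lo h h0 hx hi
    have h2 : 0 < ratio x i := div_pos (by linarith) (gap_pos h0 hx i)
    have h3 : 0 < ρ (gap x i) := by rw [← h.map_eps]; exact h.mono (hg i)
    linarith [mul_pos h2 h3]
  · linarith [down_hi_neg h h0 hx hi]

theorem neg_one_lt_down {k : Fin n} (hk : -1 < x k) (hg : ∀ i, ε < gap x i) :
    -1 < down ρ x k := by
  obtain hk' | ⟨i, rfl, hi⟩ | ⟨i, rfl, hi⟩ := down_cases h hx k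
  · rwa [hk']
  · linarith [down_lo_pos h h0 hx hi]
  · have h1 := one_add_down_hi h h0 hx hi
    have h2 : 0 < 1 - ratio x i := by
      have h3 := one_sub_ratio_mul_gap h0 hx i
      have h4 := gap_pos h0 hx i
      by_contra hc
      nlinarith [mul_nonpos_of_nonpos_of_nonneg (not_lt.mp hc) h4.le]
    have h3 : 0 < ρ (gap x i) := by rw [← h.map_eps]; exact h.mono (hg i)
    linarith [mul_pos h2 h3]

theorem down_eq_one {k : Fin n} (hk : x k = 1) : down ρ x k = 1 := by
  obtain hk' | ⟨i, rfl, hi⟩ | ⟨i, rfl, hi⟩ := down_cases h hx k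
  · rwa [hk']
  · have h1 := one_sub_down_lo h h0 hx hi
    rw [ratio, hk, sub_self, zero_div, zero_mul] at h1
    linarith
  · have h1 := one_lt_gap_of_hi_pos hx.1 (i := i) (by rw [hk]; norm_num)
    linarith [gap_lt_one_of_shift_ne_zero h hi]

theorem down_eq_neg_one {k : Fin n} (hk : x k = -1) : down ρ x k = -1 := by
  obtain hk' | ⟨i, rfl, hi⟩ | ⟨i, rfl, hi⟩ := down_cases h hx k
  · rwa [hk']
  · have h1 := one_lt_gap_of_lo_neg hx.1 (i := i) (by rw [hk]; norm_num)
    linarith [gap_lt_one_of_shift_ne_zero h hi]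
  · have h1 := one_add_down_hi h h0 hx hi
    have h2 := one_sub_ratio_mul_gap h0 hx i
    rw [hk, add_neg_cancel] at h2
    rw [(mul_eq_zero.mp h2).resolve_right (gap_pos h0 hx i).ne', zero_mul] at h1
    linarith

end Down

end Polytope

section Polytope

variable {n : ℕ}

/-! #### From the blow-up to the polytope -/

section Up

variable {ε : ℝ} {ρ κ : ℝ → ℝ} {y : Fin n → ℝ} {t : Cut n → ℝ}

theorem one_sub_lo_of_mem_blowUp (hy : (y, t) ∈ blowUp n) (i : Cut n) :
    1 - y i.lo = t i * gap y i := by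
  have : t i * (1 + y i.hi) = (1 - t i) * (1 - y i.lo) := (hy.2 i).2
  rw [gap]; linarith

theorem one_add_hi_of_mem_blowUp (hy : (y, t) ∈ blowUp n) (i : Cut n) :
    1 + y i.hi = (1 - t i) * gap y i := by
  have : t i * (1 + y i.hi) = (1 - t i) * (1 - y i.lo) := (hy.2 i).2
  rw [gap]; linarith

variable (h : IsProfile ε ρ κ)
include h

theorem gap_lt_one_of_unshift_ne_zero {i : Cut n} (hi : unshift κ y i ≠ 0) : gap y i < 1 := by
  by_contra hc
  exact hi (by rw [unshift, h.inv_eq_self (not_lt.mp hc), sub_self])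

theorem inv_gap_lt_one {i : Cut n} (hi : unshift κ y i ≠ 0) : κ (gap y i) < 1 := by
  rw [← h.inv_eq_self le_rfl]
  exact h.inv_mono (gap_lt_one_of_unshift_ne_zero h hi)

variable (hy : (y, t) ∈ blowUp n)
include hy

theorem le_inv_gap (i : Cut n) : ε ≤ κ (gap y i) := by
  rw [← h.inv_zero]
  exact h.inv_mono.monotone (gap_nonneg hy.1 i)

theorem one_sub_up_lo {i : Cut n} (hi : unshift κ y i ≠ 0) :
    1 - up κ y t i.lo = t i * κ (gap y i) := by
  have := perturb_lo hy.1 (fun i => gap_lt_one_of_unshift_ne_zero h) hi (fun i => 1 - t i)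
  rw [up, lowSum_lo, this, unshift]
  linarith [one_sub_lo_of_mem_blowUp hy i]

theorem one_add_up_hi {i : Cut n} (hi : unshift κ y i ≠ 0) :
    1 + up κ y t i.hi = (1 - t i) * κ (gap y i) := by
  have := perturb_hi hy.1 (fun i => gap_lt_one_of_unshift_ne_zero h) hi t
  rw [up, highSum_hi, this, unshift]
  linarith [one_add_hi_of_mem_blowUp hy i]

theorem gap_up_of_unshift_ne_zero {i : Cut n} (hi : unshift κ y i ≠ 0) :
    gap (up κ y t) i = κ (gap y i) := by
  have h1 := one_sub_up_lo h hy hi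
  have h2 := one_add_up_hi h hy hi
  rw [gap]; linarith

theorem up_cases (k : Fin n) :
    up κ y t k = y k ∨
    (∃ i : Cut n, i.lo = k ∧ unshift κ y i ≠ 0) ∨
      (∃ i : Cut n, i.hi = k ∧ unshift κ y i ≠ 0) := by
  obtain ⟨h1, h2⟩ | ⟨i, hi, hi', -⟩ | ⟨i, hi, hi', -⟩ :=
    perturb_cases hy.1 (fun i => gap_lt_one_of_unshift_ne_zero h (y := y) (i := i)) k
  · left
    rw [up, lowSum_eq_zero fun i hi => by rw [h1 i hi, mul_zero],
      highSum_eq_zero fun i hi => by rw [h2 i hi, mul_zero]]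
    ring
  · exact Or.inr (Or.inl ⟨i, hi, hi'⟩)
  · exact Or.inr (Or.inr ⟨i, hi, hi'⟩)

variable (h0 : 0 < ε)
include h0

theorem up_lo_pos {i : Cut n} (hi : unshift κ y i ≠ 0) : 0 < up κ y t i.lo := by
  have h1 := one_sub_up_lo h hy hi
  have h2 := mul_le_of_le_one_left (h0.le.trans (le_inv_gap h hy i)) (hy.2 i).1.2
  linarith [inv_gap_lt_one h hi]

theorem up_hi_neg {i : Cut n} (hi : unshift κ y i ≠ 0) : up κ y t i.hi < 0 := by
  have h1 := one_add_up_hi h hy hi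
  have h2 := mul_le_of_le_one_left (h0.le.trans (le_inv_gap h hy i))
    (sub_le_self 1 (hy.2 i).1.1)
  linarith [inv_gap_lt_one h hi]

theorem up_mem_cube : up κ y t ∈ cube n := by
  intro k
  obtain hk | ⟨i, rfl, hi⟩ | ⟨i, rfl, hi⟩ := up_cases h hy k
  · rw [hk]; exact hy.1 k
  · have h1 := one_sub_up_lo h hy hi
    have h2 := mul_nonneg (hy.2 i).1.1 (h0.le.trans (le_inv_gap h hy i))
    exact ⟨by linarith [up_lo_pos h hy h0 hi], by linarith⟩
  · have h1 := one_add_up_hi h hy hi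
    have h2 := mul_nonneg (sub_nonneg.mpr (hy.2 i).1.2) (h0.le.trans (le_inv_gap h hy i))
    exact ⟨by linarith, by linarith [up_hi_neg h hy h0 hi]⟩

/-- Away from the support of the displacement either nothing happens to a pair of coordinates, or
one of them is moved by a neighbouring displacement. -/
theorem gap_up_cases {i : Cut n} (hi : unshift κ y i = 0) :
    gap (up κ y t) i = gap y i ∨ 1 < gap (up κ y t) i := by
  obtain h1 | ⟨j, hj, hj'⟩ | ⟨j, hj, hj'⟩ := up_cases h hy i.lo
  · obtain h2 | ⟨j, hj, hj'⟩ | ⟨j, hj, hj'⟩ := up_cases h hy i.hi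
    · left; rw [gap, gap, h1, h2]
    · right
      refine one_lt_gap_of_hi_pos (up_mem_cube h hy h0) ?_
      rw [← hj]; exact up_lo_pos h hy h0 hj'
    · rw [Cut.hi_injective hj] at hj'
      exact absurd hi hj'
  · rw [Cut.lo_injective hj] at hj'
    exact absurd hi hj'
  · right
    refine one_lt_gap_of_lo_neg (up_mem_cube h hy h0) ?_
    rw [← hj]; exact up_hi_neg h hy h0 hj'

/-- Since `κ 0 = ε`, the inverse opens every gap to at least `ε`. A gap changed only by neighbouring
cuts exceeds `1`, and here `ε < 1` is needed. -/
theorem le_gap_up (h1 : ε < 1) (i : Cut n) : ε ≤ gap (up κ y t) i := by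
  by_cases hi : unshift κ y i = 0
  · obtain hg | hg := gap_up_cases h hy h0 hi
    · rw [hg, ← sub_eq_zero.mp hi]; exact le_inv_gap h hy i
    · exact h1.le.trans hg.le
  · rw [gap_up_of_unshift_ne_zero h hy hi]; exact le_inv_gap h hy i

theorem up_mem_B (h1 : ε < 1) : up κ y t ∈ B n ε :=
  ⟨up_mem_cube h hy h0, fun i => by
    have := le_gap_up h hy h0 h1 i
    rw [gap] at this; linarith⟩

theorem shift_up (i : Cut n) : shift ρ (up κ y t) i = unshift κ y i := by
  by_cases hi : unshift κ y i = 0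
  · rw [hi, shift, sub_eq_zero]
    obtain hg | hg := gap_up_cases h hy h0 hi
    · rw [hg]
      conv_rhs => rw [← sub_eq_zero.mp hi, h.right_inv]
    · rw [h.eq_self _ hg.le]
  · rw [shift, gap_up_of_unshift_ne_zero h hy hi, h.right_inv, unshift]

theorem ratio_up {i : Cut n} (hi : unshift κ y i ≠ 0) : ratio (up κ y t) i = t i := by
  rw [ratio, one_sub_up_lo h hy hi, gap_up_of_unshift_ne_zero h hy hi,
    mul_div_cancel_right₀ _ (h0.trans_le (le_inv_gap h hy i)).ne']

theorem ratio_mul_shift_up (i : Cut n) :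
    ratio (up κ y t) i * shift ρ (up κ y t) i = t i * unshift κ y i := by
  rw [shift_up h hy h0]
  by_cases hi : unshift κ y i = 0
  · rw [hi, mul_zero, mul_zero]
  · rw [ratio_up h hy h0 hi]

theorem one_sub_ratio_mul_shift_up (i : Cut n) :
    (1 - ratio (up κ y t) i) * shift ρ (up κ y t) i = (1 - t i) * unshift κ y i := by
  rw [sub_mul, ratio_mul_shift_up h hy h0, shift_up h hy h0]; ring

theorem down_up : down ρ (up κ y t) = y := by
  funext k
  rw [down, funext (ratio_mul_shift_up h hy h0), funext (one_sub_ratio_mul_shift_up h hy h0), up]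
  ring

theorem angle_up : angle ρ (up κ y t) = t := by
  funext i
  have h1 : lowDist ρ (up κ y t) i = t i * κ (gap y i) := by
    rw [lowDist_eq_down, down_up h hy h0, ratio_mul_shift_up h hy h0,
      one_sub_lo_of_mem_blowUp hy, unshift]
    ring
  have h2 : highDist ρ (up κ y t) i = (1 - t i) * κ (gap y i) := by
    rw [highDist_eq_down, down_up h hy h0, one_sub_ratio_mul_shift_up h hy h0,
      one_add_hi_of_mem_blowUp hy, unshift]
    ring
  rw [angle, h1, h2, ← add_mul, add_sub_cancel, one_mul,
    mul_div_cancel_right₀ _ (h0.trans_le (le_inv_gap h hy i)).ne']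

end Up

/-! #### The diffeomorphism -/

theorem contDiff_shift {ε : ℝ} {ρ κ : ℝ → ℝ} (h : IsProfile ε ρ κ) (i : Cut n) :
    ContDiff ℝ ∞ (fun x : Fin n → ℝ => shift ρ x i) :=
  (contDiff_gap i).sub (h.smooth.comp (contDiff_gap i))

theorem contDiff_unshift {ε : ℝ} {ρ κ : ℝ → ℝ} (h : IsProfile ε ρ κ) (i : Cut n) :
    ContDiff ℝ ∞ (fun x : Fin n → ℝ => unshift κ x i) :=
  (h.smooth_inv.comp (contDiff_gap i)).sub (contDiff_gap i)

theorem contDiffAt_ratio {x : Fin n → ℝ} {i : Cut n} (hx : gap x i ≠ 0) :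
    ContDiffAt ℝ ∞ (fun x : Fin n → ℝ => ratio x i) x :=
  (contDiff_const.sub (contDiff_apply ℝ ℝ i.lo)).contDiffAt.div (contDiff_gap i).contDiffAt hx

theorem contDiff_up {ε : ℝ} {ρ κ : ℝ → ℝ} (h : IsProfile ε ρ κ) :
    ContDiff ℝ ∞ (fun p : (Fin n → ℝ) × (Cut n → ℝ) => up κ p.1 p.2) := by
  have hu : ∀ i, ContDiff ℝ ∞ (fun p : (Fin n → ℝ) × (Cut n → ℝ) => unshift κ p.1 i) :=
    fun i => (contDiff_unshift h i).comp contDiff_fst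
  have ht : ∀ i, ContDiff ℝ ∞ (fun p : (Fin n → ℝ) × (Cut n → ℝ) => p.2 i) :=
    fun i => (contDiff_apply ℝ ℝ i).comp contDiff_snd
  rw [contDiff_iff_contDiffAt]
  refine fun p => contDiffAt_pi.mpr fun k => ?_
  exact (((contDiff_apply ℝ ℝ k).comp contDiff_fst).contDiffAt.sub (contDiffAt_lowSum
    (fun i => ((ht i).mul (hu i)).contDiffAt) k)).add (contDiffAt_highSum
    (fun i => ((contDiff_const.sub (ht i)).mul (hu i)).contDiffAt) k)

section

variable {ε : ℝ} {ρ κ : ℝ → ℝ} (h : IsProfile ε ρ κ)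
include h

theorem contDiffAt_low {x : Fin n → ℝ} (hx : ∀ i, gap x i ≠ 0) (k : Fin n) :
    ContDiffAt ℝ ∞ (fun x : Fin n → ℝ => lowSum (fun i => ratio x i * shift ρ x i) k) x :=
  contDiffAt_lowSum (fun i => (contDiffAt_ratio (hx i)).mul (contDiff_shift h i).contDiffAt) k

theorem contDiffAt_high {x : Fin n → ℝ} (hx : ∀ i, gap x i ≠ 0) (k : Fin n) :
    ContDiffAt ℝ ∞ (fun x : Fin n → ℝ => highSum (fun i => (1 - ratio x i) * shift ρ x i) k) x :=
  contDiffAt_highSum (fun i => (contDiffAt_const.sub (contDiffAt_ratio (hx i))).mul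
    (contDiff_shift h i).contDiffAt) k

theorem contDiffAt_down {x : Fin n → ℝ} (hx : ∀ i, gap x i ≠ 0) : ContDiffAt ℝ ∞ (down ρ) x :=
  contDiffAt_pi.mpr fun k => ((contDiff_apply ℝ ℝ k).contDiffAt.add (contDiffAt_low h hx k)).sub
    (contDiffAt_high h hx k)

theorem contDiffAt_lowDist {x : Fin n → ℝ} (hx : ∀ i, gap x i ≠ 0) (i : Cut n) :
    ContDiffAt ℝ ∞ (fun x => lowDist ρ x i) x :=
  (contDiffAt_const.sub (contDiff_apply ℝ ℝ i.lo).contDiffAt).add (contDiffAt_high h hx i.lo)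

theorem contDiffAt_highDist {x : Fin n → ℝ} (hx : ∀ i, gap x i ≠ 0) (i : Cut n) :
    ContDiffAt ℝ ∞ (fun x => highDist ρ x i) x :=
  (contDiffAt_const.add (contDiff_apply ℝ ℝ i.hi).contDiffAt).add (contDiffAt_low h hx i.hi)

theorem smoothVia_down_angle (h0 : 0 < ε) :
    SmoothVia (Subtype.val : B n ε → Fin n → ℝ) (fun x => (down ρ x.1, angle ρ x.1)) := by
  refine smoothVia_of_eventually continuous_subtype_val fun x =>
    ⟨fun x => (down ρ x, angle ρ x), ?_, Filter.Eventually.of_forall fun _ => rfl⟩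
  have hg : ∀ i, gap x.1 i ≠ 0 := fun i => (gap_pos h0 x.2 i).ne'
  have hgap : ∀ᶠ z in 𝓝 x.1, ∀ i, gap z i ≠ 0 := Filter.eventually_all.mpr fun i =>
    (contDiff_gap i).continuous.continuousAt.eventually_ne (hg i)
  have hdist : ∀ᶠ z in 𝓝 x.1, ∀ i, lowDist ρ z i + highDist ρ z i ≠ 0 :=
    Filter.eventually_all.mpr fun i =>
      ((contDiffAt_lowDist h hg i).add (contDiffAt_highDist h hg i)).continuousAt.eventually_ne
        (dist_pos h h0 x.2 i).ne'
  filter_upwards [hgap, hdist] with z hz hz'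
  exact (contDiffAt_down h hz).prodMk (contDiffAt_pi.mpr fun i =>
    (contDiffAt_lowDist h hz i).div
      ((contDiffAt_lowDist h hz i).add (contDiffAt_highDist h hz i)) (hz' i))

theorem smoothVia_up :
    SmoothVia (Subtype.val : blowUp n → (Fin n → ℝ) × (Cut n → ℝ)) (fun p => up κ p.1.1 p.1.2) :=
  fun _ => ⟨fun p => up κ p.1 p.2, contDiff_up h, Filter.Eventually.of_forall fun _ => rfl⟩

/-- The diffeomorphism between the polytope and the blow-up of the cube. -/
def blowUpHomeo (h0 : 0 < ε) (h1 : ε < 1) : B n ε ≃ₜ blowUp n where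
  toFun x := ⟨(down ρ x.1, angle ρ x.1), down_mem_blowUp h h0 x.2⟩
  invFun p := ⟨up κ p.1.1 p.1.2, up_mem_B h p.2 h0 h1⟩
  left_inv x := Subtype.ext (up_down h h0 x.2)
  right_inv p := Subtype.ext (Prod.ext (down_up h p.2 h0) (angle_up h p.2 h0))
  continuous_toFun := ((smoothVia_down_angle h h0).continuous continuous_subtype_val).subtype_mk _
  continuous_invFun := ((smoothVia_up h).continuous continuous_subtype_val).subtype_mk _

theorem blowUpHomeo_isDiffeo (h0 : 0 < ε) (h1 : ε < 1) :
    IsDiffeo (Subtype.val : B n ε → Fin n → ℝ)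
      (Subtype.val : blowUp n → (Fin n → ℝ) × (Cut n → ℝ)) (blowUpHomeo h h0 h1) :=
  ⟨smoothVia_down_angle h h0, smoothVia_up h⟩

end

/-- A point of the blow-up over a point of the cube; over the face with index `i` the ratio is
`c`. -/
def liftAngle (c : ℝ) (y : Fin n → ℝ) (i : Cut n) : ℝ :=
  if gap y i = 0 then c else (1 - y i.lo) / gap y i

theorem lift_mem_blowUp {c : ℝ} (hc : c ∈ Set.Icc (0 : ℝ) 1) {y : Fin n → ℝ} (hy : y ∈ cube n) :
    (y, liftAngle c y) ∈ blowUp n := by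
  refine ⟨hy, fun i => ?_⟩
  have h1 := (hy i.lo).2
  have h2 := (hy i.hi).1
  change liftAngle c y i ∈ _ ∧ liftAngle c y i * (1 + y i.hi) = (1 - liftAngle c y i) * (1 - y i.lo)
  by_cases hi : gap y i = 0
  · rw [liftAngle, if_pos hi]
    rw [gap] at hi
    refine ⟨hc, ?_⟩
    rw [show y i.lo = 1 by linarith, show y i.hi = -1 by linarith]
    ring
  · rw [liftAngle, if_neg hi]
    have hg := gap_nonneg hy i
    refine ⟨⟨div_nonneg (by linarith) hg, div_le_one_of_le₀ (by rw [gap]; linarith) hg⟩, ?_⟩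
    field_simp
    rw [gap]; ring

theorem blowUpHomeo_isBlowDown {ε : ℝ} {ρ κ : ℝ → ℝ} (h : IsProfile ε ρ κ) (h0 : 0 < ε)
    (h1 : ε < 1) : IsBlowDown ε (fun x : B n ε => (blowUpHomeo h h0 h1 x).1.1) where
  blow_up := ⟨_, blowUpHomeo_isDiffeo h h0 h1, fun _ => rfl⟩
  cut i x := mem_cutFacet_iff h h0 x.2 i
  old δ k := by
    apply Set.Subset.antisymm
    · rintro _ ⟨x, hx, rfl⟩
      refine ⟨down_mem_cube h h0 x.2, ?_⟩
      have hk : x.1 k = ((δ : ℤ) : ℝ) := hx.2.2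
      change down ρ x.1 k = _
      obtain rfl | rfl := Int.units_eq_one_or δ
      · exact (down_eq_one h h0 x.2 (by simpa using hk)).trans (by simp)
      · exact (down_eq_neg_one h h0 x.2 (by simpa using hk)).trans (by simp)
    · rintro y ⟨hy, hyk⟩
      -- Over a face the preimage must be chosen on the right facet: ratio `0` leaves a lower
      -- coordinate at `1`, and ratio `1` leaves an upper coordinate at `-1`.
      obtain ⟨c, hc, hc'⟩ : ∃ c ∈ Set.Icc (0 : ℝ) 1, c = (1 - ((δ : ℤ) : ℝ)) / 2 := by
        obtain rfl | rfl := Int.units_eq_one_or δ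
        · exact ⟨0, by simp, by simp⟩
        · exact ⟨1, by simp, by norm_num⟩
      have hp := lift_mem_blowUp hc hy
      refine ⟨(blowUpHomeo h h0 h1).symm ⟨_, hp⟩, ⟨Subtype.prop _, ?_⟩,
        congrArg (fun p : blowUp n => p.1.1) ((blowUpHomeo h h0 h1).apply_symm_apply ⟨_, hp⟩)⟩
      refine ⟨(Subtype.prop ((blowUpHomeo h h0 h1).symm ⟨_, hp⟩)).1, ?_⟩
      change up κ y (liftAngle c y) k = _
      obtain hk | ⟨i, rfl, hi⟩ | ⟨i, rfl, hi⟩ := up_cases h hp k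
      · rw [hk, hyk]
      · have h2 := gap_lt_one_of_unshift_ne_zero h hi
        obtain rfl | rfl := Int.units_eq_one_or δ
        · have h3 : liftAngle c y i = 0 := by
            rw [liftAngle]; split_ifs
            · simpa using hc'
            · rw [hyk]; simp
          have h4 := one_sub_up_lo h hp hi
          rw [h3, zero_mul] at h4
          simp; linarith
        · have := one_lt_gap_of_lo_neg hy (i := i) (by rw [hyk]; simp)
          linarith
      · have h2 := gap_lt_one_of_unshift_ne_zero h hi
        obtain rfl | rfl := Int.units_eq_one_or δ
        · have := one_lt_gap_of_hi_pos hy (i := i) (by rw [hyk]; simp)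
          linarith
        · have hyk' : y i.hi = -1 := by simpa using hyk
          have h3 : liftAngle c y i = 1 := by
            rw [liftAngle]; split_ifs with hg
            · rw [hc']; norm_num
            · rw [div_eq_one_iff_eq hg, gap, hyk']; ring
          have h4 := one_add_up_hi h hp hi
          rw [h3, sub_self, zero_mul] at h4
          simp; linarith

/-! #### The interior of the polytope -/

theorem exists_perturbation_of_mem_interior {S : Set (Fin n → ℝ)} {x : Fin n → ℝ}
    (hx : x ∈ interior S) (k : Fin n) :
    ∃ r : ℝ, 0 < r ∧ Function.update x k (x k + r) ∈ S ∧ Function.update x k (x k - r) ∈ S := by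
  have hS : S ∈ 𝓝 x := mem_interior_iff_mem_nhds.mp hx
  have h1 : Filter.Tendsto (fun r : ℝ => Function.update x k (x k + r)) (𝓝 0) (𝓝 x) := by
    have : Continuous (fun r : ℝ => Function.update x k (x k + r)) := by fun_prop
    simpa using this.tendsto 0
  have h2 : Filter.Tendsto (fun r : ℝ => Function.update x k (x k - r)) (𝓝 0) (𝓝 x) := by
    have : Continuous (fun r : ℝ => Function.update x k (x k - r)) := by fun_prop
    simpa using this.tendsto 0
  obtain ⟨r, hr, hr1, hr2⟩ := ((eventually_mem_nhdsWithin (a := (0 : ℝ)) (s := Set.Ioi 0)).and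
    ((h1.mono_left nhdsWithin_le_nhds).eventually hS |>.and
      ((h2.mono_left nhdsWithin_le_nhds).eventually hS))).exists
  exact ⟨r, hr, hr1, hr2⟩

theorem mem_Ioo_of_mem_interior {ε : ℝ} {x : Fin n → ℝ} (hx : x ∈ interior (B n ε)) (k : Fin n) :
    x k ∈ Set.Ioo (-1 : ℝ) 1 := by
  obtain ⟨r, hr, h1, h2⟩ := exists_perturbation_of_mem_interior hx k
  have h1 := (h1.1 k).2
  have h2 := (h2.1 k).1
  simp only [Function.update_self] at h1 h2
  exact ⟨by linarith, by linarith⟩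

theorem lt_gap_of_mem_interior {ε : ℝ} {x : Fin n → ℝ} (hx : x ∈ interior (B n ε)) (i : Cut n) :
    ε < gap x i := by
  obtain ⟨r, hr, h1, -⟩ := exists_perturbation_of_mem_interior hx i.lo
  have h1 := h1.2 i
  have hne : i.hi ≠ i.lo := by
    intro h
    have := congrArg Fin.val h
    simp [Cut.hi, Cut.lo] at this
  rw [Function.update_self, Function.update_of_ne hne] at h1
  rw [gap]; linarith

theorem down_mem_Ioo_of_mem_interior {ε : ℝ} {ρ κ : ℝ → ℝ} (h : IsProfile ε ρ κ) (h0 : 0 < ε)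
    {x : Fin n → ℝ} (hx : x ∈ interior (B n ε)) (k : Fin n) :
    down ρ x k ∈ Set.Ioo (-1 : ℝ) 1 :=
  ⟨neg_one_lt_down h h0 (interior_subset hx) (mem_Ioo_of_mem_interior hx k).1
    (lt_gap_of_mem_interior hx),
   down_lt_one h h0 (interior_subset hx) (mem_Ioo_of_mem_interior hx k).2
    (lt_gap_of_mem_interior hx)⟩

theorem isClosed_cube : IsClosed (cube n) := by
  simp only [cube, Set.ofPred_forall]
  exact isClosed_iInter fun k => isClosed_Icc.preimage (continuous_apply k)

theorem isCompact_B (ε : ℝ) : IsCompact (B n ε) := by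
  have hcube : IsCompact (cube n) :=
    (isCompact_univ_pi fun _ : Fin n => isCompact_Icc (a := (-1 : ℝ)) (b := 1)).of_isClosed_subset
      isClosed_cube fun x hx k _ => hx k
  refine hcube.of_isClosed_subset ?_ fun x hx => hx.1
  have : B n ε = cube n ∩ ⋂ i : Cut n, {x | x i.lo - x i.hi ≤ 2 - ε} := by
    ext; simp [B]
  rw [this]
  exact isClosed_cube.inter (isClosed_iInter fun i =>
    isClosed_le (by fun_prop) continuous_const)

theorem convex_B (ε : ℝ) : Convex ℝ (B n ε) := by
  rintro x ⟨hx, hx'⟩ y ⟨hy, hy'⟩ a b ha hb hab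
  refine ⟨fun k => (convex_Icc (-1 : ℝ) 1) (hx k) (hy k) ha hb hab, fun i => ?_⟩
  have h1 := mul_le_mul_of_nonneg_left (hx' i) ha
  have h2 := mul_le_mul_of_nonneg_left (hy' i) hb
  have h3 : a * (2 - ε) + b * (2 - ε) = 2 - ε := by rw [← add_mul, hab, one_mul]
  simp only [Pi.add_apply, Pi.smul_apply, smul_eq_mul]
  linarith

theorem subset_closure_interior_B {ε : ℝ} (h1 : ε < 1) : B n ε ⊆ closure (interior (B n ε)) := by
  have hne : (interior (B n ε)).Nonempty := by
    -- On this box two coordinates differ by less than `1`, hence by less than `2 - ε`.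
    refine ⟨0, interior_maximal (t := Set.univ.pi fun _ => Set.Ioo (-1 / 2 : ℝ) (1 / 2)) ?_
      (isOpen_set_pi Set.finite_univ fun _ _ => isOpen_Ioo) (fun k _ => by norm_num)⟩
    intro x hx
    refine ⟨fun k => ?_, fun i => ?_⟩
    · have := hx k trivial
      exact ⟨by linarith [this.1], by linarith [this.2]⟩
    · have h2 := hx i.lo trivial
      have h3 := hx i.hi trivial
      linarith [h2.2, h3.1]
  rw [(convex_B ε).closure_interior_eq_closure_of_nonempty_interior hne]
  exact subset_closure

end Polytope

/-! ### The characteristic polynomial of an arrow matrix -/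

section Secular

open Polynomial

variable {n : ℕ}

/-- The characteristic polynomial of the arrow matrices with diagonal `(a₀, a)` and products `w` of
the opposite off-diagonal entries. -/
def secular {K : Type*} [CommRing K] (a₀ : K) (a w : Fin n → K) : K[X] :=
  (X - C a₀) * ∏ k, (X - C (a k)) - ∑ k, C (w k) * ∏ l ∈ Finset.univ.erase k, (X - C (a l))

theorem eval_secular {K : Type*} [CommRing K] (a₀ : K) (a w : Fin n → K) (x : K) :
    (secular a₀ a w).eval x =
      (x - a₀) * ∏ k, (x - a k) - ∑ k, w k * ∏ l ∈ Finset.univ.erase k, (x - a l) := by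
  simp [secular, eval_prod, eval_finsetSum]

theorem secular_map {K L : Type*} [CommRing K] [CommRing L] (f : K →+* L) (a₀ : K)
    (a w : Fin n → K) :
    (secular a₀ a w).map f = secular (f a₀) (fun k => f (a k)) (fun k => f (w k)) := by
  simp [secular, Polynomial.map_prod, Polynomial.map_sum]

theorem secular_reindex {K : Type*} [CommRing K] (a₀ : K) (a w : Fin n → K)
    (e : Equiv.Perm (Fin n)) : secular a₀ (fun k => a (e k)) (fun k => w (e k)) =
      secular a₀ a w := by
  have h : ∀ k, ∏ l ∈ Finset.univ.erase k, (X - C (a (e l))) =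
      ∏ l ∈ Finset.univ.erase (e k), (X - C (a l)) := fun k =>
    Finset.prod_bij (fun l _ => e l) (by simp) (by simp) (fun b hb =>
      ⟨e.symm b, by simpa [Equiv.symm_apply_eq] using hb, by simp⟩) (by simp)
  rw [secular, secular, Equiv.prod_comp e (fun k => X - C (a k)), Finset.sum_congr rfl
    (fun k _ => by rw [h k]),
    Equiv.sum_comp e (fun k => C (w k) * ∏ l ∈ Finset.univ.erase k, (X - C (a l)))]

/-- Dividing by the product over all leaves. -/
theorem sum_mul_prod_erase {K : Type*} [Field K] {d : Fin n → K} (hd : ∀ k, d k ≠ 0)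
    (w : Fin n → K) :
    ∑ k, w k * ∏ l ∈ Finset.univ.erase k, d l = (∏ k, d k) * ∑ k, w k / d k := by
  rw [Finset.mul_sum]
  refine Finset.sum_congr rfl fun k _ => ?_
  rw [← Finset.mul_prod_erase Finset.univ d (Finset.mem_univ k)]
  have := hd k
  field_simp

/-- The splitting of the vertices of the star into the centre and the leaves. -/
def starEquiv (n : ℕ) : Unit ⊕ Fin n ≃ Fin (n + 1) where
  toFun := Sum.elim (fun _ => 0) Fin.succ
  invFun := Fin.cases (Sum.inl ()) Sum.inr
  left_inv := by rintro (_ | _) <;> simp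
  right_inv i := by refine Fin.cases ?_ (fun i => ?_) i <;> simp

/-- Schur complement of the diagonal block of the leaves. -/
theorem det_arrow {K : Type*} [Field K] {A : Matrix (Fin (n + 1)) (Fin (n + 1)) K}
    (hA : ∀ i j : Fin n, i ≠ j → A i.succ j.succ = 0) (hd : ∀ k : Fin n, A k.succ k.succ ≠ 0) :
    A.det = (∏ k : Fin n, A k.succ k.succ) *
      (A 0 0 - ∑ k : Fin n, A 0 k.succ * A k.succ 0 / A k.succ k.succ) := by
  have hblock : A.submatrix (starEquiv n) (starEquiv n) = Matrix.fromBlocks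
      (Matrix.of fun _ _ : Unit => A 0 0) (Matrix.of fun (_ : Unit) (k : Fin n) => A 0 k.succ)
      (Matrix.of fun (k : Fin n) (_ : Unit) => A k.succ 0)
      (Matrix.diagonal fun k : Fin n => A k.succ k.succ) := by
    ext (i | i) (j | j)
    · rfl
    · rfl
    · rfl
    · by_cases hij : i = j
      · subst hij; simp [starEquiv]
      · simp [starEquiv, hij, hA i j hij]
  let _ : Invertible (fun k : Fin n => A k.succ k.succ) :=
    ⟨fun k => (A k.succ k.succ)⁻¹, by ext k; simp [hd k], by ext k; simp [hd k]⟩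
  let _ := Matrix.diagonalInvertible (fun k : Fin n => A k.succ k.succ)
  rw [← Matrix.det_submatrix_equiv_self (starEquiv n) A, hblock, Matrix.det_fromBlocks₂₂,
    Matrix.det_diagonal, Matrix.det_unique, Matrix.invOf_diagonal_eq]
  congr 1
  simp only [Matrix.sub_apply, Matrix.of_apply, Matrix.mul_apply, Matrix.diagonal_apply]
  simp
  refine Finset.sum_congr rfl fun k _ => ?_
  change A 0 k.succ * (A k.succ k.succ)⁻¹ * A k.succ 0 = _
  ring

/-- `det_arrow` applies to `x - A` for every `x` off the leaf diagonal, and two polynomials which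
agree at infinitely many points are equal. -/
theorem charpoly_arrow {K : Type*} [Field K] [Infinite K] {A : Matrix (Fin (n + 1)) (Fin (n + 1)) K}
    (hA : ∀ i j : Fin n, i ≠ j → A i.succ j.succ = 0) :
    A.charpoly = secular (A 0 0) (fun k => A k.succ k.succ) (fun k => A 0 k.succ * A k.succ 0) := by
  refine Polynomial.eq_of_infinite_eval_eq _ _ ((Set.finite_range
    fun k : Fin n => A k.succ k.succ).infinite_compl.mono fun x hx => ?_)
  have hx' : ∀ k : Fin n, x - A k.succ k.succ ≠ 0 := fun k h => hx ⟨k, (sub_eq_zero.mp h).symm⟩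
  change A.charpoly.eval x = _
  rw [Matrix.eval_charpoly, det_arrow (by
      intro i j hij
      simp [hA i j hij, hij]) (by simpa using hx'), eval_secular, sum_mul_prod_erase hx']
  simp [(Fin.succ_ne_zero _).symm]
  ring

/-- After division by `∏ (x - a_k)` the weights are the coefficients of the partial fractions `w_k /
(x - a_k)`; the fibre sum is the residue at `v`. This is all that the spectrum says about weights of
coinciding entries. -/
theorem sum_fiber_eq_of_secular_eq {a₀ : ℝ} {a w w' : Fin n → ℝ} (h : secular a₀ a w = secular a₀ a w')
    (v : ℝ) :
    ∑ k ∈ Finset.univ.filter (fun k => a k = v), w k =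
      ∑ k ∈ Finset.univ.filter (fun k => a k = v), w' k := by
  classical
  set S := Finset.univ.filter (fun k => a k = v)
  set T := Finset.univ.filter (fun k => ¬ a k = v)
  have h1 : ∀ᶠ x in 𝓝[≠] v, ∀ k, x - a k ≠ 0 := by
    refine Filter.eventually_all.mpr fun k => ?_
    by_cases hk : a k = v
    · filter_upwards [self_mem_nhdsWithin] with x hx
      rw [hk]; exact sub_ne_zero.mpr hx
    · have : Continuous fun x : ℝ => x - a k := by fun_prop
      exact (this.continuousAt.eventually_ne (sub_ne_zero.mpr (Ne.symm hk))).filter_mono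
        nhdsWithin_le_nhds
  -- The left side is constant and the right side tends to `0` as `x → v`, since the remaining poles
  -- lie elsewhere.
  have h2 : ∀ᶠ x in 𝓝[≠] v, ∑ k ∈ S, (w k - w' k) =
      -((x - v) * ∑ k ∈ T, (w k - w' k) / (x - a k)) := by
    filter_upwards [h1, self_mem_nhdsWithin] with x hx hxv
    have h3 := congrArg (Polynomial.eval x) h
    rw [eval_secular, eval_secular, sum_mul_prod_erase hx, sum_mul_prod_erase hx] at h3
    have h4 : ∑ k, (w k - w' k) / (x - a k) = 0 := by
      simp only [sub_div, Finset.sum_sub_distrib]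
      exact sub_eq_zero.mpr (mul_left_cancel₀ (Finset.prod_ne_zero_iff.mpr fun k _ => hx k)
        (sub_right_injective h3))
    rw [← Finset.sum_filter_add_sum_filter_not _ (fun k => a k = v)] at h4
    have h5 : ∑ k ∈ S, (w k - w' k) = (x - v) * ∑ k ∈ S, (w k - w' k) / (x - a k) := by
      rw [Finset.mul_sum]
      refine Finset.sum_congr rfl fun k hk => ?_
      rw [(Finset.mem_filter.mp hk).2, mul_div_cancel₀ _ (sub_ne_zero.mpr hxv)]
    rw [h5, eq_neg_of_add_eq_zero_left h4, mul_neg]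
  have h6 : Filter.Tendsto (fun x => -((x - v) * ∑ k ∈ T, (w k - w' k) / (x - a k)))
      (𝓝[≠] v) (𝓝 0) := by
    have : ContinuousAt (fun x => -((x - v) * ∑ k ∈ T, (w k - w' k) / (x - a k))) v := by
      have hT : ∀ k ∈ T, ContinuousAt (fun x => (w k - w' k) / (x - a k)) v := fun k hk =>
        continuousAt_const.div (by fun_prop)
          (sub_ne_zero.mpr (Ne.symm (Finset.mem_filter.mp hk).2))
      have := tendsto_finsetSum T hT
      exact ((by fun_prop : ContinuousAt (fun x : ℝ => x - v) v).mul this).neg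
    have h7 := this.tendsto
    rw [sub_self, zero_mul, neg_zero] at h7
    exact h7.mono_left nhdsWithin_le_nhds
  have h8 := tendsto_nhds_unique (tendsto_const_nhds.congr' h2) h6
  rw [Finset.sum_sub_distrib] at h8
  exact sub_eq_zero.mp h8

/-- The real symmetric arrow matrix with diagonal `(a₀, a)` and row zero `(a₀, b)`. -/
def arrow (𝕜 : Type*) [RCLike 𝕜] (a₀ : ℝ) (a b : Fin n → ℝ) :
    Matrix (Fin (n + 1)) (Fin (n + 1)) 𝕜 :=
  Matrix.of (Fin.cons (Fin.cons (a₀ : 𝕜) fun k => (b k : 𝕜))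
    fun i => Fin.cons (b i : 𝕜) fun j => if i = j then (a i : 𝕜) else 0)

section Arrow

variable (𝕜 : Type*) [RCLike 𝕜] (a₀ : ℝ) (a b : Fin n → ℝ)

@[simp] theorem arrow_zero_zero : arrow 𝕜 a₀ a b 0 0 = a₀ := rfl

@[simp] theorem arrow_zero_succ (k : Fin n) : arrow 𝕜 a₀ a b 0 k.succ = b k := rfl

@[simp] theorem arrow_succ_zero (k : Fin n) : arrow 𝕜 a₀ a b k.succ 0 = b k := rfl

@[simp] theorem arrow_succ_succ (i j : Fin n) :
    arrow 𝕜 a₀ a b i.succ j.succ = if i = j then (a i : 𝕜) else 0 := rfl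

theorem charpoly_arrow_eq :
    (arrow 𝕜 a₀ a b).charpoly = (secular a₀ a fun k => b k ^ 2).map (algebraMap ℝ 𝕜) := by
  rw [charpoly_arrow (fun i j hij => by simp [hij]), secular_map]
  simp [pow_two]

theorem trace_arrow : (arrow 𝕜 a₀ a b).trace = ((a₀ + ∑ k, a k : ℝ) : 𝕜) := by
  rw [Matrix.trace, Fin.sum_univ_succ]
  simp

theorem isHermitian_arrow : (arrow 𝕜 a₀ a b).IsHermitian := by
  ext i j
  rw [Matrix.conjTranspose_apply]
  refine Fin.cases ?_ (fun i => ?_) i <;> refine Fin.cases ?_ (fun j => ?_) j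
  · simp
  · simp
  · simp
  · by_cases h : i = j
    · simp [h]
    · simp [h, Ne.symm h]

end Arrow

end Secular

/-! ### The algebra of smooth functions -/

section SmoothAlgebra

variable {X E F G : Type*} [TopologicalSpace X]
  [NormedAddCommGroup E] [NormedSpace ℝ E] [NormedAddCommGroup F] [NormedSpace ℝ F]
  [NormedAddCommGroup G] [NormedSpace ℝ G]

/-- Smoothness at a point with respect to the coordinates `ι`. -/
def SmoothViaAt (ι : X → E) (f : X → F) (x : X) : Prop :=
  ∃ g : E → F, ContDiff ℝ ∞ g ∧ ∀ᶠ y in 𝓝 x, f y = g (ι y)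

variable {ι : X → E} {x : X}

theorem SmoothViaAt.congr {f f' : X → F} (hf : SmoothViaAt ι f x) (h : ∀ᶠ y in 𝓝 x, f' y = f y) :
    SmoothViaAt ι f' x := by
  obtain ⟨g, hg, hfg⟩ := hf
  exact ⟨g, hg, by filter_upwards [hfg, h] with y h1 h2; rw [h2, h1]⟩

theorem SmoothViaAt.of_contDiff {g : E → F} (hg : ContDiff ℝ ∞ g) :
    SmoothViaAt ι (fun y => g (ι y)) x :=
  ⟨g, hg, Filter.Eventually.of_forall fun _ => rfl⟩

theorem SmoothViaAt.const (c : F) : SmoothViaAt ι (fun _ => c) x :=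
  ⟨fun _ => c, contDiff_const, Filter.Eventually.of_forall fun _ => rfl⟩

theorem SmoothViaAt.prodMk {f : X → F} {g : X → G} (hf : SmoothViaAt ι f x)
    (hg : SmoothViaAt ι g x) : SmoothViaAt ι (fun x => (f x, g x)) x := by
  obtain ⟨f', hf', h1⟩ := hf
  obtain ⟨g', hg', h2⟩ := hg
  refine ⟨fun z => (f' z, g' z), hf'.prodMk hg', ?_⟩
  filter_upwards [h1, h2] with y hy1 hy2
  rw [hy1, hy2]

theorem SmoothViaAt.pi {κ : Type*} [Fintype κ] {f : X → κ → ℝ}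
    (h : ∀ k, SmoothViaAt ι (fun x => f x k) x) : SmoothViaAt ι f x := by
  choose g hg hfg using h
  refine ⟨fun z k => g k z, contDiff_pi.mpr hg, ?_⟩
  filter_upwards [Filter.eventually_all.mpr hfg] with y hy
  exact funext hy

theorem SmoothViaAt.comp {f : X → F} (hf : SmoothViaAt ι f x) {g : F → G} (hg : ContDiff ℝ ∞ g) :
    SmoothViaAt ι (fun y => g (f y)) x := by
  obtain ⟨f', hf', h1⟩ := hf
  exact ⟨fun z => g (f' z), hg.comp hf', h1.mono fun y hy => congrArg g hy⟩

variable {f g : X → ℝ}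

theorem SmoothViaAt.add (hf : SmoothViaAt ι f x) (hg : SmoothViaAt ι g x) :
    SmoothViaAt ι (fun y => f y + g y) x :=
  (hf.prodMk hg).comp (contDiff_fst.add contDiff_snd)

theorem SmoothViaAt.sub (hf : SmoothViaAt ι f x) (hg : SmoothViaAt ι g x) :
    SmoothViaAt ι (fun y => f y - g y) x :=
  (hf.prodMk hg).comp (contDiff_fst.sub contDiff_snd)

theorem SmoothViaAt.mul (hf : SmoothViaAt ι f x) (hg : SmoothViaAt ι g x) :
    SmoothViaAt ι (fun y => f y * g y) x :=
  (hf.prodMk hg).comp (contDiff_fst.mul contDiff_snd)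

theorem SmoothViaAt.sum {κ : Type*} {s : Finset κ} {f : κ → X → ℝ}
    (h : ∀ k ∈ s, SmoothViaAt ι (f k) x) : SmoothViaAt ι (fun y => ∑ k ∈ s, f k y) x := by
  classical
  induction s using Finset.induction_on with
  | empty => simpa using SmoothViaAt.const 0
  | insert a s ha ih =>
    simp only [Finset.sum_insert ha]
    exact (h a (Finset.mem_insert_self _ _)).add
      (ih fun k hk => h k (Finset.mem_insert_of_mem hk))

theorem SmoothViaAt.prod {κ : Type*} {s : Finset κ} {f : κ → X → ℝ}
    (h : ∀ k ∈ s, SmoothViaAt ι (f k) x) : SmoothViaAt ι (fun y => ∏ k ∈ s, f k y) x := by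
  classical
  induction s using Finset.induction_on with
  | empty => simpa using SmoothViaAt.const 1
  | insert a s ha ih =>
    simp only [Finset.prod_insert ha]
    exact (h a (Finset.mem_insert_self _ _)).mul
      (ih fun k hk => h k (Finset.mem_insert_of_mem hk))

/-- The quotient of the ambient extensions is smooth only where the denominator is nonzero; a cutoff
makes it globally smooth without changing it near the point. -/
theorem SmoothViaAt.div [FiniteDimensional ℝ E] (hι : Continuous ι) (hf : SmoothViaAt ι f x)
    (hg : SmoothViaAt ι g x) (h0 : g x ≠ 0) : SmoothViaAt ι (fun y => f y / g y) x := by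
  obtain ⟨f', hf', h1⟩ := hf
  obtain ⟨g', hg', h2⟩ := hg
  have hx : ι x ∈ {z | g' z ≠ 0} := by
    change g' (ι x) ≠ 0
    rwa [← h2.self_of_nhds]
  obtain ⟨k, hk, hk'⟩ := exists_contDiff_eventuallyEq (g := fun z => f' z / g' z)
    (isOpen_ne_fun hg'.continuous continuous_const)
    (fun z hz => hf'.contDiffAt.div hg'.contDiffAt hz) hx
  refine ⟨k, hk, ?_⟩
  filter_upwards [h1, h2, hι.continuousAt.eventually hk'] with y hy1 hy2 hy3
  rw [hy3, hy1, hy2]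

theorem SmoothViaAt.continuousAt (hι : Continuous ι) {f : X → F} (hf : SmoothViaAt ι f x) :
    ContinuousAt f x := by
  obtain ⟨g, hg, h⟩ := hf
  exact ((hg.continuous.comp hι).continuousAt (x := x)).congr (h.mono fun y hy => hy.symm)

end SmoothAlgebra

/-! ### Diagonal entries and off-diagonal entries in a cube -/

section Weights

variable {n : ℕ}

theorem Cut.succ_lo (i : Cut n) : i.lo.succ = i.hi.castSucc := rfl

theorem Cut.lo_lt_hi (i : Cut n) : i.lo < i.hi := by
  rw [Fin.lt_def]; simp [Cut.lo, Cut.hi]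

/-- The length of the interval with index `j`. -/
def len (lam : Fin (n + 1) → ℝ) (j : Fin n) : ℝ := lam j.succ - lam j.castSucc

/-- The point of the interval with index `j` whose rescaled coordinate is `y j`. -/
def coord (lam : Fin (n + 1) → ℝ) (y : Fin n → ℝ) (j : Fin n) : ℝ :=
  (lam j.castSucc + lam j.succ + len lam j * y j) / 2

/-- The distance of the diagonal entries with indices `i.lo` and `i.hi`, relative to the rescaled
distance. -/
def slope (lam : Fin (n + 1) → ℝ) (t : Cut n → ℝ) (i : Cut n) : ℝ :=
  len lam i.lo * t i + len lam i.hi * (1 - t i)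

/-- The ratio in which `λ` divides the interval between the diagonal entries with indices `i.lo`
and `i.hi`. -/
def split (lam : Fin (n + 1) → ℝ) (t : Cut n → ℝ) (i : Cut n) : ℝ :=
  len lam i.lo * t i / slope lam t i

/-- The factor of the squared off-diagonal entry with index `j` which belongs to the diagonal entry
with index `l`, where these two diagonal entries differ. -/
def regularFactor (lam : Fin (n + 1) → ℝ) (y : Fin n → ℝ) (j l : Fin n) : ℝ :=
  if l = j then (coord lam y j - lam 0) * (lam (Fin.last n) - coord lam y j)
  else if l < j then (coord lam y j - lam l.succ) / (coord lam y j - coord lam y l)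
  else (lam l.castSucc - coord lam y j) / (coord lam y l - coord lam y j)

/-- The factor of the squared off-diagonal entry with index `j` which belongs to the diagonal entry
with index `l`. -/
def factor (lam : Fin (n + 1) → ℝ) (y : Fin n → ℝ) (t : Cut n → ℝ) (j l : Fin n) : ℝ :=
  if (l : ℕ) + 1 = j then highSum (fun i => 1 - split lam t i) j
  else if (j : ℕ) + 1 = l then lowSum (split lam t) j
  else regularFactor lam y j l

/-- The squared off-diagonal entry with index `j`. -/
def weight (lam : Fin (n + 1) → ℝ) (y : Fin n → ℝ) (t : Cut n → ℝ) (j : Fin n) : ℝ :=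
  ∏ l, factor lam y t j l

/-- The sum of the squared off-diagonal entries with indices `i.lo` and `i.hi`, if their diagonal
entries agree. -/
def pairWeight (lam : Fin (n + 1) → ℝ) (y : Fin n → ℝ) (i : Cut n) : ℝ :=
  ∏ l ∈ Finset.univ.erase i.hi, regularFactor lam y i.lo l

theorem factor_lo_hi (lam : Fin (n + 1) → ℝ) (y : Fin n → ℝ) (t : Cut n → ℝ) (i : Cut n) :
    factor lam y t i.lo i.hi = split lam t i := by
  rw [factor, if_neg (by simp only [Cut.lo, Cut.hi]; omega),
    if_pos (by simp only [Cut.lo, Cut.hi]), lowSum_lo]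

theorem factor_hi_lo (lam : Fin (n + 1) → ℝ) (y : Fin n → ℝ) (t : Cut n → ℝ) (i : Cut n) :
    factor lam y t i.hi i.lo = 1 - split lam t i := by
  rw [factor, if_pos (by simp only [Cut.lo, Cut.hi]), highSum_hi]

theorem factor_self (lam : Fin (n + 1) → ℝ) (y : Fin n → ℝ) (t : Cut n → ℝ) (j : Fin n) :
    factor lam y t j j =
      (coord lam y j - lam 0) * (lam (Fin.last n) - coord lam y j) := by
  simp [factor, regularFactor]

/-- The pairs of different indices: neighbours, or far from each other. -/
theorem pair_cases {k j : Fin n} (h : k < j) :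
    (∃ i : Cut n, i.lo = k ∧ i.hi = j) ∨ (k : ℕ) + 1 < j := by
  by_cases h' : (k : ℕ) + 1 = j
  · exact Or.inl ⟨⟨k, by omega⟩, rfl, Fin.ext h'⟩
  · right; rw [Fin.lt_def] at h; omega

theorem factor_of_lt {lam : Fin (n + 1) → ℝ} {y : Fin n → ℝ} {t : Cut n → ℝ} {k j : Fin n}
    (h : (k : ℕ) + 1 < j) : factor lam y t j k =
      (coord lam y j - lam k.succ) / (coord lam y j - coord lam y k) := by
  rw [factor, if_neg (by omega), if_neg (by omega), regularFactor, if_neg (by rintro rfl; omega),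
    if_pos (by rw [Fin.lt_def]; omega)]

theorem factor_of_gt {lam : Fin (n + 1) → ℝ} {y : Fin n → ℝ} {t : Cut n → ℝ} {k j : Fin n}
    (h : (k : ℕ) + 1 < j) : factor lam y t k j =
      (lam j.castSucc - coord lam y k) / (coord lam y j - coord lam y k) := by
  rw [factor, if_neg (by omega), if_neg (by omega), regularFactor, if_neg (by rintro rfl; omega),
    if_neg (by rw [Fin.lt_def]; omega)]

/-- To each leaf `l ≠ j` belongs the endpoint of its interval that faces the interval of `j`. These
endpoints run once through all eigenvalues except the first and the last. -/
theorem prod_insert_ends (f : Fin (n + 1) → ℝ) (j : Fin n) :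
    f 0 * f (Fin.last n) * ∏ l ∈ Finset.univ.erase j, f (if l < j then l.succ else l.castSucc) =
      ∏ i, f i := by
  have h0 : Fin.last n ∈ Finset.univ.erase (0 : Fin (n + 1)) := by
    have := j.pos
    simp [Fin.ext_iff]
    omega
  rw [← Finset.mul_prod_erase Finset.univ f (Finset.mem_univ 0), ← Finset.mul_prod_erase _ f h0,
    mul_assoc]
  congr 2
  refine Finset.prod_bij (fun l _ => if l < j then l.succ else l.castSucc) ?_ ?_ ?_ ?_
  · intro l hl
    simp only [Finset.mem_erase, Finset.mem_univ, and_true, Fin.ext_iff, ne_eq] at hl ⊢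
    split_ifs with h <;> rw [Fin.lt_def] at h <;> simp <;> omega
  · intro l hl m hm hlm
    simp only [Finset.mem_erase, Finset.mem_univ, and_true, Fin.ext_iff, ne_eq] at hl hm hlm ⊢
    split_ifs at hlm with h h' h' <;> rw [Fin.lt_def] at h h' <;> simp at hlm <;> omega
  · intro i hi
    simp only [Finset.mem_erase, Finset.mem_univ, and_true, Fin.ext_iff, ne_eq, Fin.val_last,
      Fin.val_zero] at hi
    have := i.isLt
    by_cases hij : (i : ℕ) ≤ j
    · refine ⟨⟨i - 1, by omega⟩, ?_, ?_⟩
      · simp [Fin.ext_iff]; omega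
      · rw [if_pos (by rw [Fin.lt_def]; simp; omega)]
        simp [Fin.ext_iff]; omega
    · refine ⟨⟨i, by omega⟩, ?_, ?_⟩
      · simp [Fin.ext_iff]; omega
      · rw [if_neg (by rw [Fin.lt_def]; simp; omega)]
        simp
  · intro l hl; rfl

/-! ### Diagonal entries and weights over the blow-up -/

section Order

variable {lam : Fin (n + 1) → ℝ} (hlam : StrictMono lam) {y : Fin n → ℝ} {t : Cut n → ℝ}

theorem coord_sub (lam : Fin (n + 1) → ℝ) (y : Fin n → ℝ) (j : Fin n) :
    coord lam y j - lam j.castSucc = len lam j * (1 + y j) / 2 := by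
  rw [coord, len]; ring

theorem sub_coord (lam : Fin (n + 1) → ℝ) (y : Fin n → ℝ) (j : Fin n) :
    lam j.succ - coord lam y j = len lam j * (1 - y j) / 2 := by
  rw [coord, len]; ring

include hlam

theorem len_pos (j : Fin n) : 0 < len lam j :=
  sub_pos.mpr (hlam (Fin.castSucc_lt_succ))

theorem coord_mem (hy : y ∈ cube n) (j : Fin n) :
    coord lam y j ∈ Set.Icc (lam j.castSucc) (lam j.succ) := by
  have h1 := coord_sub lam y j
  have h2 := sub_coord lam y j
  have h3 := mul_nonneg (len_pos hlam j).le (by linarith [(hy j).1] : 0 ≤ 1 + y j)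
  have h4 := mul_nonneg (len_pos hlam j).le (by linarith [(hy j).2] : 0 ≤ 1 - y j)
  exact ⟨by linarith, by linarith⟩

theorem coord_mem_Ioo (hy : ∀ k, y k ∈ Set.Ioo (-1 : ℝ) 1) (j : Fin n) :
    coord lam y j ∈ Set.Ioo (lam j.castSucc) (lam j.succ) := by
  have h1 := coord_sub lam y j
  have h2 := sub_coord lam y j
  have h3 := mul_pos (len_pos hlam j) (by linarith [(hy j).1] : 0 < 1 + y j)
  have h4 := mul_pos (len_pos hlam j) (by linarith [(hy j).2] : 0 < 1 - y j)
  exact ⟨by linarith, by linarith⟩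

theorem coord_lt_of_lt (hy : y ∈ cube n) {k j : Fin n} (h : (k : ℕ) + 1 < j) :
    coord lam y k < coord lam y j :=
  (coord_mem hlam hy k).2.trans_lt ((hlam (by rw [Fin.lt_def]; simpa using h)).trans_le
    (coord_mem hlam hy j).1)

theorem slope_pos (ht : ∀ i, t i ∈ Set.Icc (0 : ℝ) 1) (i : Cut n) : 0 < slope lam t i := by
  have h1 := len_pos hlam i.lo
  have h2 := len_pos hlam i.hi
  obtain ⟨h3, h4⟩ := ht i
  rw [slope]
  rcases h3.eq_or_lt with h | h
  · rw [← h]; linarith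
  · have := mul_pos h1 h
    have := mul_nonneg h2.le (sub_nonneg.mpr h4)
    linarith

theorem one_sub_split (ht : ∀ i, t i ∈ Set.Icc (0 : ℝ) 1) (i : Cut n) :
    1 - split lam t i = len lam i.hi * (1 - t i) / slope lam t i := by
  have h := (slope_pos hlam ht i).ne'
  rw [split, eq_div_iff h, sub_mul, div_mul_cancel₀ _ h, slope]; ring

theorem split_mem (ht : ∀ i, t i ∈ Set.Icc (0 : ℝ) 1) (i : Cut n) :
    split lam t i ∈ Set.Icc (0 : ℝ) 1 := by
  have h := (slope_pos hlam ht i).le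
  have h1 := one_sub_split hlam ht i
  have h2 := div_nonneg (mul_nonneg (len_pos hlam i.hi).le (sub_nonneg.mpr (ht i).2)) h
  exact ⟨div_nonneg (mul_nonneg (len_pos hlam i.lo).le (ht i).1) h, by linarith⟩

omit hlam in
-- Neighbouring intervals share an endpoint, and the difference of the entries is the sum of their
-- distances to it. On the blow-up these distances are `gap / 2` times `len * t` and `len * (1 -
-- t)`.
theorem coord_hi_sub_coord_lo (hp : (y, t) ∈ blowUp n) (i : Cut n) :
    coord lam y i.hi - coord lam y i.lo = slope lam t i * gap y i / 2 := by
  have h1 := coord_sub lam y i.hi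
  have h2 := sub_coord lam y i.lo
  rw [one_add_hi_of_mem_blowUp hp] at h1
  rw [one_sub_lo_of_mem_blowUp hp] at h2
  rw [Cut.succ_lo] at h2
  rw [slope]
  linarith

/-- Where the entries differ this identifies `split` with a factor of the weight formula; where they
agree both sides vanish, but `split` is still defined. This resolves the `0/0`. -/
theorem split_mul_coord (hp : (y, t) ∈ blowUp n) (i : Cut n) :
    split lam t i * (coord lam y i.hi - coord lam y i.lo) = lam i.lo.succ - coord lam y i.lo := by
  have h := (slope_pos hlam (fun i => (hp.2 i).1) i).ne'
  rw [coord_hi_sub_coord_lo hp, sub_coord, one_sub_lo_of_mem_blowUp hp, split]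
  field_simp

theorem one_sub_split_mul_coord (hp : (y, t) ∈ blowUp n) (i : Cut n) :
    (1 - split lam t i) * (coord lam y i.hi - coord lam y i.lo) =
      coord lam y i.hi - lam i.hi.castSucc := by
  rw [sub_mul, split_mul_coord hlam hp, Cut.succ_lo]; ring

theorem coord_monotone (hp : (y, t) ∈ blowUp n) : Monotone (coord lam y) := by
  intro k j hkj
  rcases hkj.eq_or_lt with rfl | h
  · exact le_rfl
  obtain ⟨i, rfl, rfl⟩ | h := pair_cases h
  · have := mul_nonneg (slope_pos hlam (fun i => (hp.2 i).1) i).le (gap_nonneg hp.1 i)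
    linarith [coord_hi_sub_coord_lo (lam := lam) hp i]
  · exact (coord_lt_of_lt hlam hp.1 h).le

theorem coord_eq_iff (hp : (y, t) ∈ blowUp n) (i : Cut n) :
    coord lam y i.lo = coord lam y i.hi ↔ gap y i = 0 := by
  have h := (slope_pos hlam (fun i => (hp.2 i).1) i).ne'
  have h1 := coord_hi_sub_coord_lo (lam := lam) hp i
  constructor
  · intro he
    rw [he, sub_self] at h1
    have : slope lam t i * gap y i = 0 := by linarith
    exact (mul_eq_zero.mp this).resolve_left h
  · intro hg
    rw [hg] at h1
    linarith

theorem exists_cut_of_coord_eq (hp : (y, t) ∈ blowUp n) {k j : Fin n} (hkj : k < j)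
    (he : coord lam y k = coord lam y j) : ∃ i : Cut n, i.lo = k ∧ i.hi = j ∧ gap y i = 0 := by
  obtain ⟨i, rfl, rfl⟩ | h := pair_cases hkj
  · exact ⟨i, rfl, rfl, (coord_eq_iff hlam hp i).mp he⟩
  · exact absurd he (coord_lt_of_lt hlam hp.1 h).ne

/-- At most two diagonal entries agree. -/
theorem coord_ne_of_gap_eq_zero (hp : (y, t) ∈ blowUp n) {i : Cut n} (hi : gap y i = 0)
    {l : Fin n} (h1 : l ≠ i.lo) (h2 : l ≠ i.hi) : coord lam y l ≠ coord lam y i.lo := by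
  intro he
  rcases lt_or_gt_of_ne h1 with h | h
  · obtain ⟨j, rfl, hj, hg⟩ := exists_cut_of_coord_eq hlam hp h he
    exact lo_ne_hi_of_gap_lt hp.1 (hi.trans_lt one_pos) (hg.trans_lt one_pos) hj.symm
  · obtain ⟨j, hj, rfl, -⟩ := exists_cut_of_coord_eq hlam hp h he.symm
    exact h2 (by rw [Cut.lo_injective hj])

theorem factor_mul_of_lt (hp : (y, t) ∈ blowUp n) {k j : Fin n} (h : k < j) :
    factor lam y t j k * (coord lam y j - coord lam y k) = coord lam y j - lam k.succ := by
  obtain ⟨i, rfl, rfl⟩ | h := pair_cases h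
  · rw [factor_hi_lo, one_sub_split_mul_coord hlam hp, Cut.succ_lo]
  · rw [factor_of_lt h, div_mul_cancel₀ _ (sub_pos.mpr (coord_lt_of_lt hlam hp.1 h)).ne']

theorem factor_mul_of_gt (hp : (y, t) ∈ blowUp n) {k j : Fin n} (h : k < j) :
    factor lam y t k j * (coord lam y j - coord lam y k) = lam j.castSucc - coord lam y k := by
  obtain ⟨i, rfl, rfl⟩ | h := pair_cases h
  · rw [factor_lo_hi, split_mul_coord hlam hp, Cut.succ_lo]
  · rw [factor_of_gt h, div_mul_cancel₀ _ (sub_pos.mpr (coord_lt_of_lt hlam hp.1 h)).ne']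

theorem factor_eq_regularFactor (hp : (y, t) ∈ blowUp n) {j l : Fin n}
    (h : l = j ∨ coord lam y l ≠ coord lam y j) :
    factor lam y t j l = regularFactor lam y j l := by
  by_cases hlj : l = j
  · subst hlj; rw [factor_self, regularFactor, if_pos rfl]
  have h := h.resolve_left hlj
  rw [regularFactor, if_neg hlj]
  rcases lt_or_gt_of_ne hlj with h' | h'
  · rw [if_pos h', eq_div_iff (sub_ne_zero.mpr h.symm), factor_mul_of_lt hlam hp h']
  · rw [if_neg h'.not_gt, eq_div_iff (sub_ne_zero.mpr h), factor_mul_of_gt hlam hp h']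

/-- The squared off-diagonal entry in terms of the splitting ratio of a cut. -/
theorem weight_lo (hp : (y, t) ∈ blowUp n) {i : Cut n}
    (h : ∀ l, l ≠ i.lo → l ≠ i.hi → coord lam y l ≠ coord lam y i.lo) :
    weight lam y t i.lo = split lam t i * pairWeight lam y i := by
  rw [weight, ← Finset.mul_prod_erase Finset.univ _ (Finset.mem_univ i.hi), factor_lo_hi,
    pairWeight]
  congr 1
  refine Finset.prod_congr rfl fun l hl => factor_eq_regularFactor hlam hp ?_
  by_cases hl' : l = i.lo
  · exact Or.inl hl'
  · exact Or.inr (h l hl' (Finset.ne_of_mem_erase hl))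

theorem factor_nonneg (hp : (y, t) ∈ blowUp n) (j l : Fin n) : 0 ≤ factor lam y t j l := by
  rcases lt_trichotomy l j with h | rfl | h
  · obtain ⟨i, rfl, rfl⟩ | h := pair_cases h
    · rw [factor_hi_lo]; linarith [(split_mem hlam (fun i => (hp.2 i).1) i).2]
    · rw [factor_of_lt h]
      have h1 := coord_lt_of_lt hlam hp.1 h
      have h2 := hlam.monotone (by rw [Fin.le_def]; simp; omega : l.succ ≤ j.castSucc)
      exact div_nonneg (by linarith [(coord_mem hlam hp.1 j).1]) (by linarith)
  · rw [factor_self]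
    have h1 := hlam.monotone (Fin.zero_le l.castSucc)
    have h2 := hlam.monotone (Fin.le_last l.succ)
    have h3 := coord_mem hlam hp.1 l
    exact mul_nonneg (by linarith [h3.1]) (by linarith [h3.2])
  · obtain ⟨i, rfl, rfl⟩ | h := pair_cases h
    · rw [factor_lo_hi]; exact (split_mem hlam (fun i => (hp.2 i).1) i).1
    · rw [factor_of_gt h]
      have h1 := coord_lt_of_lt hlam hp.1 h
      have h2 := hlam.monotone (by rw [Fin.le_def]; simp; omega : j.succ ≤ l.castSucc)
      exact div_nonneg (by linarith [(coord_mem hlam hp.1 j).2]) (by linarith)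

theorem weight_nonneg (hp : (y, t) ∈ blowUp n) (j : Fin n) : 0 ≤ weight lam y t j :=
  Finset.prod_nonneg fun l _ => factor_nonneg hlam hp j l

/-- A vanishing factor would place the entry `j` at an eigenvalue, hence not in the open interval.
-/
theorem weight_ne_zero (hp : (y, t) ∈ blowUp n) (hy : ∀ k, y k ∈ Set.Ioo (-1 : ℝ) 1) (j : Fin n) :
    weight lam y t j ≠ 0 := by
  refine Finset.prod_ne_zero_iff.mpr fun l _ h0 => ?_
  have h3 := coord_mem_Ioo hlam hy j
  rcases lt_trichotomy l j with h | rfl | h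
  · have h1 := factor_mul_of_lt hlam hp h
    have h2 := hlam.monotone (by rw [Fin.lt_def] at h; rw [Fin.le_def]; simp; omega :
      l.succ ≤ j.castSucc)
    rw [h0, zero_mul] at h1
    linarith [h3.1]
  · rw [factor_self] at h0
    have h1 := hlam.monotone (Fin.zero_le l.castSucc)
    have h2 := hlam.monotone (Fin.le_last l.succ)
    rcases mul_eq_zero.mp h0 with h | h
    · linarith [h3.1]
    · linarith [h3.2]
  · have h1 := factor_mul_of_gt hlam hp h
    have h2 := hlam.monotone (by rw [Fin.lt_def] at h; rw [Fin.le_def]; simp; omega :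
      j.succ ≤ l.castSucc)
    rw [h0, zero_mul] at h1
    linarith [h3.2]

/-- At a collision the common value is the shared endpoint, an eigenvalue other than the first and
the last. The other leaves have their whole intervals, or at least the facing endpoints, strictly on
one side of it. -/
theorem pairWeight_pos (hp : (y, t) ∈ blowUp n) {i : Cut n} (hi : gap y i = 0) :
    0 < pairWeight lam y i := by
  refine Finset.prod_pos fun l hl => ?_
  have hl' := Finset.ne_of_mem_erase hl
  have hce := (coord_eq_iff hlam hp i).mpr hi
  have h1 := (coord_mem hlam hp.1 i.lo)
  have h2 := (coord_mem hlam hp.1 i.hi)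
  rw [Cut.succ_lo] at h1
  have hc : coord lam y i.lo = lam i.hi.castSucc := le_antisymm h1.2 (hce ▸ h2.1)
  rw [regularFactor]
  split_ifs with h3 h4
  · rw [hc]
    have h5 := hlam (by rw [Fin.lt_def]; simp [Cut.hi] : (0 : Fin (n + 1)) < i.hi.castSucc)
    have h6 := hlam (Fin.castSucc_lt_last i.hi)
    exact mul_pos (by linarith) (by linarith)
  · have h5 : lam l.succ < coord lam y i.lo := by
      rw [hc]; exact hlam (by rw [Fin.lt_def] at h4 ⊢; simp [Cut.hi, Cut.lo] at h4 ⊢; omega)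
    have h6 := (coord_mem hlam hp.1 l).2
    exact div_pos (by linarith) (by linarith)
  · have h5 : coord lam y i.lo < lam l.castSucc := by
      rw [hc]
      refine hlam ?_
      rw [ne_eq, Fin.ext_iff] at hl'
      rw [Fin.ext_iff] at h3
      rw [Fin.lt_def] at h4 ⊢
      simp [Cut.hi, Cut.lo] at h3 h4 hl' ⊢
      omega
    have h6 := (coord_mem hlam hp.1 l).1
    exact div_pos (by linarith) (by linarith)

/-- Each factor times its denominator is a distance to the facing endpoint, and `prod_insert_ends`
collects these with the two extreme eigenvalues. The sign comes from `lam (Fin.last n) - coord lam y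
j` in the factor `l = j`. -/
theorem weight_mul_prod (hp : (y, t) ∈ blowUp n) (j : Fin n) :
    weight lam y t j * ∏ l ∈ Finset.univ.erase j, (coord lam y j - coord lam y l) =
      -∏ i, (coord lam y j - lam i) := by
  rw [weight, ← Finset.mul_prod_erase Finset.univ _ (Finset.mem_univ j), mul_assoc,
    ← Finset.prod_mul_distrib, ← prod_insert_ends _ j, factor_self]
  have : ∏ l ∈ Finset.univ.erase j, factor lam y t j l * (coord lam y j - coord lam y l) =
      ∏ l ∈ Finset.univ.erase j, (coord lam y j - lam (if l < j then l.succ else l.castSucc)) := by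
    refine Finset.prod_congr rfl fun l hl => ?_
    split_ifs with h
    · exact factor_mul_of_lt hlam hp h
    · have h' : j < l := lt_of_le_of_ne (not_lt.mp h) (Finset.ne_of_mem_erase hl).symm
      linarith [factor_mul_of_gt hlam hp h']
  rw [this]
  ring

end Order

end Weights

/-! ### The isospectral condition -/

section Isospectral

open Polynomial

variable {n : ℕ}

/-- For nonnegative weights the polynomial is the characteristic polynomial of a real arrow matrix
with off-diagonal entries `√w`, so its degree and its trace coefficient come for free. -/
theorem secular_monic {a₀ : ℝ} {a w : Fin n → ℝ} (hw : ∀ k, 0 ≤ w k) :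
    (secular a₀ a w).Monic ∧ (secular a₀ a w).natDegree = n + 1 ∧
      (secular a₀ a w).coeff n = -(a₀ + ∑ k, a k) := by
  have h : (arrow ℝ a₀ a fun k => √(w k)).charpoly = secular a₀ a w := by
    rw [charpoly_arrow_eq]
    simp [Real.sq_sqrt, hw]
  have h1 := Matrix.trace_eq_neg_charpoly_coeff (arrow ℝ a₀ a fun k => √(w k))
  rw [trace_arrow, h, Fintype.card_fin, Nat.add_sub_cancel] at h1
  refine ⟨h ▸ Matrix.charpoly_monic _, ?_, ?_⟩
  · rw [← h, Matrix.charpoly_natDegree_eq_dim, Fintype.card_fin]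
  · simp at h1; linarith

theorem coeff_prod_X_sub_C (lam : Fin (n + 1) → ℝ) :
    (∏ i, (X - C (lam i))).coeff n = -∑ i, lam i := by
  have := prod_X_sub_C_coeff_card_pred Finset.univ lam (by simp)
  simpa using this

theorem center_eq {lam : Fin (n + 1) → ℝ} {a₀ : ℝ} {a w : Fin n → ℝ} (hw : ∀ k, 0 ≤ w k)
    (h : secular a₀ a w = ∏ i, (X - C (lam i))) : a₀ = ∑ i, lam i - ∑ k, a k := by
  have h1 := (secular_monic (a₀ := a₀) (a := a) hw).2.2
  rw [h, coeff_prod_X_sub_C] at h1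
  linarith

/-- Both sides are monic of degree `n + 1` with the same coefficient in degree `n`, so their
difference has degree less than `n`. It vanishes at the `n` distinct points `a k`. -/
theorem secular_eq_of_injective {lam : Fin (n + 1) → ℝ} {a w : Fin n → ℝ} (hw : ∀ k, 0 ≤ w k)
    (ha : Function.Injective a)
    (h : ∀ k, w k * ∏ l ∈ Finset.univ.erase k, (a k - a l) = -∏ i, (a k - lam i)) :
    secular (∑ i, lam i - ∑ k, a k) a w = ∏ i, (X - C (lam i)) := by
  obtain ⟨h1, h2, h3⟩ := secular_monic (a₀ := ∑ i, lam i - ∑ k, a k) (a := a) hw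
  have h4 : (∏ i, (X - C (lam i))).Monic := monic_prod_of_monic _ _ fun i _ => monic_X_sub_C _
  have h5 : (∏ i, (X - C (lam i))).natDegree = n + 1 := by
    rw [natDegree_prod_of_monic _ _ fun i _ => monic_X_sub_C _]
    simp
  refine eq_of_degree_sub_lt_of_eval_finset_eq (Finset.univ.image a) ?_ ?_
  · rw [Finset.card_image_of_injective _ ha, Finset.card_univ, Fintype.card_fin,
      degree_lt_iff_coeff_zero]
    intro m hm
    rw [coeff_sub]
    rcases hm.eq_or_lt with rfl | hm
    · rw [h3, coeff_prod_X_sub_C]; ring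
    rcases Nat.eq_or_lt_of_le (Nat.succ_le_of_lt hm) with rfl | hm
    · have h6 := h1.coeff_natDegree
      have h7 := h4.coeff_natDegree
      rw [h2] at h6
      rw [h5] at h7
      rw [Nat.succ_eq_add_one, h6, h7, sub_self]
    · rw [coeff_eq_zero_of_natDegree_lt (h2.trans_lt hm),
        coeff_eq_zero_of_natDegree_lt (h5.trans_lt hm), sub_self]
  · intro x hx
    obtain ⟨k, -, rfl⟩ := Finset.mem_image.mp hx
    rw [eval_secular, Finset.prod_eq_zero (Finset.mem_univ k) (sub_self (a k)), mul_zero, zero_sub,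
      Finset.sum_eq_single k _ (by simp), h k, neg_neg, eval_prod]
    · simp
    · intro l _ hl
      rw [Finset.prod_eq_zero (Finset.mem_erase.mpr ⟨hl.symm, Finset.mem_univ k⟩) (sub_self (a k)),
        mul_zero]

end Isospectral

/-! ### Smoothness of the weights on the blow-up -/

section Smooth

variable {n : ℕ} {lam : Fin (n + 1) → ℝ}

theorem contDiff_coord (lam : Fin (n + 1) → ℝ) (j : Fin n) :
    ContDiff ℝ ∞ (fun y : Fin n → ℝ => coord lam y j) :=
  (contDiff_const.add (contDiff_const.mul (contDiff_apply ℝ ℝ j))).div_const 2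

theorem smoothViaAt_coord (j : Fin n) (p : blowUp n) :
    SmoothViaAt (Subtype.val : blowUp n → (Fin n → ℝ) × (Cut n → ℝ))
      (fun p => coord lam p.1.1 j) p :=
  SmoothViaAt.of_contDiff ((contDiff_coord lam j).comp contDiff_fst)

theorem smoothViaAt_split (hlam : StrictMono lam) (i : Cut n) (p : blowUp n) :
    SmoothViaAt (Subtype.val : blowUp n → (Fin n → ℝ) × (Cut n → ℝ))
      (fun p => split lam p.1.2 i) p := by
  have ht : SmoothViaAt (Subtype.val : blowUp n → (Fin n → ℝ) × (Cut n → ℝ))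
      (fun p => p.1.2 i) p :=
    SmoothViaAt.of_contDiff ((contDiff_apply ℝ ℝ i).comp contDiff_snd)
  exact ((SmoothViaAt.const _).mul ht).div continuous_subtype_val
    (((SmoothViaAt.const _).mul ht).add ((SmoothViaAt.const _).mul ((SmoothViaAt.const 1).sub ht)))
    (slope_pos hlam (fun i => (p.2.2 i).1) i).ne'

theorem smoothViaAt_factor (hlam : StrictMono lam) (j l : Fin n) (p : blowUp n) :
    SmoothViaAt (Subtype.val : blowUp n → (Fin n → ℝ) × (Cut n → ℝ))
      (fun p => factor lam p.1.1 p.1.2 j l) p := by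
  rcases lt_trichotomy l j with h | rfl | h
  · obtain ⟨i, rfl, rfl⟩ | h := pair_cases h
    · simp only [factor_hi_lo]
      exact (SmoothViaAt.const 1).sub (smoothViaAt_split hlam i p)
    · simp only [factor_of_lt h]
      exact ((smoothViaAt_coord j p).sub (SmoothViaAt.const _)).div continuous_subtype_val
        ((smoothViaAt_coord j p).sub (smoothViaAt_coord l p))
        (sub_pos.mpr (coord_lt_of_lt hlam p.2.1 h)).ne'
  · simp only [factor_self]
    exact ((smoothViaAt_coord l p).sub (SmoothViaAt.const _)).mul
      ((SmoothViaAt.const _).sub (smoothViaAt_coord l p))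
  · obtain ⟨i, rfl, rfl⟩ | h := pair_cases h
    · simp only [factor_lo_hi]
      exact smoothViaAt_split hlam i p
    · simp only [factor_of_gt h]
      exact ((SmoothViaAt.const _).sub (smoothViaAt_coord j p)).div continuous_subtype_val
        ((smoothViaAt_coord l p).sub (smoothViaAt_coord j p))
        (sub_pos.mpr (coord_lt_of_lt hlam p.2.1 h)).ne'

theorem smoothViaAt_weight (hlam : StrictMono lam) (j : Fin n) (p : blowUp n) :
    SmoothViaAt (Subtype.val : blowUp n → (Fin n → ℝ) × (Cut n → ℝ))
      (fun p => weight lam p.1.1 p.1.2 j) p :=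
  SmoothViaAt.prod fun l _ => smoothViaAt_factor hlam j l p

theorem continuous_weight (hlam : StrictMono lam) (j : Fin n) :
    Continuous (fun p : blowUp n => weight lam p.1.1 p.1.2 j) :=
  continuous_iff_continuousAt.mpr fun p =>
    (smoothViaAt_weight hlam j p).continuousAt continuous_subtype_val

theorem continuous_coord (lam : Fin (n + 1) → ℝ) (j : Fin n) :
    Continuous (fun p : blowUp n => coord lam p.1.1 j) :=
  (contDiff_coord lam j).continuous.comp (continuous_fst.comp continuous_subtype_val)

end Smooth

/-! ### Solutions of the spectral equation -/

section Spectrum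

open Polynomial

variable {n : ℕ} {lam : Fin (n + 1) → ℝ} {y : Fin n → ℝ} {t : Cut n → ℝ}

theorem mem_closure_interior_subtype {ε : ℝ} (h1 : ε < 1) (x : B n ε) :
    x ∈ closure {z : B n ε | z.1 ∈ interior (B n ε)} := by
  rw [closure_subtype]
  refine closure_mono ?_ (subset_closure_interior_B h1 x.2)
  exact fun z hz => ⟨⟨z, interior_subset hz⟩, hz, rfl⟩

/-- Density is easy in the convex polytope and is carried over by the homeomorphism. -/
theorem mem_closure_open_blowUp (p : blowUp n) :
    p ∈ closure {p : blowUp n | ∀ k, p.1.1 k ∈ Set.Ioo (-1 : ℝ) 1} := by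
  -- Any cutting depth serves.
  obtain ⟨ρ, κ, h⟩ := exists_isProfile (ε := 1 / 2) (by norm_num) (by norm_num)
  set e := blowUpHomeo (n := n) h (by norm_num) (by norm_num)
  have h2 := map_mem_closure e.continuous
    (mem_closure_interior_subtype (by norm_num) (e.symm p))
    (t := {p : blowUp n | ∀ k, p.1.1 k ∈ Set.Ioo (-1 : ℝ) 1})
    (fun z hz k => down_mem_Ioo_of_mem_interior h (by norm_num) hz k)
  rwa [e.apply_symm_apply] at h2

/-- The diagonal entry of the centre. -/
def center (lam : Fin (n + 1) → ℝ) (a : Fin n → ℝ) : ℝ := ∑ i, lam i - ∑ k, a k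

variable (hlam : StrictMono lam)
include hlam

theorem coord_strictMono (hp : (y, t) ∈ blowUp n) (hy : ∀ k, y k ∈ Set.Ioo (-1 : ℝ) 1) :
    StrictMono (coord lam y) := by
  intro k j hkj
  refine lt_of_le_of_ne (coord_monotone hlam hp hkj.le) fun he => ?_
  obtain ⟨i, rfl, rfl, hi⟩ := exists_cut_of_coord_eq hlam hp hkj he
  rw [gap] at hi
  linarith [(hy i.lo).2, (hy i.hi).1]

/-- Over the open cube the entries are distinct and interpolation applies. For each `x` the equality
of values at `x` is a closed condition, so it extends to the whole blow-up by density. -/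
theorem secular_weight (hp : (y, t) ∈ blowUp n) :
    secular (center lam (coord lam y)) (coord lam y) (weight lam y t) =
      ∏ i, (X - C (lam i)) := by
  let S : Set (blowUp n) := {p | ∀ x, (secular (center lam (coord lam p.1.1)) (coord lam p.1.1)
    (weight lam p.1.1 p.1.2)).eval x = (∏ i, (X - C (lam i))).eval x}
  have hS : IsClosed S := by
    simp only [S, Set.ofPred_forall]
    refine isClosed_iInter fun x => isClosed_eq ?_ continuous_const
    have h1 := continuous_coord lam (n := n)
    have h2 := continuous_weight hlam (n := n)
    simp only [eval_secular, center]
    fun_prop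
  have hsub : {p : blowUp n | ∀ k, p.1.1 k ∈ Set.Ioo (-1 : ℝ) 1} ⊆ S := fun p hp x => by
    have hq : (p.1.1, p.1.2) ∈ blowUp n := p.2
    rw [center, secular_eq_of_injective (weight_nonneg hlam hq)
      (coord_strictMono hlam hq hp).injective (weight_mul_prod hlam hq)]
  exact Polynomial.funext fun x =>
    closure_minimal hsub hS (mem_closure_open_blowUp ⟨(y, t), hp⟩) x

/-- The coordinate of the blow-up whose splitting ratio is `τ`. -/
def unsplit (lam : Fin (n + 1) → ℝ) (i : Cut n) (τ : ℝ) : ℝ :=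
  len lam i.hi * τ / (len lam i.lo * (1 - τ) + len lam i.hi * τ)

theorem unsplit_denom_pos (i : Cut n) {τ : ℝ} (hτ : τ ∈ Set.Icc (0 : ℝ) 1) :
    0 < len lam i.lo * (1 - τ) + len lam i.hi * τ := by
  have h1 := len_pos hlam i.lo
  have h2 := len_pos hlam i.hi
  obtain ⟨h3, h4⟩ := hτ
  rcases h3.eq_or_lt with h | h
  · rw [← h]; linarith
  · have := mul_pos h2 h
    have := mul_nonneg h1.le (sub_nonneg.mpr h4)
    linarith

theorem unsplit_mem (i : Cut n) {τ : ℝ} (hτ : τ ∈ Set.Icc (0 : ℝ) 1) :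
    unsplit lam i τ ∈ Set.Icc (0 : ℝ) 1 := by
  have h := unsplit_denom_pos hlam i hτ
  have h1 := mul_nonneg (len_pos hlam i.lo).le (sub_nonneg.mpr hτ.2)
  exact ⟨div_nonneg (mul_nonneg (len_pos hlam i.hi).le hτ.1) h.le,
    div_le_one_of_le₀ (by linarith) h.le⟩

theorem unsplit_split (ht : ∀ i, t i ∈ Set.Icc (0 : ℝ) 1) (i : Cut n) :
    unsplit lam i (split lam t i) = t i := by
  have h1 := unsplit_denom_pos hlam i (split_mem hlam ht i)
  rw [unsplit, div_eq_iff h1.ne', one_sub_split hlam ht, split]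
  have h := (slope_pos hlam ht i).ne'
  field_simp
  ring

theorem split_unsplit (i : Cut n) {τ : ℝ} (hτ : τ ∈ Set.Icc (0 : ℝ) 1)
    (hi : t i = unsplit lam i τ) : split lam t i = τ := by
  have h1 := (unsplit_denom_pos hlam i hτ).ne'
  have h2 := (len_pos hlam i.lo).ne'
  have h3 := (len_pos hlam i.hi).ne'
  have h4 : 1 - t i = len lam i.lo * (1 - τ) / (len lam i.lo * (1 - τ) + len lam i.hi * τ) := by
    rw [hi, unsplit, eq_div_iff h1, sub_mul, div_mul_cancel₀ _ h1]; ring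
  have h5 : slope lam t i =
      len lam i.lo * len lam i.hi / (len lam i.lo * (1 - τ) + len lam i.hi * τ) := by
    rw [slope, h4, hi, unsplit, eq_div_iff h1, add_mul, mul_assoc, mul_assoc,
      div_mul_cancel₀ _ h1, div_mul_cancel₀ _ h1]
    ring
  rw [split, h5, hi, unsplit]
  field_simp

/-- The coordinate of the blow-up in terms of the squared off-diagonal entries `w`. -/
def recover (lam : Fin (n + 1) → ℝ) (y w : Fin n → ℝ) (i : Cut n) : ℝ :=
  if gap y i = 0 then unsplit lam i (w i.lo / pairWeight lam y i) else (1 - y i.lo) / gap y i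

theorem split_eq_div (hp : (y, t) ∈ blowUp n) {i : Cut n} (hi : gap y i = 0) :
    split lam t i = weight lam y t i.lo / pairWeight lam y i := by
  rw [weight_lo hlam hp fun l => coord_ne_of_gap_eq_zero hlam hp hi,
    mul_div_cancel_right₀ _ (pairWeight_pos hlam hp hi).ne']

theorem recover_weight (hp : (y, t) ∈ blowUp n) : recover lam y (weight lam y t) = t := by
  funext i
  rw [recover]
  split_ifs with hi
  · rw [← split_eq_div hlam hp hi, unsplit_split hlam fun i => (hp.2 i).1]
  · rw [one_sub_lo_of_mem_blowUp hp, mul_div_cancel_right₀ _ hi]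

theorem filter_coord_pair (hp : (y, t) ∈ blowUp n) {i : Cut n} (hi : gap y i = 0) :
    Finset.univ.filter (fun k => coord lam y k = coord lam y i.lo) = {i.lo, i.hi} := by
  ext k
  simp only [Finset.mem_filter, Finset.mem_univ, true_and, Finset.mem_insert,
    Finset.mem_singleton]
  constructor
  · intro hk
    by_contra! hc
    exact coord_ne_of_gap_eq_zero hlam hp hi hc.1 hc.2 hk
  · rintro (rfl | rfl)
    · rfl
    · exact ((coord_eq_iff hlam hp i).mpr hi).symm

/-- At a collision exactly two entries agree, so the fibre sum is a sum of two weights. -/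
theorem pair_sum_eq (hp : (y, t) ∈ blowUp n) {i : Cut n} (hi : gap y i = 0) {a₀ : ℝ}
    {w w' : Fin n → ℝ} (h : secular a₀ (coord lam y) w = secular a₀ (coord lam y) w') :
    w i.lo + w i.hi = w' i.lo + w' i.hi := by
  have := sum_fiber_eq_of_secular_eq h (coord lam y i.lo)
  rwa [filter_coord_pair hlam hp hi, Finset.sum_pair i.lo_lt_hi.ne,
    Finset.sum_pair i.lo_lt_hi.ne] at this

/-- Every solution of the spectral equation comes from the blow-up. -/
theorem exists_weight_eq (hy : y ∈ cube n) {a₀ : ℝ} {w : Fin n → ℝ} (hw : ∀ k, 0 ≤ w k)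
    (h : secular a₀ (coord lam y) w = ∏ i, (X - C (lam i))) :
    ∃ t, (y, t) ∈ blowUp n ∧ weight lam y t = w := by
  have ha₀ : a₀ = center lam (coord lam y) := center_eq hw h
  have hsec : ∀ t, (y, t) ∈ blowUp n →
      secular a₀ (coord lam y) (weight lam y t) = secular a₀ (coord lam y) w := fun t ht => by
    rw [h, ha₀, secular_weight hlam ht]
  -- A comparison point: over each face take the ratio `1`. Then `split` is `1`, the upper weight of
  -- a colliding pair vanishes and the lower one is all of `pairWeight`, so `w i.lo + w i.hi =
  -- pairWeight lam y i`.
  have hp1 := lift_mem_blowUp (c := 1) ⟨zero_le_one, le_rfl⟩ hy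
  have hratio : ∀ i, gap y i = 0 → w i.lo / pairWeight lam y i ∈ Set.Icc (0 : ℝ) 1 := by
    intro i hi
    have hpos := pairWeight_pos hlam hp1 hi
    have h1 := pair_sum_eq hlam hp1 hi (hsec _ hp1)
    have hs : split lam (liftAngle 1 y) i = 1 := by
      have := one_sub_split hlam (fun i => (hp1.2 i).1) i
      have hl : liftAngle 1 y i = 1 := if_pos hi
      change 1 - split lam (liftAngle 1 y) i = len lam i.hi * (1 - liftAngle 1 y i) / _ at this
      rw [hl, sub_self, mul_zero, zero_div] at this
      linarith
    have hhi : weight lam y (liftAngle 1 y) i.hi = 0 :=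
      Finset.prod_eq_zero (Finset.mem_univ i.lo) (by rw [factor_hi_lo, hs, sub_self])
    rw [weight_lo hlam hp1 fun l => coord_ne_of_gap_eq_zero hlam hp1 hi, hs, one_mul, hhi,
      add_zero] at h1
    refine ⟨div_nonneg (hw _) hpos.le, div_le_one_of_le₀ ?_ hpos.le⟩
    linarith [hw i.hi]
  have hp : (y, recover lam y w) ∈ blowUp n := by
    refine ⟨hy, fun i => ?_⟩
    by_cases hi : gap y i = 0
    · change recover lam y w i ∈ _ ∧ recover lam y w i * (1 + y i.hi) =
        (1 - recover lam y w i) * (1 - y i.lo)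
      rw [recover, if_pos hi]
      refine ⟨unsplit_mem hlam i (hratio i hi), ?_⟩
      have h1 := (hy i.lo).2
      have h2 := (hy i.hi).1
      rw [gap] at hi
      rw [show y i.lo = 1 by linarith, show y i.hi = -1 by linarith]
      ring
    · have := hp1.2 i
      have he : recover lam y w i = liftAngle 1 y i := by
        rw [recover, liftAngle, if_neg hi, if_neg hi]
      change recover lam y w i ∈ _ ∧ recover lam y w i * (1 + y i.hi) =
        (1 - recover lam y w i) * (1 - y i.lo)
      rw [he]
      exact this
  refine ⟨recover lam y w, hp, ?_⟩
  have hlo : ∀ i, gap y i = 0 → weight lam y (recover lam y w) i.lo = w i.lo := fun i hi => by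
    rw [weight_lo hlam hp fun l => coord_ne_of_gap_eq_zero hlam hp hi,
      split_unsplit hlam i (hratio i hi) (if_pos hi),
      div_mul_cancel₀ _ (pairWeight_pos hlam hp hi).ne']
  funext j
  -- In a colliding pair the lower weight is right by the choice of the ratio, and the upper one by
  -- the pair sum. The weight of a simple entry is a fibre sum over one element.
  by_cases hj : ∃ i : Cut n, gap y i = 0 ∧ (i.lo = j ∨ i.hi = j)
  · obtain ⟨i, hi, rfl | rfl⟩ := hj
    · exact hlo i hi
    · have := pair_sum_eq hlam hp hi (hsec _ hp)
      linarith [hlo i hi]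
  · have hf : Finset.univ.filter (fun k => coord lam y k = coord lam y j) = {j} := by
      ext k
      simp only [Finset.mem_filter, Finset.mem_univ, true_and, Finset.mem_singleton]
      constructor
      · intro hk
        by_contra hkj
        rcases lt_or_gt_of_ne hkj with h' | h'
        · obtain ⟨i, -, h2, h3⟩ := exists_cut_of_coord_eq hlam hp h' hk
          exact hj ⟨i, h3, Or.inr h2⟩
        · obtain ⟨i, h2, -, h3⟩ := exists_cut_of_coord_eq hlam hp h' hk.symm
          exact hj ⟨i, h3, Or.inl h2⟩
      · rintro rfl; rfl
    have := sum_fiber_eq_of_secular_eq (hsec _ hp) (coord lam y j)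
    rwa [hf, Finset.sum_singleton, Finset.sum_singleton] at this

end Spectrum

/-! ### Interlacing -/

section Interlacing

variable {𝕜 : Type} [RCLike 𝕜]

theorem quadratic_form_eq {ι : Type*} [Fintype ι] [DecidableEq ι] {A : Matrix ι ι 𝕜}
    (hA : A.IsHermitian) (v : ι → 𝕜) :
    star v ⬝ᵥ A.mulVec v = ∑ j, ((hA.eigenvalues j : ℝ) : 𝕜) *
      ((‖(star (hA.eigenvectorUnitary : Matrix ι ι 𝕜)).mulVec v j‖ ^ 2 : ℝ) : 𝕜) := by
  set U : Matrix ι ι 𝕜 := hA.eigenvectorUnitary.1 with hU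
  have hz : star ((star U).mulVec v) = Matrix.vecMul (star v) U := by
    rw [Matrix.star_mulVec, Matrix.star_eq_conjTranspose, Matrix.conjTranspose_conjTranspose]
  have h1 : star v ⬝ᵥ A.mulVec v = star ((star U).mulVec v) ⬝ᵥ
      (Matrix.diagonal (RCLike.ofReal ∘ hA.eigenvalues)).mulVec ((star U).mulVec v) := by
    conv_lhs => rw [hA.spectral_theorem, Unitary.conjStarAlgAut_apply]
    rw [hz, ← hU, ← Matrix.dotProduct_mulVec, Matrix.mulVec_mulVec, Matrix.mulVec_mulVec]
  rw [h1, dotProduct]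
  refine Finset.sum_congr rfl fun j _ => ?_
  rw [Matrix.mulVec_diagonal, Pi.star_apply, mul_left_comm, RCLike.star_def, RCLike.conj_mul]
  simp

theorem norm_form_eq {ι : Type*} [Fintype ι] [DecidableEq ι] {A : Matrix ι ι 𝕜}
    (hA : A.IsHermitian) (v : ι → 𝕜) :
    star v ⬝ᵥ v = ∑ j,
      ((‖(star (hA.eigenvectorUnitary : Matrix ι ι 𝕜)).mulVec v j‖ ^ 2 : ℝ) : 𝕜) := by
  set U : Matrix ι ι 𝕜 := hA.eigenvectorUnitary.1 with hU
  have hz : star ((star U).mulVec v) = Matrix.vecMul (star v) U := by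
    rw [Matrix.star_mulVec, Matrix.star_eq_conjTranspose, Matrix.conjTranspose_conjTranspose]
  have h1 : star v ⬝ᵥ v = star ((star U).mulVec v) ⬝ᵥ (star U).mulVec v := by
    rw [hz, ← Matrix.dotProduct_mulVec, Matrix.mulVec_mulVec, hU,
      Unitary.mul_star_self_of_mem hA.eigenvectorUnitary.2, Matrix.one_mulVec]
  rw [h1, dotProduct]
  refine Finset.sum_congr rfl fun j _ => ?_
  rw [Pi.star_apply, RCLike.star_def, RCLike.conj_mul]
  simp

/-- A Hermitian form which is diagonal and definite on a coordinate subspace has at least as many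
eigenvalues of that sign as the dimension of the subspace. -/
theorem card_le_card_eigenvalues {ι : Type*} [Fintype ι] [DecidableEq ι] {A : Matrix ι ι 𝕜}
    (hA : A.IsHermitian) (S : Finset ι) (hS : ∀ i ∈ S, ∀ j ∈ S, i ≠ j → A i j = 0) (δ c : ℝ)
    (hneg : ∀ i ∈ S, δ * (RCLike.re (A i i) - c) < 0) :
    S.card ≤ (Finset.univ.filter fun j => δ * (hA.eigenvalues j - c) < 0).card := by
  set T := Finset.univ.filter fun j => δ * (hA.eigenvalues j - c) < 0 with hT
  by_contra! hlt
  set U : Matrix ι ι 𝕜 := hA.eigenvectorUnitary.1 with hU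
  -- The kernel consists of the vectors supported on `S` without components along the eigenvectors
  -- in `T`; it is nonzero for dimension reasons if `T` is smaller than `S`. On such a vector the
  -- form of `δ (A - c)` is negative in the standard coordinates and nonnegative in the eigenbasis.
  let f : (ι → 𝕜) →ₗ[𝕜] ({i // i ∉ S} → 𝕜) × ({j // j ∈ T} → 𝕜) :=
    (LinearMap.funLeft 𝕜 𝕜 Subtype.val).prod
      ((LinearMap.funLeft 𝕜 𝕜 Subtype.val).comp (Matrix.mulVecLin (star U)))
  have hker : LinearMap.ker f ≠ ⊥ := by
    refine LinearMap.ker_ne_bot_of_finrank_lt ?_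
    rw [Module.finrank_prod, Module.finrank_fintype_fun_eq_card, Module.finrank_fintype_fun_eq_card,
      Module.finrank_fintype_fun_eq_card, Fintype.card_subtype_compl, Fintype.card_coe,
      Fintype.card_coe]
    have := S.card_le_univ
    omega
  obtain ⟨v, hv, hv0⟩ := Submodule.exists_mem_ne_zero_of_ne_bot hker
  have hv1 : ∀ i, i ∉ S → v i = 0 := fun i hi =>
    congrFun (congrArg Prod.fst (LinearMap.mem_ker.mp hv)) ⟨i, hi⟩
  have hv2 : ∀ j ∈ T, (star U).mulVec v j = 0 := fun j hj =>
    congrFun (congrArg Prod.snd (LinearMap.mem_ker.mp hv)) ⟨j, hj⟩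
  have hdiag : ∀ i, A i i = ((RCLike.re (A i i) : ℝ) : 𝕜) := fun i =>
    (RCLike.conj_eq_iff_re.mp (hA.apply i i)).symm
  have hq : star v ⬝ᵥ A.mulVec v =
      ∑ i, ((RCLike.re (A i i) : ℝ) : 𝕜) * ((‖v i‖ ^ 2 : ℝ) : 𝕜) := by
    rw [dotProduct]
    refine Finset.sum_congr rfl fun i _ => ?_
    by_cases hi : i ∈ S
    · rw [Matrix.mulVec, dotProduct, Finset.sum_eq_single i, Pi.star_apply, mul_left_comm,
        RCLike.star_def, RCLike.conj_mul, ← hdiag]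
      · simp
      · intro j _ hj
        by_cases hjS : j ∈ S
        · rw [hS i hi j hjS hj.symm, zero_mul]
        · rw [hv1 j hjS, mul_zero]
      · simp
    · simp [hv1 i hi]
  have hn : star v ⬝ᵥ v = ∑ i, ((‖v i‖ ^ 2 : ℝ) : 𝕜) := by
    rw [dotProduct]
    refine Finset.sum_congr rfl fun i _ => ?_
    rw [Pi.star_apply, RCLike.star_def, RCLike.conj_mul]
    simp
  have h1 : ∑ i, RCLike.re (A i i) * ‖v i‖ ^ 2 =
      ∑ j, hA.eigenvalues j * ‖(star U).mulVec v j‖ ^ 2 := by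
    have := hq.symm.trans (quadratic_form_eq hA v)
    exact_mod_cast this
  have h2 : ∑ i, ‖v i‖ ^ 2 = ∑ j, ‖(star U).mulVec v j‖ ^ 2 := by
    have := hn.symm.trans (norm_form_eq hA v)
    exact_mod_cast this
  have h3 : ∑ i, δ * (RCLike.re (A i i) - c) * ‖v i‖ ^ 2 =
      ∑ j, δ * (hA.eigenvalues j - c) * ‖(star U).mulVec v j‖ ^ 2 := by
    have e1 : ∀ x : ι → ℝ, ∀ z : ι → ℝ, ∑ i, δ * (x i - c) * z i =
        δ * (∑ i, x i * z i) - δ * c * ∑ i, z i := fun x z => by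
      rw [Finset.mul_sum, Finset.mul_sum, ← Finset.sum_sub_distrib]
      exact Finset.sum_congr rfl fun i _ => by ring
    rw [e1, e1, h1, h2]
  have h4 : 0 ≤ ∑ j, δ * (hA.eigenvalues j - c) * ‖(star U).mulVec v j‖ ^ 2 := by
    refine Finset.sum_nonneg fun j _ => ?_
    by_cases hj : j ∈ T
    · simp [hv2 j hj]
    · have : 0 ≤ δ * (hA.eigenvalues j - c) := by simpa [hT] using hj
      positivity
  have h5 : ∑ i, δ * (RCLike.re (A i i) - c) * ‖v i‖ ^ 2 < 0 := by
    obtain ⟨i, hi⟩ := Function.ne_iff.mp hv0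
    have hle : ∀ i, δ * (RCLike.re (A i i) - c) * ‖v i‖ ^ 2 ≤ 0 := fun i => by
      by_cases hiS : i ∈ S
      · exact mul_nonpos_of_nonpos_of_nonneg (hneg i hiS).le (by positivity)
      · simp [hv1 i hiS]
    refine Finset.sum_neg' (fun i _ => hle i) ⟨i, Finset.mem_univ i, ?_⟩
    have hiS : i ∈ S := by
      by_contra h; exact hi (hv1 i h)
    have : 0 < ‖v i‖ := norm_pos_iff.mpr hi
    exact mul_neg_of_neg_of_pos (hneg i hiS) (by positivity)
  linarith

theorem card_eigenvalues_filter {N : ℕ} {A : Matrix (Fin N) (Fin N) 𝕜} (hA : A.IsHermitian)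
    {lam : Fin N → ℝ}
    (h : A.charpoly = ∏ i, (Polynomial.X - Polynomial.C (lam i : 𝕜))) (p : ℝ → Prop)
    [DecidablePred p] :
    (Finset.univ.filter fun j => p (hA.eigenvalues j)).card =
      (Finset.univ.filter fun i => p (lam i)).card := by
  have h1 : (Finset.univ.val.map fun j => ((hA.eigenvalues j : ℝ) : 𝕜)) =
      Finset.univ.val.map fun i => ((lam i : ℝ) : 𝕜) := by
    have := congrArg Polynomial.roots (hA.charpoly_eq.symm.trans h)
    rw [Polynomial.roots_prod _ _ (Polynomial.monic_prod_of_monic _ _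
      fun i _ => Polynomial.monic_X_sub_C _).ne_zero,
      Polynomial.roots_prod _ _ (Polynomial.monic_prod_of_monic _ _
      fun i _ => Polynomial.monic_X_sub_C _).ne_zero] at this
    simp only [Polynomial.roots_X_sub_C, Multiset.bind_singleton] at this
    exact this
  have h2 : Finset.univ.val.map hA.eigenvalues = Finset.univ.val.map lam := by
    have h3 := congrArg (Multiset.map (RCLike.re : 𝕜 → ℝ)) h1
    simpa [Multiset.map_map, Function.comp_def] using h3
  have h4 := congrArg (Multiset.countP p) h2
  rw [Multiset.countP_map, Multiset.countP_map] at h4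
  exact h4

variable {n : ℕ} {lam : Fin (n + 1) → ℝ}

/-- The leaves span a coordinate subspace on which the form is diagonal. The sign `δ` serves to
count the entries below `c` and those above `c` at once. -/
theorem card_entries_lt {A : Matrix (Fin (n + 1)) (Fin (n + 1)) 𝕜} (hA : A ∈ isospectral 𝕜 lam)
    (δ c : ℝ) :
    (Finset.univ.filter fun k : Fin n => δ * (RCLike.re (A k.succ k.succ) - c) < 0).card ≤
      (Finset.univ.filter fun i => δ * (lam i - c) < 0).card := by
  obtain ⟨h1, h2, h3⟩ := hA
  rw [← card_eigenvalues_filter h1 h3 (fun x => δ * (x - c) < 0),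
    ← Finset.card_map (Fin.succEmb n)]
  refine card_le_card_eigenvalues h1 _ ?_ δ c ?_
  · intro i hi j hj hij
    obtain ⟨i, -, rfl⟩ := Finset.mem_map.mp hi
    obtain ⟨j, -, rfl⟩ := Finset.mem_map.mp hj
    exact h2 i j fun h => hij (by rw [h])
  · intro i hi
    obtain ⟨k, hk, rfl⟩ := Finset.mem_map.mp hi
    exact (Finset.mem_filter.mp hk).2

/-- Cauchy interlacing for the leaves of the star. -/
theorem exists_mem_cubeAt (hlam : StrictMono lam) {A : Matrix (Fin (n + 1)) (Fin (n + 1)) 𝕜}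
    (hA : A ∈ isospectral 𝕜 lam) :
    ∃ s : Equiv.Perm (Fin n), (fun k : Fin n => RCLike.re (A k.succ k.succ)) ∈ cubeAt lam s := by
  set a := fun k : Fin n => RCLike.re (A k.succ k.succ) with ha
  have hmono := Tuple.monotone_sort a
  set σ := Tuple.sort a
  refine ⟨σ.symm, fun k => ?_⟩
  obtain ⟨j, rfl⟩ := σ.surjective k
  rw [Equiv.symm_apply_apply]
  constructor
  -- In increasing order, the entries up to position `j` would be `j + 1` entries below an
  -- eigenvalue that has only `j` eigenvalues below it.
  · by_contra! hlt
    have h1 : (Finset.univ.filter fun k => 1 * (a k - lam j.castSucc) < 0).card ≤ _ :=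
      card_entries_lt hA 1 (lam j.castSucc)
    have h2 : (Finset.univ.filter fun i => 1 * (lam i - lam j.castSucc) < 0) =
        Finset.Iio j.castSucc := by
      ext i; simp [hlam.lt_iff_lt]
    have h3 : (Finset.Iic j).map σ.toEmbedding ⊆
        Finset.univ.filter fun k : Fin n => 1 * (a k - lam j.castSucc) < 0 := by
      intro k hk
      obtain ⟨i, hi, rfl⟩ := Finset.mem_map.mp hk
      have : a (σ i) ≤ a (σ j) := hmono (Finset.mem_Iic.mp hi)
      simp only [Finset.mem_filter, Finset.mem_univ, true_and, one_mul, Equiv.coe_toEmbedding]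
      linarith
    have h4 := Finset.card_le_card h3
    rw [Finset.card_map, Fin.card_Iic] at h4
    rw [h2, Fin.card_Iio, Fin.val_castSucc] at h1
    omega
  -- The entries from position `j` on would be `n - j` entries above an eigenvalue that has only `n
  -- - j - 1` eigenvalues above it.
  · by_contra! hlt
    have h1 : (Finset.univ.filter fun k => -1 * (a k - lam j.succ) < 0).card ≤ _ :=
      card_entries_lt hA (-1) (lam j.succ)
    have h2 : (Finset.univ.filter fun i => -1 * (lam i - lam j.succ) < 0) =
        Finset.Ioi j.succ := by
      ext i; simp [hlam.lt_iff_lt]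
    have h3 : (Finset.Ici j).map σ.toEmbedding ⊆
        Finset.univ.filter fun k : Fin n => -1 * (a k - lam j.succ) < 0 := by
      intro k hk
      obtain ⟨i, hi, rfl⟩ := Finset.mem_map.mp hk
      have : a (σ j) ≤ a (σ i) := hmono (Finset.mem_Ici.mp hi)
      simp only [Finset.mem_filter, Finset.mem_univ, true_and, Equiv.coe_toEmbedding]
      linarith
    have h4 := Finset.card_le_card h3
    rw [Finset.card_map, Fin.card_Ici] at h4
    rw [h2, Fin.card_Ioi, Fin.val_succ] at h1
    have := j.isLt
    omega

end Interlacing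

/-! ### The part of the orbit space over a cube -/

section OrbitSpace

variable {𝕜 : Type} [RCLike 𝕜] {n : ℕ} {lam : Fin (n + 1) → ℝ}

theorem diag_eq_ofReal (A : M 𝕜 lam) (i : Fin (n + 1)) :
    A.1 i i = ((RCLike.re (A.1 i i) : ℝ) : 𝕜) :=
  (RCLike.conj_eq_iff_re.mp (A.2.1.apply i i)).symm

theorem invariants_orb (A : M 𝕜 lam) :
    invariants (orb A) = (fun i => RCLike.re (A.1 i i), fun k => ‖A.1 0 k.succ‖ ^ 2) := rfl

theorem continuous_invariants :
    Continuous (invariants : Q 𝕜 lam → (Fin (n + 1) → ℝ) × (Fin n → ℝ)) := by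
  have h : ∀ i j, Continuous fun A : M 𝕜 lam => A.1 i j := fun i j =>
    (continuous_id.matrix_elem i j).comp continuous_subtype_val
  exact Continuous.quotient_lift ((continuous_pi fun i => RCLike.continuous_re.comp (h i i)).prodMk
    (continuous_pi fun k : Fin n => (h 0 k.succ).norm.pow 2)) _

theorem continuous_orb : Continuous (orb : M 𝕜 lam → Q 𝕜 lam) := continuous_quotient_mk'

theorem orb_surjective : Function.Surjective (orb : M 𝕜 lam → Q 𝕜 lam) := Quotient.mk_surjective

theorem orb_eq_orb_iff {A A' : M 𝕜 lam} : orb A = orb A' ↔ ∃ t : Torus 𝕜 n, t • A' = A :=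
  Quotient.eq.trans Iff.rfl

/-- By hermiticity the diagonal is real and the products of opposite entries are `|b_k|²`, so the
equation over `𝕜` already holds over `ℝ`. -/
theorem secular_invariants (q : Q 𝕜 lam) :
    secular ((invariants q).1 0) (moment q) (invariants q).2 =
      ∏ i, (Polynomial.X - Polynomial.C (lam i)) := by
  obtain ⟨A, rfl⟩ := orb_surjective q
  apply Polynomial.map_injective (algebraMap ℝ 𝕜) (algebraMap ℝ 𝕜).injective
  rw [secular_map, Polynomial.map_prod]
  have h : A.1.charpoly = ∏ i, (Polynomial.X - Polynomial.C (lam i : 𝕜)) := A.2.2.2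
  rw [charpoly_arrow A.2.2.1] at h
  have h2 : ∀ k : Fin n, A.1 0 k.succ * A.1 k.succ 0 = ((‖A.1 0 k.succ‖ ^ 2 : ℝ) : 𝕜) := fun k => by
    rw [← A.2.1.apply k.succ 0, RCLike.star_def, RCLike.mul_conj]
    simp
  rw [diag_eq_ofReal A 0] at h
  simp only [h2] at h
  rw [funext fun k : Fin n => diag_eq_ofReal A k.succ] at h
  refine Eq.trans rfl (h.trans (Finset.prod_congr rfl fun i _ => ?_))
  rw [Polynomial.map_sub, Polynomial.map_X, Polynomial.map_C]

theorem invariants_nonneg (q : Q 𝕜 lam) (k : Fin n) : 0 ≤ (invariants q).2 k := by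
  obtain ⟨A, rfl⟩ := orb_surjective q
  exact sq_nonneg _

theorem exists_unitary_mul_eq {z z' : 𝕜} (h : ‖z‖ ^ 2 = ‖z'‖ ^ 2) :
    ∃ t : unitary 𝕜, z' * star (t : 𝕜) = z := by
  have h : ‖z‖ = ‖z'‖ := (sq_eq_sq₀ (norm_nonneg _) (norm_nonneg _)).mp h
  by_cases hz : z' = 0
  · refine ⟨1, ?_⟩
    rw [hz, norm_zero, norm_eq_zero] at h
    rw [hz, h, zero_mul]
  · have hn : ‖z / z'‖ = 1 := by
      rw [norm_div, h, div_self (norm_ne_zero_iff.mpr hz)]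
    refine ⟨⟨star (z / z'), ?_⟩, ?_⟩
    · rw [Unitary.mem_iff, RCLike.star_def, RCLike.conj_mul, RCLike.mul_conj, RCLike.norm_conj, hn]
      simp
    · rw [star_star, mul_div_cancel₀ _ hz]

/-- The phase of each `b_k` is adjusted independently by its own `t_k`; the rest of the matrix is
the real diagonal and the conjugates of row zero. -/
theorem invariants_injective :
    Function.Injective (invariants : Q 𝕜 lam → (Fin (n + 1) → ℝ) × (Fin n → ℝ)) := by
  intro q q' h
  obtain ⟨A, rfl⟩ := orb_surjective q
  obtain ⟨A', rfl⟩ := orb_surjective q'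
  rw [invariants_orb, invariants_orb, Prod.mk.injEq] at h
  choose t ht using fun k : Fin n => exists_unitary_mul_eq (congrFun h.2 k)
  refine orb_eq_orb_iff.mpr ⟨t, Subtype.ext ?_⟩
  have hrow : ∀ k : Fin n, (t • A').1 0 k.succ = A.1 0 k.succ := fun k => by
    rw [torus_smul_apply, phase_zero, phase_succ, one_mul, ht]
  have hdiag : ∀ i, (t • A').1 i i = A.1 i i := fun i => by
    rw [torus_smul_diag, diag_eq_ofReal A, diag_eq_ofReal A', congrFun h.1 i]
  ext i j
  refine Fin.cases ?_ (fun i => ?_) i <;> refine Fin.cases ?_ (fun j => ?_) j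
  · exact hdiag 0
  · exact hrow j
  · rw [← (t • A').2.1.apply, ← A.2.1.apply, hrow]
  · by_cases hij : i = j
    · rw [hij]; exact hdiag _
    · rw [(t • A').2.2.1 i j hij, A.2.2.1 i j hij]

/-! #### The section over the blow-up -/

theorem center_comp (s : Equiv.Perm (Fin n)) (a : Fin n → ℝ) :
    center lam (fun k => a (s k)) = center lam a := by
  rw [center, center, Equiv.sum_comp s a]

theorem arrow_mem_isospectral (hlam : StrictMono lam) (s : Equiv.Perm (Fin n)) (p : blowUp n) :
    arrow 𝕜 (center lam (coord lam p.1.1)) (fun k => coord lam p.1.1 (s k))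
      (fun k => √(weight lam p.1.1 p.1.2 (s k))) ∈ isospectral 𝕜 lam := by
  have hp : (p.1.1, p.1.2) ∈ blowUp n := p.2
  refine ⟨isHermitian_arrow _ _ _ _, fun i j hij => by simp [hij], ?_⟩
  rw [charpoly_arrow_eq]
  simp only [Real.sq_sqrt (weight_nonneg hlam hp _)]
  rw [secular_reindex _ (coord lam p.1.1), secular_weight hlam hp, Polynomial.map_prod]
  simp

/-- The section of the orbit map by matrices with real nonnegative entries in row zero. -/
def toMatrix (𝕜 : Type) [RCLike 𝕜] (hlam : StrictMono lam) (s : Equiv.Perm (Fin n))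
    (p : blowUp n) : M 𝕜 lam :=
  ⟨_, arrow_mem_isospectral hlam s p⟩

theorem continuous_arrow {X : Type*} [TopologicalSpace X] {a₀ : X → ℝ} {a b : X → Fin n → ℝ}
    (h₀ : Continuous a₀) (ha : ∀ k, Continuous fun x => a x k) (hb : ∀ k, Continuous fun x => b x k) :
    Continuous fun x => arrow 𝕜 (a₀ x) (a x) (b x) := by
  refine continuous_matrix fun i j => ?_
  refine Fin.cases ?_ (fun i => ?_) i <;> refine Fin.cases ?_ (fun j => ?_) j
  · exact RCLike.continuous_ofReal.comp h₀
  · exact RCLike.continuous_ofReal.comp (hb j)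
  · exact RCLike.continuous_ofReal.comp (hb i)
  · simp only [arrow_succ_succ]
    split_ifs
    · exact RCLike.continuous_ofReal.comp (ha i)
    · exact continuous_const

theorem continuous_toMatrix (hlam : StrictMono lam) (s : Equiv.Perm (Fin n)) :
    Continuous (toMatrix 𝕜 hlam s) := by
  refine Continuous.subtype_mk (continuous_arrow ?_ (fun k => continuous_coord lam (s k))
    fun k => (continuous_weight hlam (s k)).sqrt) _
  exact continuous_const.sub (continuous_finsetSum _ fun k _ => continuous_coord lam k)

theorem invariants_toMatrix (hlam : StrictMono lam) (s : Equiv.Perm (Fin n)) (p : blowUp n) :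
    invariants (orb (toMatrix 𝕜 hlam s p)) =
      (Fin.cons (center lam (coord lam p.1.1)) fun k => coord lam p.1.1 (s k),
        fun k => weight lam p.1.1 p.1.2 (s k)) := by
  have hp : (p.1.1, p.1.2) ∈ blowUp n := p.2
  rw [invariants_orb]
  refine Prod.ext (funext fun i => ?_) (funext fun k => ?_)
  · refine Fin.cases ?_ (fun i => ?_) i <;> simp [toMatrix]
  · simp [toMatrix, Real.sq_sqrt (weight_nonneg hlam hp _)]

theorem moment_toMatrix (hlam : StrictMono lam) (s : Equiv.Perm (Fin n)) (p : blowUp n) :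
    moment (orb (toMatrix 𝕜 hlam s p)) = fun k => coord lam p.1.1 (s k) := by
  funext k
  rw [moment, invariants_toMatrix]
  simp

theorem moment_toMatrix_mem (hlam : StrictMono lam) (s : Equiv.Perm (Fin n)) (p : blowUp n) :
    moment (orb (toMatrix 𝕜 hlam s p)) ∈ cubeAt lam s := by
  rw [moment_toMatrix]
  exact fun k => coord_mem hlam p.2.1 (s k)

/-! #### The inverse -/

theorem coord_standardize (hlam : StrictMono lam) (s : Equiv.Perm (Fin n)) (a : Fin n → ℝ)
    (j : Fin n) : coord lam (standardize lam s a) j = a (s.symm j) := by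
  have h : lam j.succ - lam j.castSucc ≠ 0 := (len_pos hlam j).ne'
  rw [coord, standardize, len, mul_div_cancel₀ _ h]
  ring

theorem standardize_coord (hlam : StrictMono lam) (s : Equiv.Perm (Fin n)) (y : Fin n → ℝ) :
    standardize lam s (fun k => coord lam y (s k)) = y := by
  funext j
  have h : lam j.succ - lam j.castSucc ≠ 0 := (len_pos hlam j).ne'
  rw [standardize, Equiv.apply_symm_apply, coord, len, div_eq_iff h]
  ring

theorem standardize_mem_cube (hlam : StrictMono lam) {s : Equiv.Perm (Fin n)} {a : Fin n → ℝ}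
    (ha : a ∈ cubeAt lam s) : standardize lam s a ∈ cube n := by
  intro j
  have h := len_pos hlam j
  have h1 := ha (s.symm j)
  rw [Equiv.apply_symm_apply] at h1
  rw [len] at h
  rw [standardize, Set.mem_Icc, le_div_iff₀ h, div_le_iff₀ h]
  exact ⟨by linarith [h1.1], by linarith [h1.2]⟩

/-- The coordinates of the blow-up in terms of the invariants. -/
def recoverPoint (s : Equiv.Perm (Fin n)) (q : Q 𝕜 lam) : (Fin n → ℝ) × (Cut n → ℝ) :=
  (standardize lam s (moment q),
    recover lam (standardize lam s (moment q)) fun j => (invariants q).2 (s.symm j))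

theorem exists_blowUp_point (hlam : StrictMono lam) {s : Equiv.Perm (Fin n)} {q : Q 𝕜 lam}
    (hq : moment q ∈ cubeAt lam s) :
    recoverPoint s q ∈ blowUp n ∧ weight lam (recoverPoint s q).1 (recoverPoint s q).2 =
      fun j => (invariants q).2 (s.symm j) := by
  have hsec := secular_invariants q
  rw [← secular_reindex _ _ _ s.symm, ← funext (coord_standardize hlam s (moment q))] at hsec
  obtain ⟨t, ht, hw⟩ := exists_weight_eq hlam (standardize_mem_cube hlam hq)
    (fun k => invariants_nonneg q _) hsec
  have h : recoverPoint s q = (standardize lam s (moment q), t) := by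
    rw [recoverPoint, ← hw, recover_weight hlam ht]
  rw [h]
  exact ⟨ht, hw⟩

theorem toMatrix_recoverPoint (hlam : StrictMono lam) {s : Equiv.Perm (Fin n)} {q : Q 𝕜 lam}
    (hq : moment q ∈ cubeAt lam s) :
    orb (toMatrix 𝕜 hlam s ⟨_, (exists_blowUp_point hlam hq).1⟩) = q := by
  have h := (exists_blowUp_point hlam hq).2
  have hc : (fun k => coord lam (recoverPoint s q).1 (s k)) = moment q := by
    funext k
    rw [recoverPoint, coord_standardize hlam, Equiv.symm_apply_apply]
  have h₀ : center lam (coord lam (recoverPoint s q).1) = (invariants q).1 0 := by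
    rw [← center_comp s, hc]
    exact (center_eq (invariants_nonneg q) (secular_invariants q)).symm
  apply invariants_injective
  rw [invariants_toMatrix]
  refine Prod.ext (funext fun i => ?_) (funext fun k => ?_)
  · exact Fin.cases h₀ (fun i => congrFun hc i) i
  · exact (congrFun h (s k)).trans (by rw [Equiv.symm_apply_apply])

/-! ### The diffeomorphism of the blow-up with a sector of the orbit space -/

section Smooth

variable (hlam : StrictMono lam) (s : Equiv.Perm (Fin n))

/-- The part of the orbit space over a cube. -/
abbrev Sector (𝕜 : Type) [RCLike 𝕜] (lam : Fin (n + 1) → ℝ) (s : Equiv.Perm (Fin n)) : Type :=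
  {q : Q 𝕜 lam // moment q ∈ cubeAt lam s}

/-- The invariants as coordinates on the part of the orbit space over a cube. -/
def sectorCoord (q : Sector 𝕜 lam s) : (Fin (n + 1) → ℝ) × (Fin n → ℝ) := invariants q.1

theorem continuous_sectorCoord : Continuous (sectorCoord s : Sector 𝕜 lam s → _) :=
  continuous_invariants.comp continuous_subtype_val

theorem smoothViaAt_standardize (j : Fin n) (q : Sector 𝕜 lam s) :
    SmoothViaAt (sectorCoord s) (fun q : Sector 𝕜 lam s => standardize lam s (moment q.1) j) q := by
  refine SmoothViaAt.of_contDiff (g := fun z : (Fin (n + 1) → ℝ) × (Fin n → ℝ) =>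
    (2 * z.1 (s.symm j).succ - lam j.castSucc - lam j.succ) / (lam j.succ - lam j.castSucc)) ?_
  have : ContDiff ℝ ∞ fun z : (Fin (n + 1) → ℝ) × (Fin n → ℝ) => z.1 (s.symm j).succ :=
    (contDiff_apply ℝ ℝ (s.symm j).succ).comp contDiff_fst
  exact (((contDiff_const.mul this).sub contDiff_const).sub contDiff_const).div_const _

theorem smoothViaAt_sector_coord (j : Fin n) (q : Sector 𝕜 lam s) :
    SmoothViaAt (sectorCoord s)
      (fun q : Sector 𝕜 lam s => coord lam (standardize lam s (moment q.1)) j) q :=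
  (SmoothViaAt.pi fun j => smoothViaAt_standardize s j q).comp (contDiff_coord lam j)

theorem smoothViaAt_gap (i : Cut n) (q : Sector 𝕜 lam s) :
    SmoothViaAt (sectorCoord s)
      (fun q : Sector 𝕜 lam s => gap (standardize lam s (moment q.1)) i) q :=
  (SmoothViaAt.pi fun j => smoothViaAt_standardize s j q).comp (contDiff_gap i)

include hlam

theorem smoothViaAt_pairWeight (i : Cut n) (q : Sector 𝕜 lam s)
    (hi : gap (standardize lam s (moment q.1)) i = 0) :
    SmoothViaAt (sectorCoord s)
      (fun q : Sector 𝕜 lam s => pairWeight lam (standardize lam s (moment q.1)) i) q := by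
  have hp : (standardize lam s (moment q.1), _) ∈ blowUp n := (exists_blowUp_point hlam q.2).1
  have hc := fun j => smoothViaAt_sector_coord s j q
  refine SmoothViaAt.prod fun l hl => ?_
  have hne : l ≠ i.lo → coord lam (standardize lam s (moment q.1)) l ≠ _ := fun h =>
    coord_ne_of_gap_eq_zero hlam hp hi h (Finset.ne_of_mem_erase hl)
  simp only [regularFactor]
  split_ifs with h1 h2
  · exact ((hc _).sub (SmoothViaAt.const _)).mul ((SmoothViaAt.const _).sub (hc _))
  · exact ((hc _).sub (SmoothViaAt.const _)).div (continuous_sectorCoord s) ((hc _).sub (hc _))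
      (sub_ne_zero.mpr (hne h1).symm)
  · exact ((SmoothViaAt.const _).sub (hc _)).div (continuous_sectorCoord s) ((hc _).sub (hc _))
      (sub_ne_zero.mpr (hne h1))

/-- `recover` is defined by cases, but near a collision its second case agrees with the first
formula `unsplit (w / pairWeight)`. That formula needs only that no third entry equals the lower one
and that `pairWeight` is nonzero, and both conditions are open. Away from collisions the quotient by
`gap` is smooth. -/
theorem smoothViaAt_recover (i : Cut n) (q : Sector 𝕜 lam s) :
    SmoothViaAt (sectorCoord s) (fun q : Sector 𝕜 lam s => (recoverPoint s q.1).2 i) q := by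
  have hcont := continuous_sectorCoord (𝕜 := 𝕜) (lam := lam) s
  by_cases hi : gap (standardize lam s (moment q.1)) i = 0
  · obtain ⟨hp, hw⟩ := exists_blowUp_point hlam q.2
    have hpos := pairWeight_pos hlam hp hi
    have hpw := smoothViaAt_pairWeight hlam s i q hi
    have hτ : SmoothViaAt (sectorCoord s) (fun q : Sector 𝕜 lam s =>
        (invariants q.1).2 (s.symm i.lo) /
          pairWeight lam (standardize lam s (moment q.1)) i) q :=
      (SmoothViaAt.of_contDiff (g := fun z : (Fin (n + 1) → ℝ) × (Fin n → ℝ) => z.2 (s.symm i.lo))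
        ((contDiff_apply ℝ ℝ (s.symm i.lo)).comp contDiff_snd)).div hcont hpw hpos.ne'
    have hτq : (invariants q.1).2 (s.symm i.lo) /
        pairWeight lam (standardize lam s (moment q.1)) i = split lam (recoverPoint s q.1).2 i := by
      have h := split_eq_div hlam hp hi
      change _ = weight lam (recoverPoint s q.1).1 (recoverPoint s q.1).2 i.lo / _ at h
      rw [hw] at h
      exact h.symm
    have hden := unsplit_denom_pos hlam i (split_mem hlam (fun i => (hp.2 i).1) i)
    have hun : SmoothViaAt (sectorCoord s) (fun q : Sector 𝕜 lam s => unsplit lam i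
        ((invariants q.1).2 (s.symm i.lo) /
          pairWeight lam (standardize lam s (moment q.1)) i)) q :=
      ((SmoothViaAt.const _).mul hτ).div hcont
        (((SmoothViaAt.const _).mul ((SmoothViaAt.const 1).sub hτ)).add
          ((SmoothViaAt.const _).mul hτ)) (by rw [hτq]; exact hden.ne')
    refine hun.congr ?_
    -- The hypothesis of `weight_lo` persists near `q`, where the pair itself may separate.
    have h1 : ∀ᶠ q' : Sector 𝕜 lam s in 𝓝 q, ∀ l, l ≠ i.lo → l ≠ i.hi →
        coord lam (standardize lam s (moment q'.1)) l ≠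
          coord lam (standardize lam s (moment q'.1)) i.lo := by
      refine Filter.eventually_all.mpr fun l => ?_
      by_cases hl : l ≠ i.lo ∧ l ≠ i.hi
      · filter_upwards [(((smoothViaAt_sector_coord s l q).sub
          (smoothViaAt_sector_coord s i.lo q)).continuousAt hcont).eventually_ne
          (sub_ne_zero.mpr (coord_ne_of_gap_eq_zero hlam hp hi hl.1 hl.2))] with q' hq' _ _
        exact sub_ne_zero.mp hq'
      · exact Filter.Eventually.of_forall fun q' h2 h3 => absurd ⟨h2, h3⟩ hl
    filter_upwards [h1, (hpw.continuousAt hcont).eventually_ne hpos.ne'] with q' h2 h3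
    obtain ⟨hp', hw'⟩ := exists_blowUp_point hlam q'.2
    have h4 := weight_lo hlam hp' h2
    change weight lam (recoverPoint s q'.1).1 (recoverPoint s q'.1).2 i.lo = _ at h4
    rw [hw'] at h4
    have h5 : (invariants q'.1).2 (s.symm i.lo) /
        pairWeight lam (standardize lam s (moment q'.1)) i =
          split lam (recoverPoint s q'.1).2 i := by
      rw [div_eq_iff h3]; exact h4
    rw [h5, unsplit_split hlam fun i => (hp'.2 i).1]
  · have hg := smoothViaAt_gap s i q
    refine (((SmoothViaAt.const 1).sub (smoothViaAt_standardize s i.lo q)).div hcont hg hi).congr ?_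
    filter_upwards [(hg.continuousAt hcont).eventually_ne hi] with q' hq'
    exact if_neg hq'

theorem smoothVia_recoverPoint :
    SmoothVia (sectorCoord s) (fun q : Sector 𝕜 lam s => recoverPoint s q.1) := fun q =>
  (SmoothViaAt.pi fun j => smoothViaAt_standardize s j q).prodMk
    (SmoothViaAt.pi fun i => smoothViaAt_recover hlam s i q)

theorem smoothVia_invariants_toMatrix :
    SmoothVia (Subtype.val : blowUp n → (Fin n → ℝ) × (Cut n → ℝ))
      (fun p => invariants (orb (toMatrix 𝕜 hlam s p))) := by
  intro p
  change SmoothViaAt _ _ p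
  simp only [invariants_toMatrix]
  refine (SmoothViaAt.pi fun i => ?_).prodMk (SmoothViaAt.pi fun k => smoothViaAt_weight hlam _ p)
  refine Fin.cases ?_ (fun i => ?_) i
  · simp only [Fin.cons_zero, center]
    exact (SmoothViaAt.const _).sub (SmoothViaAt.sum fun k _ => smoothViaAt_coord k p)
  · simp only [Fin.cons_succ]
    exact smoothViaAt_coord _ p

/-- The blow-up of the cube is the part of the orbit space over a cube. -/
def sectorHomeo (𝕜 : Type) [RCLike 𝕜] : blowUp n ≃ₜ Sector 𝕜 lam s where
  toFun p := ⟨orb (toMatrix 𝕜 hlam s p), moment_toMatrix_mem hlam s p⟩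
  invFun q := ⟨recoverPoint s q.1, (exists_blowUp_point hlam q.2).1⟩
  left_inv p := by
    refine Subtype.ext (Prod.ext ?_ ?_)
    · change standardize lam s (moment (orb (toMatrix 𝕜 hlam s p))) = _
      rw [moment_toMatrix, standardize_coord hlam]
    · change recover lam (standardize lam s (moment (orb (toMatrix 𝕜 hlam s p))))
        (fun j => (invariants (orb (toMatrix 𝕜 hlam s p))).2 (s.symm j)) = p.1.2
      rw [moment_toMatrix, standardize_coord hlam, invariants_toMatrix]
      simp only [Equiv.apply_symm_apply]
      exact recover_weight hlam p.2
  right_inv q := Subtype.ext (toMatrix_recoverPoint hlam q.2)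
  continuous_toFun := (continuous_orb.comp (continuous_toMatrix hlam s)).subtype_mk _
  continuous_invFun :=
    ((smoothVia_recoverPoint hlam s).continuous (continuous_sectorCoord s)).subtype_mk _

theorem sectorHomeo_isDiffeo (𝕜 : Type) [RCLike 𝕜] :
    IsDiffeo (Subtype.val : blowUp n → (Fin n → ℝ) × (Cut n → ℝ)) (sectorCoord s)
      (sectorHomeo hlam s 𝕜) :=
  ⟨smoothVia_invariants_toMatrix hlam s, smoothVia_recoverPoint hlam s⟩

end Smooth

theorem range_moment (hlam : StrictMono lam) (𝕜 : Type) [RCLike 𝕜] :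
    Set.range (moment : Q 𝕜 lam → Fin n → ℝ) = ⋃ s : Equiv.Perm (Fin n), cubeAt lam s := by
  apply Set.Subset.antisymm
  · rintro _ ⟨q, rfl⟩
    obtain ⟨A, rfl⟩ := orb_surjective q
    exact Set.mem_iUnion.mpr (exists_mem_cubeAt hlam A.2)
  · intro a ha
    obtain ⟨s, hs⟩ := Set.mem_iUnion.mp ha
    refine ⟨orb (toMatrix 𝕜 hlam s ⟨_, lift_mem_blowUp (c := 0) ⟨le_rfl, zero_le_one⟩
      (standardize_mem_cube hlam hs)⟩), ?_⟩
    rw [moment_toMatrix]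
    funext k
    change coord lam (standardize lam s a) (s k) = a k
    rw [coord_standardize hlam, Equiv.symm_apply_apply]

end OrbitSpace

/-! ### Fundamental domains -/

/-- If `φ p` is interior in `X` and `g • φ p = φ q`, then `g⁻¹` maps `φ r` into the domain for all
`r` near `q`. By density one such `r` is interior in the polytope, and there the hypothesis on
interior points gives `g⁻¹ = 1`. -/
theorem isFundamentalDomain_of_interior {G X V : Type*} [Group G] [TopologicalSpace X] [T2Space X]
    [MulAction G X] [ContinuousConstSMul G X] [TopologicalSpace V] {P : Set V} (hP : IsCompact P)
    (hdense : ∀ p : P, p ∈ closure {p : P | p.1 ∈ interior P}) {φ : P → X} (hφ : Continuous φ)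
    (hinj : Function.Injective φ) (hcov : ∀ x : X, ∃ (g : G) (p : P), g • φ p = x)
    (hint : ∀ (g : G) (p q : P), p.1 ∈ interior P → g • φ p = φ q → g = 1) :
    IsFundamentalDomain G P φ where
  embedding := by
    have := isCompact_iff_compactSpace.mp hP
    exact hφ.isClosedEmbedding hinj
  covers := hcov
  interior_polytope := hint
  interior_space g p q hp hpq := by
    have hc : Continuous fun r : P => g⁻¹ • φ r := hφ.const_smul g⁻¹
    have hq : q ∈ (fun r : P => g⁻¹ • φ r) ⁻¹' interior (Set.range φ) := by
      change g⁻¹ • φ q ∈ interior (Set.range φ)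
      rwa [← hpq, inv_smul_smul]
    obtain ⟨r, hr, hr'⟩ := mem_closure_iff.mp (hdense q) _ (isOpen_interior.preimage hc) hq
    obtain ⟨r'', hr''⟩ := interior_subset hr
    exact inv_eq_one.mp (hint g⁻¹ r r'' hr' hr''.symm)

/-! ### The three group actions -/

section Actions

variable {𝕜 : Type} [RCLike 𝕜] {n : ℕ} {lam : Fin (n + 1) → ℝ}

theorem smul_coe (g : N 𝕜 n) (A : M 𝕜 lam) : (g • A).1 = conj g A.1 := rfl

theorem perm_smul_orb (g : Equiv.Perm (Fin n)) (A : M 𝕜 lam) :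
    g • orb A = orb ((SemidirectProduct.inr g : N 𝕜 n) • A) := rfl

theorem orb_smul (g : N 𝕜 n) (A : M 𝕜 lam) : orb (g • A) = g.right • orb A := by
  rw [perm_smul_orb]
  refine orb_eq_orb_iff.mpr ⟨g.left, ?_⟩
  change (SemidirectProduct.inl g.left : N 𝕜 n) • ((SemidirectProduct.inr g.right : N 𝕜 n) • A) = _
  rw [smul_smul, SemidirectProduct.inl_left_mul_inr_right]

theorem moment_smul (g : Equiv.Perm (Fin n)) (q : Q 𝕜 lam) (k : Fin n) :
    moment (g • q) k = moment q (g⁻¹ k) := by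
  obtain ⟨A, rfl⟩ := orb_surjective q
  change RCLike.re (conj (SemidirectProduct.inr g : N 𝕜 n) A.1 k.succ k.succ) =
    RCLike.re (A.1 (g⁻¹ k).succ (g⁻¹ k).succ)
  rw [conj_apply, leafPerm_symm_succ, phase_succ]
  simp

instance instContinuousConstSMulN : ContinuousConstSMul (N 𝕜 n) (M 𝕜 lam) where
  continuous_const_smul g := by
    refine Continuous.subtype_mk (continuous_matrix fun i j => ?_) _
    simp only [conj_apply]
    have h : ∀ i j, Continuous fun A : M 𝕜 lam => A.1 i j := fun i j =>
      (continuous_id.matrix_elem i j).comp continuous_subtype_val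
    exact (continuous_const.mul (h _ _)).mul continuous_const

instance instContinuousConstSMulPerm : ContinuousConstSMul (Equiv.Perm (Fin n)) (Q 𝕜 lam) where
  continuous_const_smul g := continuous_quot_lift _
    (continuous_orb.comp (continuous_const_smul (SemidirectProduct.inr g : N 𝕜 n)))

instance instT2SpaceQ : T2Space (Q 𝕜 lam) :=
  .of_injective_continuous invariants_injective continuous_invariants

theorem eq_of_mem_Ioo_of_mem_Icc (hlam : StrictMono lam) {i j : Fin n} {x : ℝ}
    (hi : x ∈ Set.Ioo (lam i.castSucc) (lam i.succ))
    (hj : x ∈ Set.Icc (lam j.castSucc) (lam j.succ)) : i = j := by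
  rcases lt_trichotomy i j with h | h | h
  · have := hlam.monotone (Fin.succ_le_castSucc_iff.mpr h)
    linarith [hi.2, hj.1]
  · exact h
  · have := hlam.monotone (Fin.succ_le_castSucc_iff.mpr h)
    linarith [hi.1, hj.2]

variable {ε : ℝ} {ρ κ : ℝ → ℝ} (h : IsProfile ε ρ κ) (h0 : 0 < ε) (h1 : ε < 1)
  (hlam : StrictMono lam) (s : Equiv.Perm (Fin n))

/-- The diffeomorphism of the polytope with the part of the orbit space over a cube. -/
def polytopeHomeo (𝕜 : Type) [RCLike 𝕜] : B n ε ≃ₜ Sector 𝕜 lam s :=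
  (blowUpHomeo h h0 h1).trans (sectorHomeo hlam s 𝕜)

/-- Its lift to isospectral matrices. -/
def polytopeLift (𝕜 : Type) [RCLike 𝕜] (x : B n ε) : M 𝕜 lam :=
  toMatrix 𝕜 hlam s (blowUpHomeo h h0 h1 x)

theorem orb_polytopeLift (x : B n ε) :
    orb (polytopeLift h h0 h1 hlam s 𝕜 x) = (polytopeHomeo h h0 h1 hlam s 𝕜 x).1 := rfl

theorem moment_polytopeHomeo (x : B n ε) :
    moment (polytopeHomeo h h0 h1 hlam s 𝕜 x).1 = fun k => coord lam (down ρ x.1) (s k) :=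
  moment_toMatrix hlam s _

theorem isBlowDown_moment : IsBlowDown ε
    (fun x => standardize lam s (moment (polytopeHomeo h h0 h1 hlam s 𝕜 x).1)) := by
  have : (fun x => standardize lam s (moment (polytopeHomeo h h0 h1 hlam s 𝕜 x).1)) =
      fun x : B n ε => (blowUpHomeo h h0 h1 x).1.1 := funext fun x => by
    rw [moment_polytopeHomeo, standardize_coord hlam]; rfl
  rw [this]
  exact blowUpHomeo_isBlowDown h h0 h1

/-- Over the interior each diagonal entry lies in an open interval that meets no other closed one,
so its value determines its position within the cube. -/
theorem perm_eq_one_of_interior (g : Equiv.Perm (Fin n)) (p q : B n ε)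
    (hp : p.1 ∈ interior (B n ε))
    (hpq : g • (polytopeHomeo h h0 h1 hlam s 𝕜 p).1 = (polytopeHomeo h h0 h1 hlam s 𝕜 q).1) :
    g = 1 := by
  have hg : ∀ k, g⁻¹ k = k := fun k => by
    have h2 := congrFun (congrArg moment hpq) k
    rw [moment_smul, moment_polytopeHomeo] at h2
    have h3 := coord_mem_Ioo hlam (down_mem_Ioo_of_mem_interior h h0 hp) (s (g⁻¹ k))
    have h4 := (polytopeHomeo h h0 h1 hlam s 𝕜 q).2 k
    rw [← h2] at h4
    exact s.injective (eq_of_mem_Ioo_of_mem_Icc hlam h3 h4)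
  exact inv_eq_one.mp (Equiv.ext hg)

theorem exists_perm_smul_eq (q : Q 𝕜 lam) : ∃ (g : Equiv.Perm (Fin n)) (p : B n ε),
    g • (polytopeHomeo h h0 h1 hlam s 𝕜 p).1 = q := by
  have hq : moment q ∈ ⋃ s, cubeAt lam s := range_moment hlam 𝕜 ▸ Set.mem_range_self q
  obtain ⟨r, hr⟩ := Set.mem_iUnion.mp hq
  -- Entry `k` of the translate is the entry `(r⁻¹ * s) k` of `q`, which lies in the interval with
  -- index `r ((r⁻¹ * s) k) = s k`.
  have hmem : moment ((r⁻¹ * s)⁻¹ • q) ∈ cubeAt lam s := fun k => by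
    rw [moment_smul]
    simpa using hr ((r⁻¹ * s) k)
  refine ⟨r⁻¹ * s, (polytopeHomeo h h0 h1 hlam s 𝕜).symm ⟨_, hmem⟩, ?_⟩
  rw [Homeomorph.apply_symm_apply, smul_inv_smul]

theorem isFundamentalDomain_perm : IsFundamentalDomain (Equiv.Perm (Fin n)) (B n ε)
    (fun x => (polytopeHomeo h h0 h1 hlam s 𝕜 x).1) :=
  isFundamentalDomain_of_interior (isCompact_B ε) (mem_closure_interior_subtype h1)
    (continuous_subtype_val.comp (polytopeHomeo h h0 h1 hlam s 𝕜).continuous)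
    (Subtype.val_injective.comp (polytopeHomeo h h0 h1 hlam s 𝕜).injective)
    (exists_perm_smul_eq h h0 h1 hlam s) (perm_eq_one_of_interior h h0 h1 hlam s)

theorem polytopeLift_injective : Function.Injective (polytopeLift h h0 h1 hlam s 𝕜) := fun _ _ hpq =>
  (polytopeHomeo h h0 h1 hlam s 𝕜).injective (Subtype.ext (congrArg orb hpq))

theorem polytopeLift_ne_zero {p : B n ε} (hp : p.1 ∈ interior (B n ε)) (k : Fin n) :
    (polytopeLift h h0 h1 hlam s 𝕜 p).1 0 k.succ ≠ 0 := by
  have hb : (down ρ p.1, angle ρ p.1) ∈ blowUp n := down_mem_blowUp h h0 p.2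
  have hw := weight_ne_zero hlam hb (down_mem_Ioo_of_mem_interior h h0 hp) (s k)
  have hw' := lt_of_le_of_ne (weight_nonneg hlam hb (s k)) hw.symm
  exact RCLike.ofReal_ne_zero.mpr (Real.sqrt_pos.mpr hw').ne'

/-- Passing to `Q` kills the permutation part of `g`, and then `p = q`. The torus part fixes row
zero, whose entries do not vanish over the interior, so all its phases are `1`. -/
theorem isFundamentalDomain_lift :
    IsFundamentalDomain (N 𝕜 n) (B n ε) (polytopeLift h h0 h1 hlam s 𝕜) := by
  refine isFundamentalDomain_of_interior (isCompact_B ε) (mem_closure_interior_subtype h1)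
    ((continuous_toMatrix hlam s).comp (blowUpHomeo h h0 h1).continuous)
    (polytopeLift_injective h h0 h1 hlam s) (fun A => ?_) fun g p q hp hpq => ?_
  · obtain ⟨g, p, hgp⟩ := exists_perm_smul_eq h h0 h1 hlam s (orb A)
    rw [← orb_polytopeLift, perm_smul_orb, eq_comm] at hgp
    obtain ⟨t, ht⟩ := orb_eq_orb_iff.mp hgp
    refine ⟨SemidirectProduct.inl t * SemidirectProduct.inr g, p, ?_⟩
    rw [mul_smul]
    exact ht
  · have hright : g.right = 1 := perm_eq_one_of_interior (𝕜 := 𝕜) h h0 h1 hlam s g.right p q hp (by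
      rw [← orb_polytopeLift, ← orb_polytopeLift, ← orb_smul, hpq])
    have hpq' : p = q := (polytopeHomeo h h0 h1 hlam s 𝕜).injective (Subtype.ext (by
      rw [← orb_polytopeLift, ← orb_polytopeLift, ← hpq, orb_smul, hright, one_smul]))
    subst hpq'
    refine SemidirectProduct.ext (funext fun k => Subtype.ext ?_) hright
    have h2 := congrFun (congrFun (congrArg Subtype.val hpq) 0) k.succ
    rw [smul_coe, conj_apply, hright, phase_zero, phase_succ, leafPerm_symm_zero,
      leafPerm_symm_succ, one_mul, inv_one, Equiv.Perm.one_apply] at h2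
    have h3 := mul_left_cancel₀ (polytopeLift_ne_zero h h0 h1 hlam s hp k)
      (h2.trans (mul_one _).symm)
    exact star_injective (h3.trans (star_one 𝕜).symm)

end Actions
end ArrowMatrix
end

theorem mainTheorem5 (n : ℕ) (lam : Fin (n + 1) → ℝ) (hlam : StrictMono lam)
    (ε : ℝ) (hε : 0 < ε) (hε' : ε < 1) :
    Set.range (ArrowMatrix.moment : ArrowMatrix.Q ℂ lam → Fin n → ℝ) =
      ⋃ s : Equiv.Perm (Fin n), ArrowMatrix.cubeAt lam s ∧
    ∀ s : Equiv.Perm (Fin n),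
    ∃ (Φ : ArrowMatrix.B n ε ≃ₜ
          {q : ArrowMatrix.Q ℂ lam // ArrowMatrix.moment q ∈ ArrowMatrix.cubeAt lam s})
      (Ψ : ArrowMatrix.B n ε → ArrowMatrix.M ℂ lam)
      (Ψr : ArrowMatrix.B n ε → ArrowMatrix.M ℝ lam),
      ArrowMatrix.IsDiffeo (fun x : ArrowMatrix.B n ε => x.1)
        (fun q => ArrowMatrix.invariants q.1) Φ ∧
      ArrowMatrix.IsBlowDown ε
        (fun x => ArrowMatrix.standardize lam s (ArrowMatrix.moment (Φ x).1)) ∧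
      (∀ x, ArrowMatrix.orb (Ψ x) = (Φ x).1) ∧
      (∀ x, (Ψ x).1 = (Ψr x).1.map Complex.ofReal) ∧
      ArrowMatrix.IsFundamentalDomain (Equiv.Perm (Fin n)) (ArrowMatrix.B n ε)
        (fun x => (Φ x).1) ∧
      ArrowMatrix.IsFundamentalDomain (ArrowMatrix.N ℂ n) (ArrowMatrix.B n ε) Ψ ∧
      ArrowMatrix.IsFundamentalDomain (ArrowMatrix.N ℝ n) (ArrowMatrix.B n ε) Ψr := by
  obtain ⟨ρ, κ, h⟩ := ArrowMatrix.exists_isProfile hε hε'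
  refine ⟨ArrowMatrix.range_moment hlam ℂ, fun s =>
    ⟨ArrowMatrix.polytopeHomeo h hε hε' hlam s ℂ, ArrowMatrix.polytopeLift h hε hε' hlam s ℂ,
      ArrowMatrix.polytopeLift h hε hε' hlam s ℝ,
      (ArrowMatrix.blowUpHomeo_isDiffeo h hε hε').trans (ArrowMatrix.sectorHomeo_isDiffeo hlam s ℂ),
      ArrowMatrix.isBlowDown_moment h hε hε' hlam s,
      ArrowMatrix.orb_polytopeLift h hε hε' hlam s, fun x => ?_,
      ArrowMatrix.isFundamentalDomain_perm h hε hε' hlam s,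
      ArrowMatrix.isFundamentalDomain_lift h hε hε' hlam s,
      ArrowMatrix.isFundamentalDomain_lift h hε hε' hlam s⟩⟩
  -- Both lifts are `arrow` with the same real data over the two fields.
  ext i j
  rw [Matrix.map_apply]
  refine Fin.cases ?_ (fun i => ?_) i <;> refine Fin.cases ?_ (fun j => ?_) j
  · rfl
  · rfl
  · rfl
  · change ArrowMatrix.arrow ℂ _ _ _ i.succ j.succ =
      Complex.ofReal (ArrowMatrix.arrow ℝ _ _ _ i.succ j.succ)
    rw [ArrowMatrix.arrow_succ_succ, ArrowMatrix.arrow_succ_succ]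
    split_ifs
    · rfl
    · simp
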